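/- Let $F_n$ be the free group on $x_1,\dots,x_n$ and, for $i\neq j$, let $\alpha_{ij}\in \mathrm{Aut}(F_n)$ be the automorphism with $\alpha_{ij}(x_i)=x_jx_ix_j^{-1}$ and $\alpha_{ij}(x_r)=x_r$ for $r\neq i$. Let $P\Sigma_n^+$ be the subgroup of $\mathrm{Aut}(F_n)$ generated by the $\alpha_{ij}$ with $1\le j<i\le n$. For $1\le j\le m-1\le n-1$ let $G(n,m,j)\le P\Sigma_n^+$ be the subgroup generated by $\alpha_{m,1},\dots,\alpha_{m,j}$, and for $2\le k\le n$ put $$H(n,k)=G(n,k,k-1)\times G(n,k+1,k-1)\times\cdots\times G(n,n,k-1),$$ a direct product of $n-k+1$ groups. For a group $\pi$ let $\Gamma^1\pi=\pi$, $\Gamma^{s+1}\pi=[\pi,\Gamma^s\pi]$ and $gr_s^{DCS}(\pi)=\Gamma^s\pi/\Gamma^{s+1}\pi$. Let $V_q$ be a free abelian group of rank $q$, let $L[V_q]$ be the smallest Lie subalgebra of the tensor algebra $T[V_q]$ (over $\mathbb Z$) that contains $V_q$, and let $L_s[V_q]=L[V_q]\cap V_q^{\otimes s}$. Write $W^*=\mathrm{Hom}(W,\mathbb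 Z)$, and regard $\mathbb Z\oplus W^*$ as a graded algebra with $\mathbb Z$ in degree $0$, $W^*$ in degree $1$, and $W^*\cdot W^*=0$. Tensor products of graded algebras carry the total grading and the multiplication $(a\otimes b)(a'\otimes b')=(-1)^{|b||a'|}aa'\otimes bb'$. Cohomology is group cohomology with trivial coefficients $\mathbb Z$, with the cup product. Assume $2\le k\le n$. 1. There are isomorphisms of graded algebras $$H^*(H(n,k);\mathbb Z)\cong\bigotimes_{n-k+1}\bigl(\mathbb Z\oplus L_1[V_{k-1}]^*\bigr)\cong\bigotimes_{n-k+1}\bigl(\mathbb Z\oplus V_{k-1}^*\bigr).$$ 2. For every $s\ge1$, the image of the homomorphism $H^*(gr_s^{DCS}H(n,k);\mathbb Z)\to H^*(\Gamma^sH(n,k);\mathbb Z)$ induced by the quotient map $\Gamma^sH(n,k)\to gr_s^{DCS}H(n,k)$ is a subalgebra of $H^*(\Gamma^sH(n,k);\mathbb Z)$ that is isomorphic, as a graded algebra, to $$\bigotimes_{n-k+1}\bigl(\mathbb Z\oplus L_s[V_{k-1}]^*\bigr).$$ -/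

import Mathlib

noncomputable section

namespace McCool

open CategoryTheory
open scoped TensorProduct DirectSum

section Cohomology

variable (G : Type) [Group G]

/-- Inhomogeneous `n`-cochains of `G` with coefficients in the trivial module `ℤ`. -/
abbrev Coch (n : ℕ) : Type := (Fin n → G) → ℤ
/-- `H^n(G; ℤ)`, trivial coefficients. -/
abbrev HZ (n : ℕ) : Type := groupCohomology (Rep.trivial ℤ G ℤ) n
/-- Cocycles of degree `n`. -/
abbrev Cocyc (n : ℕ) : Type := groupCohomology.cocycles (Rep.trivial ℤ G ℤ) n

variable {G}
/-- The differential of inhomogeneous cochains. -/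
def δ {n : ℕ} (f : Coch G n) : Coch G (n + 1) := inhomogeneousCochains.d (Rep.trivial ℤ G ℤ) n f

theorem δ_apply {n : ℕ} (f : Coch G n) (x : Fin (n + 1) → G) :
    δ f x = f (fun i => x i.succ) + ∑ j : Fin (n + 1), (-1 : ℤ) ^ ((j : ℕ) + 1) * f (Fin.contractNth j (· * ·) x) := by
  simp [δ, inhomogeneousCochains.d]

/-- The cochain underlying a cocycle. -/
def val {n : ℕ} (z : Cocyc G n) : Coch G n := groupCohomology.iCocycles (Rep.trivial ℤ G ℤ) n z
/-- The cohomology class of a cocycle. -/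
def cls {n : ℕ} (z : Cocyc G n) : HZ G n := groupCohomology.π (Rep.trivial ℤ G ℤ) n z
/-- A cocycle from a cochain with zero differential. -/
def mkCocyc {n : ℕ} (f : Coch G n) (h : δ f = 0) : Cocyc G n := groupCohomology.cocyclesMk (A := Rep.trivial ℤ G ℤ) f h

theorem val_mkCocyc {n : ℕ} (f : Coch G n) (h : δ f = 0) : val (mkCocyc f h) = f := groupCohomology.iCocycles_mk (A := Rep.trivial ℤ G ℤ) f h

theorem val_injective {n : ℕ} : Function.Injective (val : Cocyc G n → Coch G n) :=
  (ModuleCat.mono_iff_injective _).1 inferInstance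

theorem δ_val {n : ℕ} (z : Cocyc G n) : δ (val z) = 0 := by
  have := (groupCohomology.inhomogeneousCochains (Rep.trivial ℤ G ℤ)).iCycles_d n (n+1)
  rw [groupCohomology.inhomogeneousCochains.d_def] at this
  exact congr($this z)

theorem cls_surjective {n : ℕ} : Function.Surjective (cls : Cocyc G n → HZ G n) :=
  fun x => groupCohomology_induction_on x fun z => ⟨z, rfl⟩

theorem exists_toCocycles {n : ℕ} (z : Cocyc G n) (hz : cls z = 0) (m : ℕ)
    (hm : (ComplexShape.up ℕ).prev n = m) :
    ∃ f : Coch G m, groupCohomology.toCocycles (Rep.trivial ℤ G ℤ) m n f = z := by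
  have hex := ShortComplex.exact_of_g_is_cokernel
    (ShortComplex.mk _ _ ((groupCohomology.inhomogeneousCochains
      (Rep.trivial ℤ G ℤ)).toCycles_comp_homologyπ m n))
    ((groupCohomology.inhomogeneousCochains (Rep.trivial ℤ G ℤ)).homologyIsCokernel m n hm)
  exact (ShortComplex.moduleCat_exact_iff _).1 hex z hz

theorem val_toCocycles {n : ℕ} (f : Coch G n) :
    val (groupCohomology.toCocycles (Rep.trivial ℤ G ℤ) n (n + 1) f : Cocyc G (n + 1)) = δ f := by
  have := (groupCohomology.inhomogeneousCochains (Rep.trivial ℤ G ℤ)).toCycles_i n (n + 1)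
  rw [groupCohomology.inhomogeneousCochains.d_def] at this
  exact congr($this f)

theorem cls_eq_zero_of_δ {m n : ℕ} (h : m + 1 = n) (z : Cocyc G n) (f : Coch G m)
    (hf : ∀ x, δ f (x ∘ Fin.cast h) = val z x) : cls z = 0 := by
  subst h
  have hz : groupCohomology.toCocycles (Rep.trivial ℤ G ℤ) m (m + 1) f = z :=
    val_injective (by rw [val_toCocycles]; exact funext hf)
  rw [← hz]
  exact congr($((groupCohomology.inhomogeneousCochains
    (Rep.trivial ℤ G ℤ)).toCycles_comp_homologyπ m (m + 1)) f)

theorem exists_δ_of_cls_eq_zero {m : ℕ} (z : Cocyc G (m + 1)) (hz : cls z = 0) :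
    ∃ f : Coch G m, δ f = val z := by
  obtain ⟨f, rfl⟩ := exists_toCocycles z hz m (by simp)
  exact ⟨f, (val_toCocycles f).symm⟩

theorem eq_zero_of_cls_eq_zero (z : Cocyc G 0) (hz : cls z = 0) : z = 0 := by
  obtain ⟨f, rfl⟩ := exists_toCocycles z hz 0 (by simp)
  have : groupCohomology.toCocycles (Rep.trivial ℤ G ℤ) 0 0 = 0 := by
    rw [← cancel_mono ((groupCohomology.inhomogeneousCochains (Rep.trivial ℤ G ℤ)).iCycles 0)]
    rw [HomologicalComplex.toCycles_i, HomologicalComplex.shape _ _ _ (by simp)]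
    simp
  exact congr($this f)

/-- The cup product of cochains,
`(f ∪ g)(x₁, …, x_{p+q}) = f(x₁, …, x_p) g(x_{p+1}, …, x_{p+q})`. -/
def cupC {p q : ℕ} (f : Coch G p) (g : Coch G q) : Coch G (p + q) :=
  fun x => f (fun i => x (Fin.castAdd q i)) * g (fun j => x (Fin.natAdd p j))

theorem leibniz {p q : ℕ} (f : Coch G p) (g : Coch G q) (x : Fin (p + q + 1) → G) :
    δ (cupC f g) x =
      cupC (δ f) g (x ∘ Fin.cast (by omega)) +
        (-1) ^ p * cupC f (δ g) (x ∘ Fin.cast (by omega)) := by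
  have hC : ∀ (n : ℕ) (j : Fin (n + 1)) (y : Fin (n + 1) → G) (k : Fin n),
      Fin.contractNth j (· * ·) y k = if (k : ℕ) < j then y k.castSucc else
        if (k : ℕ) = j then y k.castSucc * y k.succ else y k.succ := fun _ _ _ _ => rfl
  have hsum := Fin.sum_univ_add (a := p) (b := q + 1) fun j : Fin (p + q + 1) =>
    (-1 : ℤ) ^ ((j : ℕ) + 1) * cupC f g (Fin.contractNth j (· * ·) x)
  have hx : ∀ {a b : ℕ} (ha : a < p + q + 1) (hb : b < p + q + 1), a = b → x ⟨a, ha⟩ = x ⟨b, hb⟩ :=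
    fun _ _ h => by subst h; rfl
  -- contraction inside the first block
  have h1 : ∀ i : Fin p, cupC f g (Fin.contractNth (n := p + q) (Fin.castAdd (q + 1) i) (· * ·) x) =
      f (Fin.contractNth i.castSucc (· * ·) fun j : Fin (p + 1) => x ⟨j, by omega⟩) *
        g (fun j => x ⟨p + 1 + j, by omega⟩) := by
    intro i
    refine congrArg₂ (· * ·) (congrArg f (funext fun k => ?_)) (congrArg g (funext fun k => ?_))
    · simp only [hC]
      rfl
    · simp only [hC, Fin.val_natAdd, Fin.val_castAdd]
      rw [if_neg (by omega), if_neg (by omega)]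
      refine congrArg x (Fin.ext ?_)
      simp
      try omega
  -- contraction inside the second block
  have h2 : ∀ i : Fin (q + 1),
      cupC f g (Fin.contractNth (n := p + q) (Fin.natAdd p i) (· * ·) x) =
      f (fun j => x ⟨j, by omega⟩) *
        g (Fin.contractNth i (· * ·) fun j : Fin (q + 1) => x ⟨p + j, by omega⟩) := by
    intro i
    refine congrArg₂ (· * ·) (congrArg f (funext fun k => ?_)) (congrArg g (funext fun k => ?_))
    · simp only [hC, Fin.val_natAdd, Fin.val_castAdd]
      rw [if_pos (by omega)]
      rfl
    · simp only [hC, Fin.val_natAdd, add_lt_add_iff_left, add_right_inj]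
      rfl
  have h4 : (Fin.contractNth (Fin.last p) (· * ·) fun j : Fin (p + 1) => x ⟨j, by omega⟩) =
      fun j : Fin p => x ⟨j, by omega⟩ := by
    funext k
    simp only [hC]
    rw [if_pos (by simp)]
    rfl
  have e1 : δ (cupC f g) x = f (fun j => x ⟨j + 1, by omega⟩) * g (fun j => x ⟨p + 1 + j, by omega⟩) +
      ∑ j : Fin (p + q + 1), (-1 : ℤ) ^ ((j : ℕ) + 1) * cupC f g (Fin.contractNth j (· * ·) x) := by
    rw [δ_apply]
    refine congrArg (· + _) (congrArg₂ (· * ·) rfl (congrArg g (funext fun k => ?_)))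
    refine congrArg x (Fin.ext ?_)
    simp
    try omega
  have e2 : cupC (δ f) g (x ∘ Fin.cast (by omega)) =
      (f (fun j => x ⟨j + 1, by omega⟩) + ∑ i : Fin (p + 1), (-1 : ℤ) ^ ((i : ℕ) + 1) *
        f (Fin.contractNth i (· * ·) fun j : Fin (p + 1) => x ⟨j, by omega⟩)) *
        g (fun j => x ⟨p + 1 + j, by omega⟩) := by
    simp only [cupC, δ_apply]
    rfl
  have e3 : cupC f (δ g) (x ∘ Fin.cast (by omega)) = f (fun j => x ⟨j, by omega⟩) *
      (g (fun j => x ⟨p + 1 + j, by omega⟩) + ∑ i : Fin (q + 1), (-1 : ℤ) ^ ((i : ℕ) + 1) *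
        g (Fin.contractNth i (· * ·) fun j : Fin (q + 1) => x ⟨p + j, by omega⟩)) := by
    simp only [cupC, δ_apply]
    refine congrArg₂ (· * ·) rfl (congrArg (· + _) (congrArg g (funext fun k => ?_)))
    refine congrArg x (Fin.ext ?_)
    simp
    try omega
  rw [Fin.sum_univ_castSucc (n := p), h4] at e2
  have s1 : ∑ i : Fin p, (-1 : ℤ) ^ ((Fin.castAdd (q + 1) i : ℕ) + 1) *
      cupC f g (Fin.contractNth (n := p + q) (Fin.castAdd (q + 1) i) (· * ·) x) =
      (∑ i : Fin p, (-1 : ℤ) ^ ((i.castSucc : ℕ) + 1) *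
        f (Fin.contractNth i.castSucc (· * ·) fun j : Fin (p + 1) => x ⟨j, by omega⟩)) *
        g (fun j => x ⟨p + 1 + j, by omega⟩) := by
    rw [Finset.sum_mul]
    exact Finset.sum_congr rfl fun i _ => by
      rw [h1, mul_assoc, Fin.val_castAdd, Fin.val_castSucc]
  have s2 : ∑ i : Fin (q + 1), (-1 : ℤ) ^ ((Fin.natAdd p i : ℕ) + 1) *
      cupC f g (Fin.contractNth (n := p + q) (Fin.natAdd p i) (· * ·) x) =
      (-1) ^ p * (f (fun j => x ⟨j, by omega⟩) * ∑ i : Fin (q + 1), (-1 : ℤ) ^ ((i : ℕ) + 1) *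
        g (Fin.contractNth i (· * ·) fun j : Fin (q + 1) => x ⟨p + j, by omega⟩)) := by
    rw [Finset.mul_sum, Finset.mul_sum]
    exact Finset.sum_congr rfl fun i _ => by
      rw [h2, Fin.val_natAdd, add_assoc, pow_add]
      ring
  rw [e1.trans (congrArg (_ + ·) (hsum.trans (congrArg₂ (· + ·) s1 s2))), e2, e3, Fin.val_last]
  generalize (∑ i : Fin p, (-1 : ℤ) ^ ((i.castSucc : ℕ) + 1) * _) = S
  generalize (∑ i : Fin (q + 1), (-1 : ℤ) ^ ((i : ℕ) + 1) * _) = T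
  ring

/-- The cup product of cocycles. -/
def cupZ {p q : ℕ} (z : Cocyc G p) (w : Cocyc G q) : Cocyc G (p + q) :=
  mkCocyc (cupC (val z) (val w)) (by
    funext x
    rw [leibniz, δ_val, δ_val]
    simp [cupC])

theorem val_cupZ {p q : ℕ} (z : Cocyc G p) (w : Cocyc G q) : val (cupZ z w) = cupC (val z) (val w) :=
  val_mkCocyc _ _

theorem val_add {n : ℕ} (z w : Cocyc G n) : val (z + w) = val z + val w := map_add _ z w
theorem val_zero {n : ℕ} : val (0 : Cocyc G n) = 0 := map_zero (groupCohomology.iCocycles (Rep.trivial ℤ G ℤ) n).hom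
theorem val_sub {n : ℕ} (z w : Cocyc G n) : val (z - w) = val z - val w := map_sub (groupCohomology.iCocycles (Rep.trivial ℤ G ℤ) n).hom z w
theorem cls_add {n : ℕ} (z w : Cocyc G n) : cls (z + w) = cls z + cls w := map_add (groupCohomology.π (Rep.trivial ℤ G ℤ) n).hom z w
theorem cls_sub {n : ℕ} (z w : Cocyc G n) : cls (z - w) = cls z - cls w := map_sub (groupCohomology.π (Rep.trivial ℤ G ℤ) n).hom z w
theorem cls_zero {n : ℕ} : cls (0 : Cocyc G n) = 0 := map_zero (groupCohomology.π (Rep.trivial ℤ G ℤ) n).hom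

theorem cls_cupZ_left {p q : ℕ} (z : Cocyc G p) (w : Cocyc G q) (hz : cls z = 0) : cls (cupZ z w) = 0 := by
  cases p with
  | zero =>
    rw [eq_zero_of_cls_eq_zero z hz]
    have : cupZ (0 : Cocyc G 0) w = 0 := val_injective (by
      rw [val_cupZ, val_zero, val_zero]; funext x; simp [cupC])
    rw [this, cls_zero]
  | succ p =>
    obtain ⟨f, hf⟩ := exists_δ_of_cls_eq_zero z hz
    refine cls_eq_zero_of_δ (m := p + q) (by omega) _ (cupC f (val w)) fun x => ?_
    rw [leibniz, δ_val, hf, val_cupZ]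
    have : cupC f (0 : Coch G (q + 1)) = 0 := by funext x; simp [cupC]
    rw [this]
    simp [Function.comp_def]

theorem cls_cupZ_right {p q : ℕ} (z : Cocyc G p) (w : Cocyc G q) (hw : cls w = 0) :
    cls (cupZ z w) = 0 := by
  cases q with
  | zero =>
    rw [eq_zero_of_cls_eq_zero w hw]
    have : cupZ z (0 : Cocyc G 0) = 0 := val_injective (by
      rw [val_cupZ, val_zero, val_zero]; funext x; simp [cupC])
    rw [this, cls_zero]
  | succ q =>
    obtain ⟨f, hf⟩ := exists_δ_of_cls_eq_zero w hw
    refine cls_eq_zero_of_δ (m := p + q) (by omega) _ ((-1) ^ p • cupC (val z) f) fun x => ?_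
    have hs : δ ((-1 : ℤ) ^ p • cupC (val z) f) = (-1 : ℤ) ^ p • δ (cupC (val z) f) :=
      map_smul (inhomogeneousCochains.d (Rep.trivial ℤ G ℤ) (p + q)).hom _ _
    rw [hs, Pi.smul_apply, leibniz, δ_val, hf, val_cupZ]
    have : cupC (0 : Coch G (p + 1)) f = 0 := by funext x; simp [cupC]
    rw [this, smul_eq_mul, Pi.zero_apply, zero_add, ← mul_assoc, ← mul_pow]
    simp

/-- The cup product on cohomology: the class of the cup product of representing cocycles
(independent of the representatives by `cup_cls`). -/
def cup {p q : ℕ} (a : HZ G p) (b : HZ G q) : HZ G (p + q) :=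
  cls (cupZ (Function.surjInv cls_surjective a) (Function.surjInv cls_surjective b))

theorem cupZ_add {p q : ℕ} (z : Cocyc G p) (w w' : Cocyc G q) : cupZ z (w + w') = cupZ z w + cupZ z w' :=
  val_injective (by simp only [val_add, val_cupZ]; funext x; simp [cupC, mul_add])

theorem add_cupZ {p q : ℕ} (z z' : Cocyc G p) (w : Cocyc G q) : cupZ (z + z') w = cupZ z w + cupZ z' w :=
  val_injective (by simp only [val_add, val_cupZ]; funext x; simp [cupC, add_mul])

theorem cls_cupZ_congr {p q : ℕ} {z z' : Cocyc G p} {w w' : Cocyc G q} (hz : cls z = cls z')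
    (hw : cls w = cls w') : cls (cupZ z w) = cls (cupZ z' w') := by
  have h1 : cls (cupZ (z - z') w) = 0 := cls_cupZ_left _ _ (by rw [cls_sub, hz, sub_self])
  have h2 : cls (cupZ z' (w - w')) = 0 := cls_cupZ_right _ _ (by rw [cls_sub, hw, sub_self])
  have e1 : cupZ z w = cupZ (z - z') w + cupZ z' (w - w') + cupZ z' w' := by
    rw [add_assoc, ← cupZ_add, sub_add_cancel, ← add_cupZ, sub_add_cancel]
  rw [e1, cls_add, cls_add, h1, h2, zero_add, zero_add]

theorem cup_cls {p q : ℕ} (z : Cocyc G p) (w : Cocyc G q) : cup (cls z) (cls w) = cls (cupZ z w) :=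
  cls_cupZ_congr (Function.surjInv_eq _ _) (Function.surjInv_eq _ _)

/-- The constant `0`-cocycle `1`. -/
def oneZ : Cocyc G 0 := mkCocyc (fun _ => 1) (by
  funext x
  rw [δ_apply]
  simp)

theorem val_oneZ : val (oneZ : Cocyc G 0) = fun _ => 1 := val_mkCocyc _ _

instance : GradedMonoid.GOne (HZ G) := ⟨cls oneZ⟩
instance : GradedMonoid.GMul (HZ G) := ⟨fun {_ _} => cup⟩

theorem gradedMk_eq {m n : ℕ} (h : n = m) (z : Cocyc G m) (w : Cocyc G n)
    (hzw : ∀ x, val z x = val w (x ∘ Fin.cast h)) :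
    (GradedMonoid.mk m (cls z) : GradedMonoid (HZ G)) = GradedMonoid.mk n (cls w) := by
  subst h
  have : z = w := val_injective (funext hzw)
  rw [this]

instance : DirectSum.GRing (HZ G) where
  mul_zero a := by
    obtain ⟨z, rfl⟩ := cls_surjective a
    rw [← cls_zero]
    exact (cup_cls _ _).trans (cls_cupZ_right _ _ cls_zero)
  zero_mul a := by
    obtain ⟨z, rfl⟩ := cls_surjective a
    rw [← cls_zero]
    exact (cup_cls _ _).trans (cls_cupZ_left _ _ cls_zero)
  mul_add a b c := by
    obtain ⟨a, rfl⟩ := cls_surjective a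
    obtain ⟨b, rfl⟩ := cls_surjective b
    obtain ⟨c, rfl⟩ := cls_surjective c
    change cup (cls a) (cls b + cls c) = cup (cls a) (cls b) + cup (cls a) (cls c)
    rw [← cls_add, cup_cls, cup_cls, cup_cls, cupZ_add, cls_add]
  add_mul a b c := by
    obtain ⟨a, rfl⟩ := cls_surjective a
    obtain ⟨b, rfl⟩ := cls_surjective b
    obtain ⟨c, rfl⟩ := cls_surjective c
    change cup (cls a + cls b) (cls c) = cup (cls a) (cls c) + cup (cls b) (cls c)
    rw [← cls_add, cup_cls, cup_cls, cup_cls, add_cupZ, cls_add]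
  one_mul := by
    rintro ⟨n, a⟩
    obtain ⟨z, rfl⟩ := cls_surjective a
    change GradedMonoid.mk _ (cup (cls oneZ) (cls z)) = GradedMonoid.mk _ (cls z)
    rw [cup_cls]
    refine gradedMk_eq (Nat.zero_add n).symm _ _ fun x => ?_
    rw [val_cupZ, val_oneZ]
    simp only [cupC, one_mul]
    exact congrArg (val z) (funext fun i => congrArg x (Fin.ext (by simp)))
  mul_one := by
    rintro ⟨n, a⟩
    obtain ⟨z, rfl⟩ := cls_surjective a
    change GradedMonoid.mk _ (cup (cls z) (cls oneZ)) = GradedMonoid.mk _ (cls z)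
    rw [cup_cls]
    refine gradedMk_eq (Nat.add_zero n).symm _ _ fun x => ?_
    rw [val_cupZ, val_oneZ]
    simp only [cupC, mul_one]
    exact congrArg (val z) (funext fun i => congrArg x (Fin.ext (by simp)))
  mul_assoc := by
    rintro ⟨p, a⟩ ⟨q, b⟩ ⟨r, c⟩
    obtain ⟨a, rfl⟩ := cls_surjective a
    obtain ⟨b, rfl⟩ := cls_surjective b
    obtain ⟨c, rfl⟩ := cls_surjective c
    change GradedMonoid.mk _ (cup (cup (cls a) (cls b)) (cls c)) =
      GradedMonoid.mk _ (cup (cls a) (cup (cls b) (cls c)))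
    simp only [cup_cls]
    refine gradedMk_eq (add_assoc p q r).symm _ _ fun x => ?_
    simp only [val_cupZ, cupC, mul_assoc]
    refine congrArg₂ (· * ·) rfl (congrArg₂ (· * ·) rfl ?_)
    exact congrArg (val c) (funext fun i => congrArg x (Fin.ext (by simp [add_assoc])))
  natCast n := n • cls oneZ
  natCast_zero := zero_smul ℕ _
  natCast_succ n := succ_nsmul _ n
  intCast n := n • cls oneZ
  intCast_ofNat n := natCast_zsmul _ n
  intCast_negSucc_ofNat n := negSucc_zsmul _ n

variable (G) in
/-- The integral cohomology ring `H^*(G; ℤ) = ⨁ H^n(G; ℤ)` with the cup product. -/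
abbrev CohomologyRing : Type := DirectSum ℕ (HZ G)

variable {K : Type} [Group K]

/-- The map `H^n(K; ℤ) → H^n(G; ℤ)` induced by a group homomorphism `G → K`. -/
def mapH (φ : G →* K) (n : ℕ) : HZ K n →+ HZ G n :=
  (groupCohomology.map (A := Rep.trivial ℤ K ℤ) (B := Rep.trivial ℤ G ℤ) φ
    (Rep.ofHom ⟨LinearMap.id, fun _ => rfl⟩) n).hom.toAddMonoidHom

/-- The map on cocycles induced by a group homomorphism. -/
def mapZ (φ : G →* K) {n : ℕ} (z : Cocyc K n) : Cocyc G n :=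
  (groupCohomology.cocyclesMap (A := Rep.trivial ℤ K ℤ) (B := Rep.trivial ℤ G ℤ) φ
    (Rep.ofHom ⟨LinearMap.id, fun _ => rfl⟩) n).hom z

theorem val_mapZ (φ : G →* K) {n : ℕ} (z : Cocyc K n) : val (mapZ φ z) = fun x => val z (φ ∘ x) :=
  congr($(HomologicalComplex.cyclesMap_i (groupCohomology.cochainsMap
    (A := Rep.trivial ℤ K ℤ) (B := Rep.trivial ℤ G ℤ) φ
    (Rep.ofHom ⟨LinearMap.id, fun _ => rfl⟩)) n) z)

theorem mapH_cls (φ : G →* K) {n : ℕ} (z : Cocyc K n) : mapH φ n (cls z) = cls (mapZ φ z) :=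
  groupCohomology.π_map_apply ..

theorem mapZ_cupZ (φ : G →* K) {p q : ℕ} (z : Cocyc K p) (w : Cocyc K q) :
    mapZ φ (cupZ z w) = cupZ (mapZ φ z) (mapZ φ w) :=
  val_injective (by simp only [val_mapZ, val_cupZ]; rfl)

theorem mapZ_oneZ (φ : G →* K) : mapZ φ oneZ = oneZ :=
  val_injective (by simp only [val_mapZ, val_oneZ])

/-- The ring homomorphism `H^*(K; ℤ) → H^*(G; ℤ)` induced by a group homomorphism `G → K`. -/
def cohomologyMap (φ : G →* K) : CohomologyRing K →+* CohomologyRing G :=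
  DirectSum.toSemiring (fun n => (DirectSum.of (HZ G) n).comp (mapH φ n))
    (congrArg (DirectSum.of (HZ G) 0) ((mapH_cls φ oneZ).trans (congrArg cls (mapZ_oneZ φ))))
    (by
      intro p q a b
      obtain ⟨a, rfl⟩ := cls_surjective a
      obtain ⟨b, rfl⟩ := cls_surjective b
      simp only [AddMonoidHom.comp_apply, mapH_cls, DirectSum.of_mul_of]
      refine congrArg (DirectSum.of (HZ G) (p + q)) ?_
      change mapH φ (p + q) (cup (cls a) (cls b)) = cup _ _
      rw [cup_cls, cup_cls, mapH_cls, mapZ_cupZ])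

end Cohomology

section GradedAlgebras

/-- An `ℕ`-graded algebra over `R`. -/
structure GrAlg (R : Type) [CommRing R] where
  carrier : Type
  [ring : Ring carrier]
  [algebra : Algebra R carrier]
  grading : ℕ → Submodule R carrier
  [graded : GradedAlgebra grading]

attribute [instance] GrAlg.ring GrAlg.algebra GrAlg.graded

section
variable (R : Type) [CommRing R] (M : Type) [AddCommGroup M] [Module R M] [Module Rᵐᵒᵖ M] [IsCentralScalar R M]

/-- The grading of `R ⊕ M` with `R` in degree `0` and `M` in degree `1`. -/
def degOneGrading : ℕ → Submodule R (TrivSqZeroExt R M)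
  | 0 => LinearMap.ker (TrivSqZeroExt.sndHom R M)
  | 1 => LinearMap.ker (TrivSqZeroExt.fstHom R R M).toLinearMap
  | _ + 2 => ⊥

theorem inl_mem (r : R) : TrivSqZeroExt.inl r ∈ degOneGrading R M 0 := by simp [degOneGrading]

theorem inr_mem (m : M) : TrivSqZeroExt.inr m ∈ degOneGrading R M 1 := by simp [degOneGrading]

/-- The decomposition of `R ⊕ M` into homogeneous parts. -/
def degOneDecompose : TrivSqZeroExt R M →ₗ[R] ⨁ n, degOneGrading R M n where
  toFun x := DirectSum.lof R ℕ (fun n => degOneGrading R M n) 0 ⟨.inl x.fst, inl_mem R M _⟩ +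
    DirectSum.lof R ℕ (fun n => degOneGrading R M n) 1 ⟨.inr x.snd, inr_mem R M _⟩
  map_add' x y := by
    rw [add_add_add_comm, ← map_add, ← map_add]
    congr 3 <;> ext <;> simp
  map_smul' r x := by
    rw [RingHom.id_apply, smul_add, ← map_smul, ← map_smul]
    congr 3 <;> ext <;> simp

instance : GradedAlgebra (degOneGrading R M) where
  one_mem := by simp [degOneGrading]
  mul_mem := by
    rintro (_ | _ | i) (_ | _ | j) x y hx hy
    all_goals simp_all [degOneGrading, TrivSqZeroExt.ext_iff]
  toDecomposition := DirectSum.Decomposition.ofLinearMap _ (degOneDecompose R M)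
    (by
      ext x <;> simp [degOneDecompose])
    (by
      refine DirectSum.linearMap_ext R fun n => LinearMap.ext fun x => ?_
      obtain ⟨x, hx⟩ := x
      simp only [LinearMap.comp_apply, DirectSum.coeLinearMap_lof, LinearMap.id_apply]
      change DirectSum.lof R ℕ (fun n => degOneGrading R M n) 0 _ +
        DirectSum.lof R ℕ (fun n => degOneGrading R M n) 1 _ = _
      match n, hx with
      | 0, hx =>
        have h : x.snd = 0 := hx
        have h1 : (⟨.inr x.snd, inr_mem R M _⟩ : degOneGrading R M 1) = 0 :=
          Subtype.ext (by simp [h])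
        rw [h1, map_zero, add_zero]
        exact congrArg _ (Subtype.ext (by ext <;> simp [h]))
      | 1, hx =>
        have h : x.fst = 0 := hx
        have h1 : (⟨.inl x.fst, inl_mem R M _⟩ : degOneGrading R M 0) = 0 :=
          Subtype.ext (by simp [h])
        rw [h1, map_zero, zero_add]
        exact congrArg _ (Subtype.ext (by ext <;> simp [h]))
      | n + 2, hx =>
        have h : x = 0 := hx
        subst h
        have h1 : (⟨.inl (0 : TrivSqZeroExt R M).fst, inl_mem R M _⟩ : degOneGrading R M 0) = 0 :=
          Subtype.ext (by simp)
        have h2 : (⟨.inr (0 : TrivSqZeroExt R M).snd, inr_mem R M _⟩ : degOneGrading R M 1) = 0 :=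
          Subtype.ext (by simp)
        have h3 : (⟨0, hx⟩ : degOneGrading R M (n + 2)) = 0 := rfl
        rw [h1, h2, h3, map_zero, map_zero, map_zero, add_zero])

/-- The graded algebra `R ⊕ M`, where `R` is in degree `0`, `M` is in degree `1` and `M · M = 0`. -/
def degOne : GrAlg R := ⟨TrivSqZeroExt R M, degOneGrading R M⟩
end

section
variable {R : Type} [CommRing R] (A B : GrAlg R)

/-- The total grading on a graded tensor product. -/
def tensorGrading (n : ℕ) : Submodule R (A.grading ᵍ⊗[R] B.grading) :=
  Submodule.span R {x | ∃ i j : ℕ, i + j = n ∧ ∃ a ∈ A.grading i, ∃ b ∈ B.grading j,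
    x = GradedTensorProduct.tmul R a b}


variable {A B} in
theorem tmul_mem {i j n : ℕ} (h : i + j = n) {a : A.carrier} (ha : a ∈ A.grading i)
    {b : B.carrier} (hb : b ∈ B.grading j) :
    GradedTensorProduct.tmul R a b ∈ tensorGrading A B n :=
  Submodule.subset_span ⟨i, j, h, a, ha, b, hb, rfl⟩

/-- The summand of bidegree `(i, j)` of a graded tensor product. -/
def tensorPiece (i j : ℕ) : A.grading i ⊗[R] B.grading j →ₗ[R] tensorGrading A B (i + j) :=
  LinearMap.codRestrict _ ((GradedTensorProduct.of R A.grading B.grading).toLinearMap ∘ₗ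
    TensorProduct.map (A.grading i).subtype (B.grading j).subtype) (fun x => by
      induction x with
      | zero => rw [map_zero]; exact zero_mem _
      | add x y hx hy => rw [map_add]; exact add_mem hx hy
      | tmul a b => exact tmul_mem rfl a.2 b.2)

/-- The decomposition of a graded tensor product by total degree. -/
def tensorDecompose : A.grading ᵍ⊗[R] B.grading →ₗ[R] ⨁ n, tensorGrading A B n :=
  DirectSum.toModule R (ℕ × ℕ) _ (fun p =>
      DirectSum.lof R ℕ (fun n => tensorGrading A B n) (p.1 + p.2) ∘ₗ tensorPiece A B p.1 p.2) ∘ₗ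
    (TensorProduct.directSum R R (fun i => A.grading i) (fun j => B.grading j)).toLinearMap ∘ₗ
    (GradedTensorProduct.auxEquiv R A.grading B.grading).toLinearMap

theorem tensorDecompose_tmul {i j n : ℕ} (h : i + j = n) {a : A.carrier} (ha : a ∈ A.grading i)
    {b : B.carrier} (hb : b ∈ B.grading j) :
    tensorDecompose A B (GradedTensorProduct.tmul R a b) =
      DirectSum.lof R ℕ (fun n => tensorGrading A B n) n
        ⟨GradedTensorProduct.tmul R a b, tmul_mem h ha hb⟩ := by
  subst h
  lift a to A.grading i using ha
  lift b to B.grading j using hb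
  simp only [tensorDecompose, LinearMap.comp_apply, LinearEquiv.coe_coe,
    GradedTensorProduct.auxEquiv_tmul, DirectSum.decompose_coe]
  rw [← DirectSum.lof_eq_of R, ← DirectSum.lof_eq_of R, TensorProduct.directSum_lof_tmul_lof,
    DirectSum.toModule_lof]
  rfl

theorem tensor_induction {p : A.grading ᵍ⊗[R] B.grading → Prop} (h0 : p 0)
    (ha : ∀ x y, p x → p y → p (x + y))
    (ht : ∀ i j, ∀ a ∈ A.grading i, ∀ b ∈ B.grading j, p (GradedTensorProduct.tmul R a b))
    (x : A.grading ᵍ⊗[R] B.grading) : p x := by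
  change A.carrier ⊗[R] B.carrier at x
  induction x using TensorProduct.induction_on with
  | zero => exact h0
  | add x y hx hy => exact ha _ _ hx hy
  | tmul a b =>
    induction a using DirectSum.Decomposition.inductionOn A.grading with
    | zero => rw [TensorProduct.zero_tmul]; exact h0
    | add a a' h h' => rw [TensorProduct.add_tmul]; exact ha _ _ h h'
    | homogeneous a =>
      induction b using DirectSum.Decomposition.inductionOn B.grading with
      | zero => rw [TensorProduct.tmul_zero]; exact h0
      | add b b' h h' => rw [TensorProduct.tmul_add]; exact ha _ _ h h'
      | homogeneous b => exact ht _ _ _ a.2 _ b.2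

instance : GradedAlgebra (tensorGrading A B) where
  one_mem := tmul_mem (zero_add 0) SetLike.GradedOne.one_mem SetLike.GradedOne.one_mem
  mul_mem := by
    intro m n x y hx hy
    induction hx using Submodule.span_induction with
    | zero => rw [zero_mul]; exact zero_mem _
    | add x x' _ _ h h' => rw [add_mul]; exact add_mem h h'
    | smul r x _ h => rw [smul_mul_assoc]; exact Submodule.smul_mem _ _ h
    | mem x hx =>
      induction hy using Submodule.span_induction with
      | zero => rw [mul_zero]; exact zero_mem _
      | add x x' _ _ h h' => rw [mul_add]; exact add_mem h h'
      | smul r x _ h => rw [mul_smul_comm]; exact Submodule.smul_mem _ _ h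
      | mem y hy =>
        obtain ⟨i, j, rfl, a, ha, b, hb, rfl⟩ := hx
        obtain ⟨i', j', rfl, a', ha', b', hb', rfl⟩ := hy
        have := GradedTensorProduct.tmul_coe_mul_coe_tmul A.grading B.grading a ⟨b, hb⟩ ⟨a', ha'⟩ b'
        rw [this]
        have hm := tmul_mem (A := A) (B := B) (n := i + j + (i' + j')) (by omega)
          (SetLike.GradedMul.mul_mem ha ha') (SetLike.GradedMul.mul_mem hb hb')
        rcases Int.units_eq_one_or ((-1 : ℤˣ) ^ (j * i')) with h | h
        · rw [h, one_smul]; exact hm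
        · rw [h, Units.neg_smul, one_smul]; exact neg_mem hm
  toDecomposition := DirectSum.Decomposition.ofLinearMap _ (tensorDecompose A B)
    (by
      refine LinearMap.ext fun x => ?_
      induction x using tensor_induction A B with
      | h0 => rw [map_zero, map_zero]
      | ha x y hx hy => rw [map_add, map_add, hx, hy]
      | ht i j a ha b hb =>
        rw [LinearMap.comp_apply, tensorDecompose_tmul A B rfl ha hb, DirectSum.coeLinearMap_lof]
        rfl)
    (by
      refine DirectSum.linearMap_ext R fun n => LinearMap.ext fun x => ?_
      obtain ⟨x, hx⟩ := x
      simp only [LinearMap.comp_apply, DirectSum.coeLinearMap_lof, LinearMap.id_apply]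
      induction hx using Submodule.span_induction with
      | zero => rw [map_zero]; exact (map_zero _).symm
      | add x y hx hy h h' => rw [map_add, h, h', ← map_add]; rfl
      | smul r x hx h => rw [map_smul, h, ← map_smul]; rfl
      | mem x hx =>
        obtain ⟨i, j, h, a, ha, b, hb, rfl⟩ := hx
        exact tensorDecompose_tmul A B h ha hb)

/-- The tensor product of graded algebras, with multiplication
`(a ⊗ b)(a' ⊗ b') = (-1)^{|b||a'|} aa' ⊗ bb'` and the total grading. -/
def tensor : GrAlg R := ⟨A.grading ᵍ⊗[R] B.grading, tensorGrading A B⟩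

/-- The `m`-fold tensor power of a graded algebra. The empty tensor product is `R` in degree `0`,
written as `R ⊕ 0`. -/
def tensorPower : ℕ → GrAlg R
  | 0 => degOne R PUnit
  | m + 1 => tensor A (tensorPower m)

end

attribute [local instance] LieRing.ofAssociativeRing

/-- `L_s[V]`: the elements of tensor degree `s` in the smallest Lie subalgebra `L[V]` of the tensor
algebra `T[V]` that contains `V`. -/
def freeLiePart (R : Type) [CommRing R] (V : Type) [AddCommGroup V] [Module R V] (s : ℕ) :
    Submodule R (TensorAlgebra R V) :=
  (LieSubalgebra.lieSpan R (TensorAlgebra R V) (Set.range (TensorAlgebra.ι R (M := V)))).toSubmodule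
    ⊓ LinearMap.range (TensorAlgebra.ι R (M := V)) ^ s

/-- The graded algebra `ℤ ⊕ V_q^*`, where `V_q` is free abelian of rank `q`. -/
def zPlusDual (q : ℕ) : GrAlg ℤ := degOne ℤ (Module.Dual ℤ (Fin q → ℤ))

/-- The graded algebra `ℤ ⊕ L_s[V_q]^*`, where `V_q` is free abelian of rank `q`. -/
def zPlusLieDual (s q : ℕ) : GrAlg ℤ := degOne ℤ (Module.Dual ℤ (freeLiePart ℤ (Fin q → ℤ) s))

end GradedAlgebras

section Groups

/-- The `s`-th stage `Γ^s` of the descending central series, for `s ≥ 1`, with `Γ^1 = G`. -/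
abbrev dcs (G : Type) [Group G] (s : ℕ) : Subgroup G :=
  (⊤ : Subgroup G).lowerCentralSeries (s - 1)

/-- `gr_s^{DCS}(G) = Γ^s / Γ^{s+1}`, for `s ≥ 1`. -/
abbrev grDCS (G : Type) [Group G] (s : ℕ) : Type := dcs G s ⧸ (dcs G (s + 1)).subgroupOf (dcs G s)

/-- The natural quotient map `Γ^s → gr_s^{DCS}(G)`. -/
def toGrDCS (G : Type) [Group G] (s : ℕ) : dcs G s →* grDCS G s := QuotientGroup.mk' _

/-- The endomorphism of the free group sending `x_i` to `w x_i w⁻¹` and fixing the other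
generators. -/
def conjHom {n : ℕ} (i : Fin n) (w : FreeGroup (Fin n)) : FreeGroup (Fin n) →* FreeGroup (Fin n) :=
  FreeGroup.lift fun r => if r = i then w * FreeGroup.of r * w⁻¹ else FreeGroup.of r

theorem conjHom_comp {n : ℕ} (i j : Fin n) :
    (conjHom i (FreeGroup.of j)⁻¹).comp (conjHom i (FreeGroup.of j)) = MonoidHom.id _ ∧
    (conjHom i (FreeGroup.of j)).comp (conjHom i (FreeGroup.of j)⁻¹) = MonoidHom.id _ := by
  constructor <;> ext r <;> by_cases hr : r = i <;> by_cases hj : j = i <;>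
    simp [conjHom, hr, hj, mul_assoc]

/-- The automorphism `α_{ij}` of the free group: `x_i ↦ x_j x_i x_j⁻¹`, and `x_r ↦ x_r` for
`r ≠ i`. (It is the identity if `i = j`.) -/
def alpha {n : ℕ} (i j : Fin n) : MulAut (FreeGroup (Fin n)) :=
  MonoidHom.toMulEquiv (conjHom i (FreeGroup.of j)) (conjHom i (FreeGroup.of j)⁻¹)
    (conjHom_comp i j).1 (conjHom_comp i j).2

/-- The upper triangular McCool group `PΣ_n^+`, generated by the `α_{ij}` with `j < i`. -/
def upperMcCool (n : ℕ) : Subgroup (MulAut (FreeGroup (Fin n))) :=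
  Subgroup.closure {a | ∃ i j : Fin n, j < i ∧ a = alpha i j}

/-- The subgroup `G(n,m,j)` of `PΣ_n^+` generated by `α_{m,1}, …, α_{m,j}`. Indices in the notation
`α_{m,r}` are `1`-based, so that `α_{m,r}` is `alpha` at the elements `m - 1` and `r - 1` of
`Fin n`. -/
def subgroupG (n m j : ℕ) : Subgroup (upperMcCool n) :=
  Subgroup.closure {a | ∃ i r : Fin n, (i : ℕ) + 1 = m ∧ (r : ℕ) + 1 ≤ j ∧ (a : MulAut _) = alpha i r}

/-- `H(n,k) = G(n,k,k-1) × G(n,k+1,k-1) × ⋯ × G(n,n,k-1)`. -/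
abbrev groupH (n k : ℕ) : Type := (m : Set.Icc k n) → subgroupG n m (k - 1)

end Groups

end McCool

end

noncomputable section
namespace McCool
open CategoryTheory
open scoped TensorProduct DirectSum

/-! ### Counting generators of abelian groups -/

section GeneratorCount

/-! Put `q = k - 1` and `N = n - k + 1`, and let `F` be free of rank `q`. For fixed `m` the
automorphisms `α_{m,r}` with `r < m` generate a free group (`alphaHom_injective`). So `H(n,k)` is
isomorphic to `F^N`, and `Γ^s H(n,k)` corresponds to `(Γ^s F)^N`.

Degree one classes are characters. They anticommute, and two characters pulled back from the same
free group have product zero, because a free group carries functions with any prescribed bilinear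
defect (`chr_pullback_mul_eq_zero`). Characters on the factors therefore define a ring homomorphism
from a tensor power of `ℤ ⊕ W` to the cohomology ring (`exists_tensorLift`). It is injective
whenever there are dual group elements that commute across factors. Indeed, the alternating sum over
a commuting tuple kills coboundaries (`altEval_δ`) and turns a product of characters into a
determinant, so square-free monomials have dual functionals (`IsDualFamily.functional_mono`). This
covers `(Γ^s F)^N` as well, since `Γ^s F` is free by Nielsen–Schreier.

For `F^N` the map is also onto. The Cayley tree of `F` gives a short exact sequence of coinduced
modules, and its long exact sequence bounds the number of generators of `H^n(F^N)` by the number of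
monomials of degree `n` (`genBy_freeGroup_power`). Generators that few, together with dual
functionals, force the monomials to span (`mem_span_of_dual`).

For the second statement, the leading term of the Magnus expansion identifies `Γ^s F / Γ^{s+1} F`
with `L_s[V]` (`ker_lieLead`, `lieLead_surjective`). The kernel is found by Lazard elimination:
generators are removed one at a time by a collection process, while the leading terms of the
remaining commutators stay algebraically free (`FreeFamily.mem_dcs_of_hasLead`). Hence `gr_s H(n,k)`
is free abelian of finite rank. Its cohomology ring is generated by characters, so the image in
`H^*(Γ^s H(n,k))` is the subring generated by their pullbacks. That subring is the image of the
injective map from the tensor power of `ℤ ⊕ L_s[V]^*` (`exists_range_cohomologyMap_equiv`). -/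

/-- `M` can be generated by `r` elements. -/
def GenBy (r : ℕ) (M : Type*) [AddCommGroup M] : Prop :=
  ∃ f : (Fin r → ℤ) →+ M, Function.Surjective f

variable {A B C : Type*} [AddCommGroup A] [AddCommGroup B] [AddCommGroup C]

theorem GenBy.of_surjective {r : ℕ} (h : GenBy r A) (f : A →+ B) (hf : Function.Surjective f) :
    GenBy r B :=
  let ⟨g, hg⟩ := h
  ⟨f.comp g, hf.comp hg⟩

theorem GenBy.mono {r s : ℕ} (hrs : r ≤ s) (h : GenBy r A) : GenBy s A := by
  obtain ⟨f, hf⟩ := h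
  refine ⟨f.comp (LinearMap.funLeft ℤ ℤ (Fin.castLE hrs)).toAddMonoidHom, hf.comp ?_⟩
  exact LinearMap.funLeft_surjective_of_injective ℤ ℤ _ (Fin.castLE_injective hrs)

theorem GenBy.pi {r : ℕ} (h : GenBy r A) (q : ℕ) : GenBy (q * r) (Fin q → A) := by
  obtain ⟨f, hf⟩ := h
  refine ⟨AddMonoidHom.mk' (fun x i => f fun j => x (finProdFinEquiv (i, j))) ?_, ?_⟩
  · intro x y
    funext i
    exact map_add f _ _
  · intro y
    choose x hx using fun i => hf (y i)
    refine ⟨fun k => x (finProdFinEquiv.symm k).1 (finProdFinEquiv.symm k).2, ?_⟩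
    funext i
    exact (congrArg f (funext fun j => by beta_reduce; rw [Equiv.symm_apply_apply])).trans (hx i)

/-- The preimage in `ℤ^r` of the image of `A` is free of rank at most `r`. The preimages `k` are
chosen as a mere function, which is additive because `f` is injective. -/
theorem GenBy.of_injective {r : ℕ} (h : GenBy r B) (f : A →+ B) (hf : Function.Injective f) :
    GenBy r A := by
  obtain ⟨g, hg⟩ := h
  let P : Submodule ℤ (Fin r → ℤ) := AddSubgroup.toIntSubmodule (f.range.comap g)
  have hP : ∀ x : P, ∃ a, f a = g x := fun x => x.2
  choose k hk using hP
  have hr : Module.finrank ℤ P ≤ r := by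
    simpa using Submodule.finrank_le P
  let b := Module.finBasis ℤ P
  refine GenBy.mono hr ⟨AddMonoidHom.mk' (fun x => k (b.equivFun.symm x)) ?_, ?_⟩
  · intro x y
    apply hf
    rw [hk, map_add f, hk, hk, ← map_add g, ← Submodule.coe_add, map_add]
  · intro a
    obtain ⟨x, hx⟩ := hg (f a)
    refine ⟨b.equivFun ⟨x, a, hx.symm⟩, hf ?_⟩
    simp [hk, hx]

theorem GenBy.of_exact {r s : ℕ} (hA : GenBy r A) (hC : GenBy s C) (f : A →+ B) (g : B →+ C)
    (hfg : ∀ b, g b = 0 → ∃ a, f a = b) : GenBy (r + s) B := by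
  obtain ⟨u, hu⟩ := hA
  -- `g` need not be onto, so the generators to be lifted are those of its range.
  obtain ⟨v, hv⟩ : GenBy s g.range := hC.of_injective g.range.subtype Subtype.val_injective
  choose t ht using fun i : Fin s => g.rangeRestrict_surjective (v (Pi.single i 1))
  have hv' : ∀ x : Fin s → ℤ, v x = g.rangeRestrict (∑ i, x i • t i) := by
    intro x
    conv_lhs => rw [← Finset.univ_sum_single x]
    rw [map_sum, map_sum]
    refine Finset.sum_congr rfl fun i _ => ?_
    rw [map_zsmul, ht, ← map_zsmul, ← Pi.single_smul, smul_eq_mul, mul_one]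
  refine ⟨AddMonoidHom.mk' (fun x => f (u fun i => x (Fin.castAdd s i)) +
    ∑ i, x (Fin.natAdd r i) • t i) ?_, ?_⟩
  · intro x y
    have : (fun i => (x + y) (Fin.castAdd s i)) = (fun i => x (Fin.castAdd s i)) +
      fun i => y (Fin.castAdd s i) := rfl
    rw [this, map_add, map_add]
    simp only [Pi.add_apply, add_smul, Finset.sum_add_distrib]
    abel
  · intro b
    obtain ⟨x, hx⟩ := hv (g.rangeRestrict b)
    rw [hv', ← sub_eq_zero, ← map_sub] at hx
    obtain ⟨a, ha⟩ := hfg (b - ∑ i, x i • t i) (by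
      have := congrArg Subtype.val hx
      rw [← neg_sub, map_neg]
      exact neg_eq_zero.2 this)
    obtain ⟨y, rfl⟩ := hu a
    refine ⟨Fin.append y x, ?_⟩
    simp [ha]

end GeneratorCount

/-! ### Upper bound for the cohomology of a product with a free group -/

section Kuenneth

variable {G : Type} [Group G]

/-- The map induced on cohomology by a map of coefficients. -/
def coeffMap {M N : Rep.{0} ℤ G} (f : M ⟶ N) (n : ℕ) : groupCohomology M n →+ groupCohomology N n :=
  ((groupCohomology.functor ℤ G n).map f).hom.toAddMonoidHom

instance (n : ℕ) : (groupCohomology.functor ℤ G n).Additive where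
  map_add {X Y f g} := by
    change HomologicalComplex.homologyMap ((groupCohomology.cochainsFunctor ℤ G).map (f + g)) n = _
    rw [Functor.map_add, HomologicalComplex.homologyMap_add]
    rfl

theorem moduleCat_sum_apply {q : ℕ} {A B : ModuleCat.{0} ℤ} (f : Fin q → (A ⟶ B)) (y : A) :
    (∑ i, f i).hom y = ∑ i, (f i).hom y := by
  rw [ModuleCat.hom_sum, LinearMap.sum_apply]

/-- The identity of `ℤ^q` is the sum of the projections followed by the inclusions, and cohomology
is an additive functor of the coefficients. -/
theorem genBy_cohomology_pi {r n : ℕ} (h : GenBy r (HZ G n)) (q : ℕ) :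
    GenBy (q * r) (groupCohomology (Rep.trivial ℤ G (Fin q → ℤ)) n) := by
  let ι (i : Fin q) : Rep.trivial ℤ G ℤ ⟶ Rep.trivial ℤ G (Fin q → ℤ) :=
    Rep.ofHom ⟨LinearMap.single ℤ (fun _ => ℤ) i, fun _ => rfl⟩
  let p (i : Fin q) : Rep.trivial ℤ G (Fin q → ℤ) ⟶ Rep.trivial ℤ G ℤ :=
    Rep.ofHom ⟨LinearMap.proj i, fun _ => rfl⟩
  have hs : ∑ i, p i ≫ ι i = 𝟙 _ := by
    apply Rep.hom_ext
    apply Representation.IntertwiningMap.ext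
    refine LinearMap.ext fun x => ?_
    let ev : (Rep.trivial ℤ G (Fin q → ℤ) ⟶ Rep.trivial ℤ G (Fin q → ℤ)) →+ (Fin q → ℤ) :=
      AddMonoidHom.mk' (fun f => f.hom.toLinearMap x) fun _ _ => rfl
    refine (map_sum ev (fun i => p i ≫ ι i) Finset.univ).trans ?_
    exact Finset.univ_sum_single x
  refine (h.pi q).of_surjective (AddMonoidHom.mk' (fun x => ∑ i, coeffMap (ι i) n (x i)) ?_) ?_
  · intro x y
    simp [Finset.sum_add_distrib]
  · intro y
    refine ⟨fun i => coeffMap (p i) n y, ?_⟩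
    have := congrArg (groupCohomology.functor ℤ G n).map hs
    rw [Functor.map_sum, CategoryTheory.Functor.map_id] at this
    simp only [Functor.map_comp] at this
    exact (moduleCat_sum_apply _ y).symm.trans congr($(this).hom y)

variable (G) (q : ℕ)

/-- The factor `G` of `G × F`, as a subgroup. -/
abbrev leftFactor : Subgroup (G × FreeGroup (Fin q)) := (MonoidHom.snd G (FreeGroup (Fin q))).ker

/-- The left factor is isomorphic to `G`. -/
def leftFactorEquiv : leftFactor G q ≃* G where
  toFun x := x.1.1
  invFun g := ⟨(g, 1), rfl⟩
  left_inv x := Subtype.ext (Prod.ext rfl x.2.symm)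
  right_inv _ := rfl
  map_mul' _ _ := rfl

/-- The representation coinduced from a trivial representation of the left factor. -/
abbrev coindTrivial (V : Type) [AddCommGroup V] [Module ℤ V] : Rep.{0} ℤ (G × FreeGroup (Fin q)) :=
  Rep.coind (leftFactor G q).subtype (Rep.trivial ℤ (leftFactor G q) V)

/-- This is Shapiro's lemma for the left factor. -/
theorem genBy_coindTrivial {V : Type} [AddCommGroup V] [Module ℤ V] {r n : ℕ}
    (h : GenBy r (groupCohomology (Rep.trivial ℤ G V) n)) :
    GenBy r (groupCohomology (coindTrivial G q V) n) := by
  let e1 := groupCohomology.mapIso (leftFactorEquiv G q) (A := Rep.trivial ℤ G V)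
    (B := Rep.trivial ℤ (leftFactor G q) V) (LinearEquiv.refl ℤ V) (fun _ => rfl) n
  let e := (groupCohomology.coindIso (Rep.trivial ℤ (leftFactor G q) V) n ≪≫ e1).symm
  exact h.of_surjective e.hom.hom.toAddMonoidHom e.toLinearEquiv.surjective

/-- Constant functions. -/
def constMap : Rep.trivial ℤ (G × FreeGroup (Fin q)) ℤ ⟶ coindTrivial G q ℤ :=
  Rep.ofHom ⟨{ toFun := fun m => ⟨fun _ => m, fun _ _ => rfl⟩
               map_add' := fun _ _ => rfl
               map_smul' := fun _ _ => rfl }, fun _ => rfl⟩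

/-- Differences along the edges of the Cayley graph of the free group. -/
def edgeMap : coindTrivial G q ℤ ⟶ coindTrivial G q (Fin q → ℤ) :=
  Rep.ofHom ⟨{ toFun := fun h => ⟨fun γ i => h.1 ((1, FreeGroup.of i) * γ) - h.1 γ, fun s γ => by
                  have hs : (s : G × FreeGroup (Fin q)) = (s.1.1, 1) := Prod.ext rfl s.2
                  funext i
                  have h1 := h.2 s ((1, FreeGroup.of i) * γ)
                  have h2 := h.2 s γ
                  have h3 : (1, FreeGroup.of i) * ((s : G × FreeGroup (Fin q)) * γ) =
                      (s : G × FreeGroup (Fin q)) * ((1, FreeGroup.of i) * γ) := by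
                    rw [hs]; ext <;> simp
                  simp only [Subgroup.subtype_apply] at h1 h2 ⊢
                  rw [h3, h1, h2]
                  rfl⟩
               map_add' := fun h k => by
                  ext γ i
                  exact add_sub_add_comm _ _ _ _
               map_smul' := fun c h => by
                  ext γ i
                  exact (mul_sub c _ _).symm }, fun g => by
                  refine LinearMap.ext fun h => Subtype.ext (funext fun γ => funext fun i => ?_)
                  change h.1 ((1, FreeGroup.of i) * γ * g) - h.1 (γ * g) =
                    h.1 ((1, FreeGroup.of i) * (γ * g)) - h.1 (γ * g)
                  rw [mul_assoc]⟩

/-- A function on the free group with prescribed differences along the edges of the Cayley graph. -/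
theorem exists_potential {X : Type*} (c : FreeGroup X → X → ℤ) :
    ∃ h : FreeGroup X → ℤ, ∀ w i, h (FreeGroup.of i * w) - h w = c w i := by
  -- `P i` walks along the edge labelled `i` and adds its prescribed difference to the second
  -- coordinate. Since the letters are free, these permutations extend to an action, and the orbit
  -- of `(1, 0)` is the graph of the potential.
  let P (i : X) : Equiv.Perm (FreeGroup X × ℤ) :=
    { toFun := fun x => (FreeGroup.of i * x.1, x.2 + c x.1 i)
      invFun := fun x => ((FreeGroup.of i)⁻¹ * x.1, x.2 - c ((FreeGroup.of i)⁻¹ * x.1) i)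
      left_inv := fun x => by simp
      right_inv := fun x => by simp }
  let L : FreeGroup X →* Equiv.Perm (FreeGroup X × ℤ) := FreeGroup.lift P
  have h1 : ∀ w x, (L w x).1 = w * x.1 := by
    intro w
    induction w using FreeGroup.induction_on with
    | C1 => simp
    | of i => intro x; simp [L, P]
    | inv_of i _ => intro x; simp only [L, map_inv, FreeGroup.lift_apply_of]; rfl
    | mul a b ha hb => intro x; rw [map_mul, Equiv.Perm.mul_apply, ha, hb, mul_assoc]
  refine ⟨fun w => (L w (1, 0)).2, fun w i => ?_⟩
  beta_reduce
  rw [map_mul, Equiv.Perm.mul_apply]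
  have : L (FreeGroup.of i) = P i := by simp [L]
  rw [this]
  change (L w (1, 0)).2 + c (L w (1, 0)).1 i - _ = _
  rw [h1]
  simp

theorem freeGroup_fun_const {q : ℕ} (h : FreeGroup (Fin q) → ℤ)
    (hh : ∀ w i, h (FreeGroup.of i * w) = h w) (w : FreeGroup (Fin q)) : h w = h 1 := by
  have : ∀ v : FreeGroup (Fin q), ∀ w, h (v * w) = h w := by
    intro v
    induction v using FreeGroup.induction_on with
    | C1 => simp
    | of i => intro w; exact hh w i
    | inv_of i _ => intro w; rw [← hh _ i, mul_inv_cancel_left]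
    | mul a b ha hb => intro x; rw [mul_assoc, ha, hb]
  simpa using this w 1

/-- The short exact sequence `0 → ℤ → Coind ℤ → Coind ℤ^q → 0` of the Cayley graph. -/
def cayleyComplex : ShortComplex (Rep.{0} ℤ (G × FreeGroup (Fin q))) :=
  ShortComplex.mk (constMap G q) (edgeMap G q) (by
    refine Rep.hom_ext (Representation.IntertwiningMap.ext (LinearMap.ext fun m =>
      Subtype.ext (funext fun γ => funext fun i => ?_)))
    exact sub_self _)

theorem rep_exact {k H : Type} [CommRing k] [Group H] (X : ShortComplex (Rep.{0} k H))
    (h : ∀ x : X.X₂, X.g.hom x = 0 → ∃ y : X.X₁, X.f.hom y = x) : X.Exact := by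
  apply (forget₂ (Rep.{0} k H) (ModuleCat.{0} k)).reflects_exact_of_faithful
  rw [ShortComplex.moduleCat_exact_iff]
  exact h

/-- An element of the coinduced module is a function on the free group alone. Exactness in the
middle says that the Cayley graph is connected, surjectivity of the edge map that it has no cycles.
-/
theorem cayleyComplex_shortExact : (cayleyComplex G q).ShortExact where
  exact := by
    apply rep_exact
    intro h hh
    replace hh : ∀ γ i, h.1 ((1, FreeGroup.of i) * γ) - h.1 γ = 0 := fun γ i =>
      congr(($hh).1 γ i)
    refine ⟨h.1 1, Subtype.ext (funext fun γ => ?_)⟩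
    have h1 := h.2 ⟨(γ.1, 1), rfl⟩ (1, γ.2)
    have h2 := freeGroup_fun_const (fun w => h.1 (1, w)) (fun w i => by
      simpa [sub_eq_zero] using hh (1, w) i) γ.2
    simp only [Subgroup.subtype_apply, Prod.mk_mul_mk, mul_one, one_mul] at h1
    exact (h1.trans h2).symm
  mono_f := (Rep.mono_iff_injective _).2 fun a b hab => congr(($hab).1 1)
  epi_g := (Rep.epi_iff_surjective _).2 fun c => by
    obtain ⟨h, hh⟩ := exists_potential fun w => c.1 (1, w)
    refine ⟨⟨fun γ => h γ.2, fun s γ => ?_⟩, Subtype.ext (funext fun γ => funext fun i => ?_)⟩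
    · have hs : (s : G × FreeGroup (Fin q)).2 = 1 := s.2
      simp [hs]
    · have h1 := c.2 ⟨(γ.1, 1), rfl⟩ (1, γ.2)
      simp only [Subgroup.subtype_apply, Prod.mk_mul_mk, mul_one, one_mul] at h1
      exact (hh γ.2 i).trans congr($h1 i).symm

/-- In the long exact sequence of the Cayley complex, `H^{n+1}` of the product lies between `H^n(G;
ℤ^q)` and `H^{n+1}(G; ℤ)`. -/
theorem genBy_prod_freeGroup {r s n : ℕ} (h : GenBy r (HZ G (n + 1))) (h' : GenBy s (HZ G n)) :
    GenBy (r + q * s) (HZ (G × FreeGroup (Fin q)) (n + 1)) := by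
  have hX := cayleyComplex_shortExact G q
  have h2 := genBy_coindTrivial G q h
  have h3 := genBy_coindTrivial G q (genBy_cohomology_pi h' q)
  have hex := groupCohomology.mapShortComplex₁_exact hX (i := n) rfl
  rw [ShortComplex.moduleCat_exact_iff] at hex
  rw [add_comm]
  exact GenBy.of_exact h3 h2 (groupCohomology.δ hX n (n + 1) rfl).hom.toAddMonoidHom
    (coeffMap (constMap G q) (n + 1)) hex

theorem genBy_zero : GenBy 1 (HZ G 0) := by
  have h : GenBy 1 (Cocyc G 0) := by
    refine GenBy.of_injective (B := Fin 1 → ℤ) ⟨AddMonoidHom.id _, Function.surjective_id⟩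
      (AddMonoidHom.mk' (fun z _ => val z Fin.elim0) fun z w => ?_) ?_
    · funext _
      exact congr($(val_add z w) Fin.elim0)
    · intro z w hzw
      refine val_injective (funext fun x => ?_)
      rw [Subsingleton.elim x Fin.elim0]
      exact congr($hzw 0)
  exact h.of_surjective (groupCohomology.π (Rep.trivial ℤ G ℤ) 0).hom.toAddMonoidHom cls_surjective

theorem genBy_of_subsingleton [Subsingleton G] (n : ℕ) : GenBy 0 (HZ G (n + 1)) := by
  have := isZero_groupCohomology_succ_of_subsingleton (Rep.trivial ℤ G ℤ) n
  have : Subsingleton (HZ G (n + 1)) := ModuleCat.subsingleton_of_isZero this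
  exact ⟨0, fun x => ⟨0, Subsingleton.elim _ _⟩⟩

variable {G}
theorem GenBy.of_mulEquiv {K : Type} [Group K] (e : G ≃* K) {r n : ℕ} (h : GenBy r (HZ K n)) :
    GenBy r (HZ G n) := by
  let e1 := (groupCohomology.mapIso e (A := Rep.trivial ℤ K ℤ)
    (B := Rep.trivial ℤ G ℤ) (LinearEquiv.refl ℤ ℤ) (fun _ => rfl) n).symm
  exact h.of_surjective e1.hom.hom.toAddMonoidHom e1.toLinearEquiv.surjective

/-- The Betti numbers of the `N`-th power of a free group of rank `q`. -/
def bettiPower : ℕ → ℕ → ℕ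
  | _, 0 => 1
  | 0, _ + 1 => 0
  | N + 1, n + 1 => bettiPower N (n + 1) + q * bettiPower N n

theorem genBy_freeGroup_power (N n : ℕ) :
    GenBy (bettiPower q N n) (HZ (Fin N → FreeGroup (Fin q)) n) := by
  induction N generalizing n with
  | zero =>
    cases n with
    | zero => exact genBy_zero _
    | succ n => exact genBy_of_subsingleton _ n
  | succ N ih =>
    cases n with
    | zero => exact genBy_zero _
    | succ n =>
      let e : (Fin (N + 1) → FreeGroup (Fin q)) ≃* (Fin N → FreeGroup (Fin q)) × FreeGroup (Fin q) :=
        { toFun := fun x => (fun i => x i.succ, x 0)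
          invFun := fun x => Fin.cons x.2 x.1
          left_inv := fun x => by
            funext i
            refine Fin.cases ?_ (fun i => ?_) i <;> simp
          right_inv := fun x => by ext <;> simp
          map_mul' := fun _ _ => rfl }
      exact (genBy_prod_freeGroup _ q (ih (n + 1)) (ih n)).of_mulEquiv e

end Kuenneth

end McCool
end

noncomputable section
namespace McCool
open CategoryTheory
open scoped TensorProduct DirectSum

/-! ### Lazard elimination in free algebras -/

section Elimination

variable {R : Type*} [Ring R]

/-- The iterated commutator `[x, [x, … [x, y]]]` in a ring. -/
def iterAd (x : R) (i : ℕ) (y : R) : R := (fun y => x * y - y * x)^[i] y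

theorem iterAd_zero (x y : R) : iterAd x 0 y = y := rfl

theorem iterAd_succ (x y : R) (i : ℕ) :
    iterAd x (i + 1) y = x * iterAd x i y - iterAd x i y * x :=
  Function.iterate_succ_apply' _ _ _

theorem map_iterAd {S F : Type*} [Ring S] [FunLike F R S] [RingHomClass F R S] (f : F) (x : R)
    (i : ℕ) (y : R) : f (iterAd x i y) = iterAd (f x) i (f y) := by
  induction i with
  | zero => rfl
  | succ i ih => rw [iterAd_succ, iterAd_succ, map_sub, map_mul, map_mul, ih]

variable (k : Type) [CommRing k] (Y : Type)

/-- The algebra homomorphism `b ↦ b + ε D(b)` for the derivation `D` of the free algebra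
on the letters `(y, i)` with `D (y, i) = (y, i + 1)`. -/
def shiftHom : FreeAlgebra k (Y × ℕ) →ₐ[k] TrivSqZeroExt (FreeAlgebra k (Y × ℕ)) (FreeAlgebra k (Y × ℕ)) :=
  FreeAlgebra.lift k fun p => TrivSqZeroExt.inl (FreeAlgebra.ι k p) +
    TrivSqZeroExt.inr (FreeAlgebra.ι k (p.1, p.2 + 1))

theorem fst_shiftHom (b : FreeAlgebra k (Y × ℕ)) : (shiftHom k Y b).fst = b := by
  have : (TrivSqZeroExt.fstHom k (FreeAlgebra k (Y × ℕ)) (FreeAlgebra k (Y × ℕ))).comp (shiftHom k Y) =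
      AlgHom.id k _ := by
    ext p
    simp [shiftHom]
  exact congr($this b)

/-- The derivation `D` with `D (y, i) = (y, i + 1)`. -/
def shiftDer : Module.End k (FreeAlgebra k (Y × ℕ)) :=
  { toFun := fun b => (shiftHom k Y b).snd
    map_add' := fun a b => by simp
    map_smul' := fun c b => by simp }

theorem shiftDer_mul (a b : FreeAlgebra k (Y × ℕ)) :
    shiftDer k Y (a * b) = a * shiftDer k Y b + shiftDer k Y a * b := by
  change (shiftHom k Y (a * b)).snd = a * (shiftHom k Y b).snd + (shiftHom k Y a).snd * b
  rw [map_mul, TrivSqZeroExt.snd_mul, fst_shiftHom, fst_shiftHom]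
  rfl

theorem shiftDer_one : shiftDer k Y 1 = 0 := by
  change (shiftHom k Y 1).snd = 0
  rw [map_one]
  rfl

theorem shiftDer_ι (p : Y × ℕ) : shiftDer k Y (FreeAlgebra.ι k p) = FreeAlgebra.ι k (p.1, p.2 + 1) := by
  change (shiftHom k Y (FreeAlgebra.ι k p)).snd = _
  simp [shiftHom]

variable {Y} {ζ : Type} (x₀ : ζ)

open Classical in
/-- The action of the free algebra on `ζ` on the free algebra on the letters `(y, i)`, `y ≠ x₀`:
the letter `x₀` acts by the derivation `D`, and `y` by left multiplication by `(y, 0)`. -/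
def elimAction : FreeAlgebra k ζ →ₐ[k] Module.End k (FreeAlgebra k ({z : ζ // z ≠ x₀} × ℕ)) :=
  FreeAlgebra.lift k fun z => if h : z = x₀ then shiftDer k _ else
    Algebra.lmul k _ (FreeAlgebra.ι k (⟨z, h⟩, 0))

/-- The homomorphism `(y, i) ↦ [x₀, [x₀, … [x₀, y]]]`. -/
def elimHom {A : Type*} [Ring A] [Algebra k A] (t : ζ → A) : FreeAlgebra k ({z : ζ // z ≠ x₀} × ℕ) →ₐ[k] A :=
  FreeAlgebra.lift k fun p => iterAd (t x₀) p.2 (t p.1)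

/-- For a derivation `D` and left multiplication `L_b` one has `[D, L_b] = L_{D b}`. So the iterated
commutator of `x₀` with `y` acts as left multiplication by the letter `(y, i)`. -/
theorem elimAction_elimHom :
    (elimAction k x₀).comp (elimHom k x₀ (FreeAlgebra.ι k)) = Algebra.lmul k _ := by
  refine FreeAlgebra.hom_ext (funext fun p => ?_)
  obtain ⟨⟨y, hy⟩, i⟩ := p
  simp only [Function.comp_apply, AlgHom.comp_apply, elimHom, FreeAlgebra.lift_ι_apply, map_iterAd]
  induction i with
  | zero => simp [elimAction, hy, iterAd_zero]
  | succ i ih =>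
    rw [iterAd_succ, ih]
    refine LinearMap.ext fun b => ?_
    have : elimAction k x₀ (FreeAlgebra.ι k x₀) = shiftDer k _ := by simp [elimAction]
    rw [this]
    simp [shiftDer_mul, shiftDer_ι]

theorem lift_elimHom {A : Type*} [Ring A] [Algebra k A] (t : ζ → A) (b : FreeAlgebra k ({z : ζ // z ≠ x₀} × ℕ)) :
    FreeAlgebra.lift k t (elimHom k x₀ (FreeAlgebra.ι k) b) = elimHom k x₀ t b := by
  have : (FreeAlgebra.lift k t).comp (elimHom k x₀ (FreeAlgebra.ι k)) = elimHom k x₀ t := by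
    refine FreeAlgebra.hom_ext (funext fun p => ?_)
    simp [elimHom, map_iterAd]
  exact congr($this b)

/-- By `elimAction_elimHom`, an element is recovered from its image by letting the image act on `1`.
-/
theorem elimHom_injective {A : Type*} [Ring A] [Algebra k A] {t : ζ → A}
    (ht : Function.Injective (FreeAlgebra.lift k t)) : Function.Injective (elimHom k x₀ t) := by
  intro a b hab
  rw [← lift_elimHom k x₀ t, ← lift_elimHom k x₀ t] at hab
  have h := congr(elimAction k x₀ $(ht hab) 1)
  have h2 := fun b => congr($(elimAction_elimHom k x₀) b 1)
  simp only [AlgHom.comp_apply] at h2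
  rw [h2, h2] at h
  simpa using h

/-- The letter `x₀` acts on `1` by `D 1 = 0`, so acting on `1` isolates `b` and gives `b = 0`; then
`c • x₀ = 0` in the free algebra. -/
theorem eq_zero_of_smul_add_elimHom {A : Type*} [Ring A] [Algebra k A] {t : ζ → A}
    (ht : Function.Injective (FreeAlgebra.lift k t)) (c : k)
    (b : FreeAlgebra k ({z : ζ // z ≠ x₀} × ℕ)) (h : c • t x₀ + elimHom k x₀ t b = 0) : c = 0 := by
  have h0 : c • FreeAlgebra.ι k x₀ + elimHom k x₀ (FreeAlgebra.ι k) b = 0 := by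
    apply ht
    rw [map_add, map_smul, lift_elimHom, FreeAlgebra.lift_ι_apply, h, map_zero]
  have h1 := congr(elimAction k x₀ $h0 1)
  have h2 := congr($(elimAction_elimHom k x₀) b 1)
  have h3 : elimAction k x₀ (FreeAlgebra.ι k x₀) = shiftDer k _ := by simp [elimAction]
  simp only [AlgHom.comp_apply] at h2
  rw [map_add, map_smul, LinearMap.add_apply, h2, h3, LinearMap.smul_apply, shiftDer_one] at h1
  have hb : b = 0 := by simpa using h1
  rw [hb, map_zero, add_zero] at h0
  simpa using congrArg (FreeAlgebra.lift k fun _ => (1 : k)) h0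

/-- The inclusion of free algebras induced by `f` is split by the map that kills the letters outside
the range of `f`. -/
theorem lift_injective_of_injective {ζ' : Type} {A : Type*} [Ring A] [Algebra k A] {t : ζ → A}
    (ht : Function.Injective (FreeAlgebra.lift k t)) (f : ζ' → ζ) (hf : Function.Injective f) :
    Function.Injective (FreeAlgebra.lift k fun z => t (f z)) := by
  classical
  let e : FreeAlgebra k ζ' →ₐ[k] FreeAlgebra k ζ := FreeAlgebra.lift k fun z => FreeAlgebra.ι k (f z)
  let r : FreeAlgebra k ζ →ₐ[k] FreeAlgebra k ζ' := FreeAlgebra.lift k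
    fun z => if h : ∃ z', f z' = z then FreeAlgebra.ι k h.choose else 0
  have hr : r.comp e = AlgHom.id k _ := by
    refine FreeAlgebra.hom_ext (funext fun z => ?_)
    have h : ∃ z', f z' = f z := ⟨z, rfl⟩
    simp only [Function.comp_apply, AlgHom.comp_apply, e, r, FreeAlgebra.lift_ι_apply, dif_pos h,
      AlgHom.id_apply, hf h.choose_spec]
  have he : Function.Injective e := Function.LeftInverse.injective (g := r) fun x => congr($hr x)
  have : (FreeAlgebra.lift k fun z => t (f z)) = (FreeAlgebra.lift k t).comp e :=
    FreeAlgebra.hom_ext (funext fun z => by simp [e])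
  rw [this]
  exact ht.comp he

end Elimination

/-! ### Leading terms of units in power series rings -/

section PowerSeries

open PowerSeries
open scoped commutatorElement

variable {A : Type} [Ring A]

/-- `u = 1 + t X^w + ⋯`. -/
def HasLead (w : ℕ) (t : A) (u : A⟦X⟧) : Prop := ∃ r : A⟦X⟧, u = 1 + X ^ w * r ∧ constantCoeff r = t

theorem HasLead.coeff_eq {w : ℕ} (hw : 1 ≤ w) {t : A} {u : A⟦X⟧} (h : HasLead w t u) :
    coeff w u = t := by
  obtain ⟨r, rfl, rfl⟩ := h
  have := coeff_X_pow_mul r w 0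
  rw [zero_add] at this
  simp [this, coeff_one, Nat.pos_iff_ne_zero.1 hw]

theorem HasLead.constantCoeff_eq {w : ℕ} (hw : 1 ≤ w) {t : A} {u : A⟦X⟧} (h : HasLead w t u) :
    constantCoeff u = 1 := by
  obtain ⟨r, rfl, rfl⟩ := h
  simp [Nat.pos_iff_ne_zero.1 hw]

theorem hasLead_one (w : ℕ) : HasLead w (0 : A) 1 := ⟨0, by simp, by simp⟩

theorem HasLead.of_lt {w w' : ℕ} (hw : w < w') {t : A} {u : A⟦X⟧} (h : HasLead w' t u) :
    HasLead w 0 u := by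
  obtain ⟨r, rfl, rfl⟩ := h
  obtain ⟨d, rfl⟩ := Nat.exists_eq_add_of_lt hw
  refine ⟨X ^ (d + 1) * r, ?_, by simp⟩
  rw [← mul_assoc, ← pow_add, add_assoc]

theorem HasLead.mul {w : ℕ} (hw : 1 ≤ w) {t t' : A} {u u' : A⟦X⟧} (h : HasLead w t u)
    (h' : HasLead w t' u') : HasLead w (t + t') (u * u') := by
  obtain ⟨r, rfl, rfl⟩ := h
  obtain ⟨r', rfl, rfl⟩ := h'
  refine ⟨r + r' + r * (X ^ w * r'), by noncomm_ring, ?_⟩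
  simp [Nat.pos_iff_ne_zero.1 hw]

theorem HasLead.inv {w : ℕ} (hw : 1 ≤ w) {t : A} {u : A⟦X⟧ˣ} (h : HasLead w t u) :
    HasLead w (-t) (↑u⁻¹ : A⟦X⟧) := by
  have hc := h.constantCoeff_eq hw
  have hi : constantCoeff (↑u⁻¹ : A⟦X⟧) = 1 := by
    have := congrArg constantCoeff u.mul_inv
    rwa [map_mul, hc, one_mul, map_one] at this
  obtain ⟨r, hr, rfl⟩ := h
  refine ⟨-(r * ↑u⁻¹), ?_, by simp [hi]⟩
  have h1 : (1 + X ^ w * r) * (↑u⁻¹ : A⟦X⟧) = 1 := by rw [← hr, u.mul_inv]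
  rw [add_mul, one_mul, mul_assoc] at h1
  rw [mul_neg, ← sub_eq_add_neg]
  exact eq_sub_of_add_eq h1

/-- Since `X` is central, `u u' - u' u = X^{w+w'} (r r' - r' r)`, and the group commutator is `1 +
(u u' - u' u) u⁻¹ u'⁻¹`, where the two inverses have constant term `1`. -/
theorem HasLead.commutator {w w' : ℕ} (hw : 1 ≤ w) (hw' : 1 ≤ w') {t t' : A} {u u' : A⟦X⟧ˣ}
    (h : HasLead w t u) (h' : HasLead w' t' u') :
    HasLead (w + w') (t * t' - t' * t) (⁅u, u'⁆ : A⟦X⟧ˣ) := by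
  have hi : constantCoeff (↑u⁻¹ : A⟦X⟧) = 1 := (h.inv hw).constantCoeff_eq hw
  have hi' : constantCoeff (↑u'⁻¹ : A⟦X⟧) = 1 := (h'.inv hw').constantCoeff_eq hw'
  obtain ⟨r, hr, rfl⟩ := h
  obtain ⟨r', hr', rfl⟩ := h'
  refine ⟨(r * r' - r' * r) * (↑u⁻¹ * ↑u'⁻¹), ?_, by simp [hi, hi']⟩
  have h1 : (u : A⟦X⟧) * (u' : A⟦X⟧) - (u' : A⟦X⟧) * (u : A⟦X⟧) = X ^ (w + w') * (r * r' - r' * r) := by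
    have e1 : X ^ w * r * (X ^ w' * r') = X ^ (w + w') * (r * r') := by
      rw [mul_assoc, ← mul_assoc r, ((commute_X_pow r w').eq), pow_add]
      simp only [mul_assoc]
    have e2 : X ^ w' * r' * (X ^ w * r) = X ^ (w + w') * (r' * r) := by
      rw [mul_assoc, ← mul_assoc r', ((commute_X_pow r' w).eq), add_comm, pow_add]
      simp only [mul_assoc]
    rw [hr, hr', mul_sub, ← e1, ← e2]
    noncomm_ring
  rw [← mul_assoc, ← h1, commutatorElement_def, Units.val_mul, Units.val_mul, Units.val_mul, sub_mul]
  have : (u' : A⟦X⟧) * u * (↑u⁻¹ * ↑u'⁻¹) = 1 := by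
    rw [mul_assoc, ← mul_assoc (u : A⟦X⟧), u.mul_inv, one_mul, u'.mul_inv]
  rw [this, add_sub_cancel, mul_assoc, mul_assoc]

/-- The unit `1 + aX`. -/
def oneAddX (a : A) : A⟦X⟧ˣ where
  val := 1 + X * C a
  inv := mk fun n => (-a) ^ n
  val_inv := by
    ext n
    cases n with
    | zero => simp [add_mul]
    | succ n =>
      rw [add_mul, one_mul, mul_assoc, map_add, coeff_succ_X_mul, coeff_C_mul, coeff_mk, coeff_mk]
      simp [coeff_one, pow_succ']
  inv_val := by
    ext n
    cases n with
    | zero => simp [mul_add]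
    | succ n =>
      rw [mul_add, mul_one, ← (commute_X (C a)).eq, ← mul_assoc, map_add, coeff_succ_mul_X,
        coeff_mul_C, coeff_mk, coeff_mk]
      simp [coeff_one, pow_succ]

theorem hasLead_oneAddX (a : A) : HasLead 1 a (oneAddX a : A⟦X⟧) := ⟨C a, by simp [oneAddX], by simp⟩

end PowerSeries
end McCool
end

noncomputable section
namespace McCool
open CategoryTheory
open scoped TensorProduct DirectSum

/-! ### Collection process and the kernel of the leading term -/

section Magnus

open PowerSeries
open scoped commutatorElement

/-- Induction on `b` by the three subgroups lemma, applied in the quotient by the target term. -/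
theorem commutator_lowerCentralSeries_le (F : Type*) [Group F] (a b : ℕ) :
    ⁅(⊤ : Subgroup F).lowerCentralSeries a, (⊤ : Subgroup F).lowerCentralSeries b⁆ ≤
      (⊤ : Subgroup F).lowerCentralSeries (a + b + 1) := by
  induction b generalizing a with
  | zero => exact le_rfl
  | succ b ih =>
    set N := (⊤ : Subgroup F).lowerCentralSeries (a + (b + 1) + 1) with hN
    let f := QuotientGroup.mk' N
    have hf : ∀ H : Subgroup F, H ≤ N ↔ H.map f = ⊥ := fun H => by
      rw [Subgroup.map_eq_bot_iff, QuotientGroup.ker_mk']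
    rw [Subgroup.commutator_comm, Subgroup.lowerCentralSeries_succ, hf, Subgroup.map_commutator,
      Subgroup.map_commutator]
    apply Subgroup.commutator_commutator_eq_bot_of_rotate
    · rw [← Subgroup.map_commutator, ← Subgroup.map_commutator, ← hf, Subgroup.commutator_comm ⊤,
        ← Subgroup.lowerCentralSeries_succ]
      refine (ih (a + 1)).trans (le_of_eq ?_)
      rw [hN]
      congr 1
      omega
    · rw [← Subgroup.map_commutator, ← Subgroup.map_commutator, ← hf]
      exact Subgroup.commutator_mono (ih a) le_rfl

theorem commutator_mem_dcs {F : Type} [Group F] {a b : ℕ} (ha : 1 ≤ a) (hb : 1 ≤ b) {x y : F}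
    (hx : x ∈ dcs F a) (hy : y ∈ dcs F b) : ⁅x, y⁆ ∈ dcs F (a + b) := by
  have := commutator_lowerCentralSeries_le F (a - 1) (b - 1)
    (Subgroup.commutator_mem_commutator hx hy)
  rwa [show a - 1 + (b - 1) + 1 = a + b - 1 by omega] at this

theorem dcs_antitone (F : Type) [Group F] {a b : ℕ} (h : a ≤ b) : dcs F b ≤ dcs F a :=
  Subgroup.lowerCentralSeries_antitone _ (by omega)

/-- The iterated commutator `[x, [x, … [x, y]]]` in a group. -/
def iterComm {F : Type*} [Group F] (x : F) (i : ℕ) (y : F) : F := (fun y => ⁅x, y⁆)^[i] y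

theorem iterComm_succ {F : Type*} [Group F] (x y : F) (i : ℕ) :
    iterComm x (i + 1) y = ⁅x, iterComm x i y⁆ := Function.iterate_succ_apply' _ _ _

/-- Collection: every element of the subgroup generated by `x`, `Z` and `K` is a power of `x` times
an element of the subgroup generated by the `[x, [x, … [x, z]]]` and `K`. -/
theorem exists_zpow_mul {F : Type*} [Group F] (K : Subgroup F) [K.Normal] (x : F) (Z : Set F)
    (hK : ∀ z ∈ Z, ∃ i, iterComm x i z ∈ K) (g : F) (hg : g ∈ Subgroup.closure (insert x Z) ⊔ K) :
    ∃ k : ℤ, ∃ h ∈ Subgroup.closure {y | ∃ z ∈ Z, ∃ i, y = iterComm x i z} ⊔ K, g = x ^ k * h := by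
  set M := Subgroup.closure {y | ∃ z ∈ Z, ∃ i, y = iterComm x i z} ⊔ K with hM
  have hKM : K ≤ M := le_sup_right
  have hcM : ∀ z ∈ Z, ∀ i, iterComm x i z ∈ M := fun z hz i =>
    (le_sup_left : _ ≤ M) (Subgroup.subset_closure ⟨z, hz, i, rfl⟩)
  -- With `c_i` the `i`-fold commutator, `x c_i x⁻¹ = c_{i+1} c_i`.
  have h1 : ∀ h ∈ M, x * h * x⁻¹ ∈ M := by
    have : M ≤ M.comap (MulAut.conj x).toMonoidHom := by
      conv_lhs => rw [hM]
      refine sup_le ((Subgroup.closure_le _).2 ?_) fun h hh => ?_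
      · rintro _ ⟨z, hz, i, rfl⟩
        have := mul_mem (hcM z hz (i + 1)) (hcM z hz i)
        rw [iterComm_succ, commutatorElement_def, inv_mul_cancel_right] at this
        exact this
      · exact hKM (Subgroup.Normal.conj_mem ‹_› h hh x)
    exact this
  -- Here `x⁻¹ c_i x = (x⁻¹ c_{i+1} x)⁻¹ c_i`, a recursion that raises the index and stops once the
  -- commutator lies in the normal subgroup `K`.
  have h2 : ∀ z ∈ Z, ∀ d i, iterComm x (i + d) z ∈ K → x⁻¹ * iterComm x i z * x ∈ M := by
    intro z hz d
    induction d with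
    | zero =>
      intro i hi
      have := Subgroup.Normal.conj_mem ‹_› _ hi x⁻¹
      rw [inv_inv] at this
      exact hKM this
    | succ d ih =>
      intro i hi
      have h3 := ih (i + 1) (by rwa [show i + 1 + d = i + (d + 1) by omega])
      have h4 := mul_mem (inv_mem h3) (hcM z hz i)
      rw [iterComm_succ, commutatorElement_def] at h4
      convert h4 using 1
      group
  have h3 : ∀ h ∈ M, x⁻¹ * h * x ∈ M := by
    have : M ≤ M.comap (MulAut.conj x⁻¹).toMonoidHom := by
      conv_lhs => rw [hM]
      refine sup_le ((Subgroup.closure_le _).2 ?_) fun h hh => ?_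
      · rintro _ ⟨z, hz, i, rfl⟩
        obtain ⟨d, hd⟩ := hK z hz
        have hd' : ∀ i, iterComm x (i + d) z ∈ K := by
          intro i
          induction i with
          | zero => rwa [zero_add]
          | succ i ih =>
            rw [add_right_comm, iterComm_succ]
            have h5 := mul_mem (Subgroup.Normal.conj_mem ‹_› _ ih x) (inv_mem ih)
            exact h5
        simpa using h2 z hz d i (hd' i)
      · exact hKM (Subgroup.Normal.conj_mem ‹_› h hh x⁻¹)
    intro h hh
    simpa using this hh
  have hx : x ∈ Subgroup.normalizer (M : Set F) := by
    rw [Subgroup.mem_normalizer_iff]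
    refine fun h => ⟨h1 h, fun hh => ?_⟩
    simpa [mul_assoc] using h3 _ hh
  have hle : Subgroup.closure (insert x Z) ⊔ K ≤ Subgroup.zpowers x ⊔ M := by
    refine sup_le ((Subgroup.closure_le _).2 ?_) (hKM.trans le_sup_right)
    rintro y (rfl | hy)
    · exact (le_sup_left : _ ≤ Subgroup.zpowers y ⊔ M) (Subgroup.mem_zpowers y)
    · exact (le_sup_right : M ≤ _) (hcM y hy 0)
  have h6 := hle hg
  rw [← SetLike.mem_coe, Subgroup.coe_mul_of_left_le_normalizer_right] at h6
  · obtain ⟨y, ⟨k, rfl⟩, h, hh, rfl⟩ := h6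
    exact ⟨k, h, hh, rfl⟩
  · rwa [Subgroup.zpowers_le]

variable {A : Type} [Ring A] {F : Type} [Group F]

/-- Commutators add degrees, so the filtration of the units by degree dominates the descending
central series. -/
theorem exists_hasLead_of_mem_dcs (μ : F →* A⟦X⟧ˣ) (hμ : ∀ g, ∃ t, HasLead 1 t (μ g : A⟦X⟧))
    (w : ℕ) (hw : 1 ≤ w) (g : F) (hg : g ∈ dcs F w) : ∃ t, HasLead w t (μ g : A⟦X⟧) := by
  induction w, hw using Nat.le_induction generalizing g with
  | base => exact hμ g
  | succ w hw ih =>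
    have : dcs F (w + 1) = ⁅dcs F w, ⊤⁆ := by
      obtain ⟨v, rfl⟩ := Nat.exists_eq_add_of_le' hw
      rfl
    rw [this, Subgroup.commutator_def] at hg
    induction hg using Subgroup.closure_induction with
    | mem x hx =>
      obtain ⟨y, hy, z, -, rfl⟩ := hx
      obtain ⟨t, ht⟩ := ih y hy
      obtain ⟨t', ht'⟩ := hμ z
      rw [map_commutatorElement]
      exact ⟨_, ht.commutator hw le_rfl ht'⟩
    | one => rw [map_one]; exact ⟨0, hasLead_one _⟩
    | mul x y _ _ hx hy =>
      obtain ⟨t, ht⟩ := hx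
      obtain ⟨t', ht'⟩ := hy
      rw [map_mul, Units.val_mul]
      exact ⟨_, ht.mul (by omega) ht'⟩
    | inv x _ hx =>
      obtain ⟨t, ht⟩ := hx
      rw [map_inv]
      exact ⟨_, ht.inv (by omega)⟩

theorem HasLead.zpow {w : ℕ} (hw : 1 ≤ w) {t : A} {u : A⟦X⟧ˣ} (h : HasLead w t (u : A⟦X⟧)) (k : ℤ) :
    HasLead w (k • t) ((u ^ k : A⟦X⟧ˣ) : A⟦X⟧) := by
  induction k with
  | zero => rw [zero_smul, zpow_zero]; exact hasLead_one w
  | succ i ih => rw [zpow_add_one, add_smul, one_smul]; exact ih.mul hw h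
  | pred i ih => rw [zpow_sub_one, sub_smul, one_smul, sub_eq_add_neg]; exact ih.mul hw (h.inv hw)

variable [Algebra ℤ A]

/-- A family of elements of the filtration quotients of a group whose leading terms under a
Magnus-type homomorphism `μ` are algebraically free. -/
structure FreeFamily (μ : F →* A⟦X⟧ˣ) (s : ℕ) (ζ : Type) where
  elt : ζ → F
  lead : ζ → A
  wt : ζ → ℕ
  one_le : ∀ z, 1 ≤ wt z
  wt_le : ∀ z, wt z ≤ s
  mem : ∀ z, elt z ∈ dcs F (wt z)
  hasLead : ∀ z, HasLead (wt z) (lead z) (μ (elt z) : A⟦X⟧)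
  free : Function.Injective (FreeAlgebra.lift ℤ lead)

namespace FreeFamily

variable {μ : F →* A⟦X⟧ˣ} {s : ℕ} {ζ : Type} (D : FreeFamily μ s ζ)

theorem iterComm_mem (x z : ζ) (i : ℕ) :
    iterComm (D.elt x) i (D.elt z) ∈ dcs F (D.wt z + i * D.wt x) ∧
    HasLead (D.wt z + i * D.wt x) (iterAd (D.lead x) i (D.lead z))
      (μ (iterComm (D.elt x) i (D.elt z)) : A⟦X⟧) := by
  induction i with
  | zero => rw [zero_mul, add_zero]; exact ⟨D.mem z, D.hasLead z⟩
  | succ i ih =>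
    have h : 1 ≤ D.wt z + i * D.wt x := (D.one_le z).trans (Nat.le_add_right _ _)
    rw [iterComm_succ, iterAd_succ, map_commutatorElement,
      show D.wt z + (i + 1) * D.wt x = D.wt x + (D.wt z + i * D.wt x) by ring]
    exact ⟨commutator_mem_dcs (D.one_le x) h (D.mem x) ih.1,
      (D.hasLead x).commutator (D.one_le x) h ih.2⟩

/-- The index type of the family obtained by eliminating `x`. -/
abbrev ElimIndex (x : ζ) : Type := {p : {z : ζ // z ≠ x} × ℕ // D.wt p.1 + p.2 * D.wt x ≤ s}

/-- The family `[x, [x, … [x, z]]]`, `z ≠ x`, obtained by eliminating `x`. -/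
def elim (x : ζ) : FreeFamily μ s (D.ElimIndex x) where
  elt p := iterComm (D.elt x) p.1.2 (D.elt p.1.1)
  lead p := iterAd (D.lead x) p.1.2 (D.lead p.1.1)
  wt p := D.wt p.1.1 + p.1.2 * D.wt x
  one_le _ := (D.one_le _).trans (Nat.le_add_right _ _)
  wt_le p := p.2
  mem _ := (D.iterComm_mem x _ _).1
  hasLead _ := (D.iterComm_mem x _ _).2
  free := lift_injective_of_injective ℤ (elimHom_injective ℤ x D.free) _ Subtype.val_injective

instance [Finite ζ] (x : ζ) : Finite (D.ElimIndex x) := by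
  refine Finite.of_injective (β := ζ × Fin (s + 1)) (fun p => (p.1.1, ⟨p.1.2, ?_⟩)) ?_
  · have := p.2
    have h := D.one_le x
    nlinarith
  · rintro ⟨⟨⟨a, ha⟩, i⟩, h⟩ ⟨⟨⟨b, hb⟩, j⟩, h'⟩ hab
    simp only [Prod.mk.injEq, Fin.mk.injEq] at hab
    obtain ⟨rfl, rfl⟩ := hab
    rfl

theorem exists_zpow_mul_elim (x : ζ) (g : F)
    (hg : g ∈ Subgroup.closure (Set.range D.elt) ⊔ dcs F (s + 1)) :
    ∃ k : ℤ, ∃ h ∈ Subgroup.closure (Set.range (D.elim x).elt) ⊔ dcs F (s + 1),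
      g = D.elt x ^ k * h := by
  have hsub : Set.range D.elt ⊆ insert (D.elt x) (D.elt '' {z | z ≠ x}) := by
    rintro _ ⟨z, rfl⟩
    by_cases hz : z = x
    · exact Or.inl (by rw [hz])
    · exact Or.inr ⟨z, hz, rfl⟩
  obtain ⟨k, h, hh, rfl⟩ := exists_zpow_mul (dcs F (s + 1)) (D.elt x) (D.elt '' {z | z ≠ x}) (by
      rintro _ ⟨z, hz, rfl⟩
      -- Every bracket with `x` raises the weight by at least one, so `s + 1` brackets suffice.
      refine ⟨s + 1, dcs_antitone F ?_ (D.iterComm_mem x z (s + 1)).1⟩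
      have := D.one_le x
      nlinarith) g (sup_le_sup_right (Subgroup.closure_mono hsub) _ hg)
  refine ⟨k, h, ?_, rfl⟩
  refine (sup_le ((Subgroup.closure_le _).2 ?_) le_sup_right :
    _ ≤ Subgroup.closure (Set.range (D.elim x).elt) ⊔ dcs F (s + 1)) hh
  rintro _ ⟨_, ⟨z, hz, rfl⟩, i, rfl⟩
  by_cases hi : D.wt z + i * D.wt x ≤ s
  · exact (le_sup_left : _ ≤ Subgroup.closure (Set.range (D.elim x).elt) ⊔ dcs F (s + 1))
      (Subgroup.subset_closure ⟨⟨(⟨z, hz⟩, i), hi⟩, rfl⟩)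
  · exact (le_sup_right : _ ≤ Subgroup.closure (Set.range (D.elim x).elt) ⊔ dcs F (s + 1))
      (dcs_antitone F (by omega) (D.iterComm_mem x z i).1)

theorem exists_hasLead (hμ : ∀ g, ∃ t, HasLead 1 t (μ g : A⟦X⟧)) {m : ℕ} (hm : 1 ≤ m) (hms : m ≤ s)
    (hD : ∀ z, m ≤ D.wt z) (g : F) (hg : g ∈ Subgroup.closure (Set.range D.elt) ⊔ dcs F (s + 1)) :
    ∃ b, HasLead m (FreeAlgebra.lift ℤ D.lead b) (μ g : A⟦X⟧) := by
  let S : Subgroup F :=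
    { carrier := {g | ∃ b, HasLead m (FreeAlgebra.lift ℤ D.lead b) (μ g : A⟦X⟧)}
      one_mem' := ⟨0, by rw [map_zero, map_one]; exact hasLead_one m⟩
      mul_mem' := by
        rintro x y ⟨b, hb⟩ ⟨c, hc⟩
        refine ⟨b + c, ?_⟩
        rw [map_add, map_mul]
        exact hb.mul hm hc
      inv_mem' := by
        rintro x ⟨b, hb⟩
        refine ⟨-b, ?_⟩
        rw [map_neg, map_inv]
        exact hb.inv hm }
  refine (sup_le ((Subgroup.closure_le _).2 ?_) ?_ : _ ≤ S) hg
  · rintro _ ⟨z, rfl⟩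
    rcases (hD z).eq_or_lt with h | h
    · refine ⟨FreeAlgebra.ι ℤ z, ?_⟩
      rw [FreeAlgebra.lift_ι_apply, h]
      exact D.hasLead z
    · refine ⟨0, ?_⟩
      rw [map_zero]
      exact (D.hasLead z).of_lt h
  · intro g hg
    obtain ⟨t, ht⟩ := exists_hasLead_of_mem_dcs μ hμ (s + 1) (by omega) g hg
    refine ⟨0, ?_⟩
    rw [map_zero]
    exact ht.of_lt (by omega)

theorem elim_lift (x : ζ) (b : FreeAlgebra ℤ (D.ElimIndex x)) :
    ∃ c, FreeAlgebra.lift ℤ (D.elim x).lead b = elimHom ℤ x D.lead c := by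
  refine ⟨FreeAlgebra.lift ℤ (fun p => FreeAlgebra.ι ℤ p.1) b, ?_⟩
  have : FreeAlgebra.lift ℤ (D.elim x).lead = (elimHom ℤ x D.lead).comp
      (FreeAlgebra.lift ℤ (fun p : D.ElimIndex x => FreeAlgebra.ι ℤ p.1)) := by
    refine FreeAlgebra.hom_ext (funext fun p => ?_)
    simp [elimHom, elim]
  exact congr($this b)

/-- The hypothesis on `g` says that its expansion is `1` modulo `X^{s+1}`. Eliminating an element
`x` of minimal weight `m` writes `g = x^k y`, and freeness of the leading terms forces `k = 0`, so
`g` already lies in the part generated by the smaller family. The inner induction is on the number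
of elements of weight `m`, the outer one on `s + 1 - m`. -/
theorem mem_dcs_of_hasLead (hμ : ∀ g, ∃ t, HasLead 1 t (μ g : A⟦X⟧)) (d m : ℕ) (hm : 1 ≤ m)
    (hd : m + d = s + 1) (c : ℕ) :
    ∀ (ζ : Type) [Finite ζ] (D : FreeFamily μ s ζ), (∀ z, m ≤ D.wt z) →
      Nat.card {z // D.wt z = m} ≤ c → ∀ g ∈ Subgroup.closure (Set.range D.elt) ⊔ dcs F (s + 1),
      HasLead s 0 (μ g : A⟦X⟧) → g ∈ dcs F (s + 1) := by
  induction d generalizing m c with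
  | zero =>
    intro ζ _ D hD _ g hg _
    -- Now `m = s + 1`, while all weights are at most `s`.
    have : IsEmpty ζ := ⟨fun z => by have := hD z; have := D.wt_le z; omega⟩
    rwa [Set.range_eq_empty, Subgroup.closure_empty, bot_sup_eq] at hg
  | succ d ihd =>
    induction c with
    | zero =>
      intro ζ _ D hD hc g hg h
      refine ihd (m + 1) (by omega) (by omega) _ ζ D (fun z => ?_) le_rfl g hg h
      have h0 : Nat.card {z // D.wt z = m} = 0 := by omega
      have := (Nat.card_eq_zero.1 h0).resolve_right (by rw [not_infinite_iff_finite]; infer_instance)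
      rcases (hD z).eq_or_lt with h | h
      · exact (this.false ⟨z, h.symm⟩).elim
      · exact h
    | succ c ihc =>
      intro ζ _ D hD hc g hg h
      by_cases hx : ∃ x, D.wt x = m
      · obtain ⟨x, hx⟩ := hx
        have hD' : ∀ z, m ≤ (D.elim x).wt z := fun z => (hD z.1.1).trans (Nat.le_add_right _ _)
        obtain ⟨k, y, hy, rfl⟩ := D.exists_zpow_mul_elim x g hg
        obtain ⟨b, hb⟩ := (D.elim x).exists_hasLead hμ hm (by omega) hD' y hy
        obtain ⟨b', hb'⟩ := D.elim_lift x b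
        -- The coefficient of `X^m` in the expansion of `x^k y` is `k` times the lead of `x` plus an
        -- element of the eliminated subalgebra, and it vanishes because `m ≤ s`.
        have hk : k = 0 := by
          apply eq_zero_of_smul_add_elimHom ℤ x D.free k b'
          have h1 := ((D.hasLead x).zpow (D.one_le x) k)
          rw [hx] at h1
          have h2 := (h1.mul hm hb).coeff_eq hm
          rw [← Units.val_mul, ← map_zpow, ← map_mul] at h2
          have h3 : HasLead m (0 : A) (μ (D.elt x ^ k * y) : A⟦X⟧) := by
            rcases (show m ≤ s by omega).eq_or_lt with h' | h'
            · rwa [h']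
            · exact h.of_lt h'
          rw [← hb', ← h3.coeff_eq hm, h2]
          -- The scalar action coming from `Algebra ℤ A` has to be matched with integer multiples.
          exact congrArg (· + _) ((Algebra.smul_def k (D.lead x)).trans
            ((congrArg (· * D.lead x) (eq_intCast (algebraMap ℤ A) k)).trans (zsmul_eq_mul _ _).symm))
        subst hk
        rw [zpow_zero, one_mul] at h ⊢
        refine ihc _ (D.elim x) hD' ?_ y hy h
        -- Elements of weight `m` in the eliminated family have no bracket with `x`, so they are old
        -- elements of weight `m` other than `x`.
        have hlt : Nat.card {z // (D.elim x).wt z = m} < Nat.card {z // D.wt z = m} := by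
          have h0 : ∀ z : D.ElimIndex x, (D.elim x).wt z = m → z.1.2 = 0 ∧ D.wt z.1.1 = m := by
            intro z hz
            have h1 : D.wt z.1.1 + z.1.2 * D.wt x = m := hz
            have h2 := hD z.1.1
            have h3 := D.one_le x
            refine ⟨?_, by omega⟩
            have : z.1.2 * D.wt x = 0 := by omega
            exact (Nat.mul_eq_zero.1 this).resolve_right (by omega)
          let f (z : {z // (D.elim x).wt z = m}) : {z // D.wt z = m} := ⟨z.1.1.1, (h0 z.1 z.2).2⟩
          have := Fintype.ofFinite {z // (D.elim x).wt z = m}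
          have := Fintype.ofFinite {z // D.wt z = m}
          rw [Nat.card_eq_fintype_card, Nat.card_eq_fintype_card]
          refine Fintype.card_lt_of_injective_of_notMem f ?_ (b := ⟨x, hx⟩) ?_
          · rintro ⟨⟨⟨a, i⟩, ha⟩, ha'⟩ ⟨⟨⟨b, j⟩, hb⟩, hb'⟩ hab
            have hi : i = 0 := (h0 _ ha').1
            have hj : j = 0 := (h0 _ hb').1
            subst hi hj
            have : a = b := Subtype.ext congr(($hab).1)
            subst this
            rfl
          · rintro ⟨z, hz⟩
            exact z.1.1.1.2 congr(($hz).1)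
        omega
      · refine ihd (m + 1) (by omega) (by omega) _ ζ D (fun z => ?_) le_rfl g hg h
        exact lt_of_le_of_ne (hD z) fun h => hx ⟨z, h.symm⟩

end FreeFamily

end Magnus
end McCool
end

noncomputable section
namespace McCool
open CategoryTheory
open scoped TensorProduct DirectSum

/-! ### The graded quotients of a free group and the free Lie algebra -/

section FreeLie

open PowerSeries
open scoped commutatorElement

attribute [local instance] LieRing.ofAssociativeRing

section FreeLiePart

variable {R V : Type} [CommRing R] [AddCommGroup V] [Module R V]

theorem freeLiePart_le (s : ℕ) :
    freeLiePart R V s ≤ LinearMap.range (TensorAlgebra.ι R (M := V)) ^ s := inf_le_right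

theorem ι_mem_freeLiePart (v : V) : TensorAlgebra.ι R v ∈ freeLiePart R V 1 :=
  ⟨LieSubalgebra.subset_lieSpan ⟨v, rfl⟩, by rw [pow_one]; exact ⟨v, rfl⟩⟩

theorem commutator_mem_freeLiePart {a b : ℕ} {x y : TensorAlgebra R V}
    (hx : x ∈ freeLiePart R V a) (hy : y ∈ freeLiePart R V b) :
    x * y - y * x ∈ freeLiePart R V (a + b) := by
  refine ⟨LieSubalgebra.lie_mem _ hx.1 hy.1, sub_mem ?_ ?_⟩
  · rw [pow_add]
    exact Submodule.mul_mem_mul hx.2 hy.2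
  · rw [add_comm, pow_add]
    exact Submodule.mul_mem_mul hy.2 hx.2

end FreeLiePart

variable (q : ℕ)

/-- The Magnus homomorphism `x_i ↦ 1 + v_i X`. -/
def magnus : FreeGroup (Fin q) →* (TensorAlgebra ℤ (Fin q → ℤ))⟦X⟧ˣ :=
  FreeGroup.lift fun i => oneAddX (TensorAlgebra.ι ℤ (Pi.basisFun ℤ (Fin q) i))

theorem hasLead_magnus_one (g : FreeGroup (Fin q)) :
    ∃ t ∈ freeLiePart ℤ (Fin q → ℤ) 1, HasLead 1 t (magnus q g : (TensorAlgebra ℤ (Fin q → ℤ))⟦X⟧) := by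
  induction g using FreeGroup.induction_on with
  | C1 => exact ⟨0, zero_mem _, by rw [map_one]; exact hasLead_one 1⟩
  | of i =>
    refine ⟨_, ι_mem_freeLiePart (Pi.basisFun ℤ (Fin q) i), ?_⟩
    rw [magnus, FreeGroup.lift_apply_of]
    exact hasLead_oneAddX _
  | inv_of i h =>
    obtain ⟨t, ht, h⟩ := h
    refine ⟨-t, neg_mem ht, ?_⟩
    rw [map_inv]
    exact h.inv le_rfl
  | mul x y hx hy =>
    obtain ⟨t, ht, h⟩ := hx
    obtain ⟨t', ht', h'⟩ := hy
    refine ⟨t + t', add_mem ht ht', ?_⟩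
    rw [map_mul]
    exact h.mul le_rfl h'

theorem hasLead_magnus {s : ℕ} (hs : 1 ≤ s) (g : FreeGroup (Fin q)) (hg : g ∈ dcs _ s) :
    ∃ t ∈ freeLiePart ℤ (Fin q → ℤ) s, HasLead s t (magnus q g : (TensorAlgebra ℤ (Fin q → ℤ))⟦X⟧) := by
  induction s, hs using Nat.le_induction generalizing g with
  | base => exact hasLead_magnus_one q g
  | succ w hw ih =>
    have : dcs (FreeGroup (Fin q)) (w + 1) = ⁅dcs (FreeGroup (Fin q)) w, ⊤⁆ := by
      obtain ⟨v, rfl⟩ := Nat.exists_eq_add_of_le' hw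
      rfl
    rw [this, Subgroup.commutator_def] at hg
    induction hg using Subgroup.closure_induction with
    | mem x hx =>
      obtain ⟨y, hy, z, -, rfl⟩ := hx
      obtain ⟨t, ht, h⟩ := ih y hy
      obtain ⟨t', ht', h'⟩ := hasLead_magnus_one q z
      refine ⟨_, commutator_mem_freeLiePart ht ht', ?_⟩
      rw [map_commutatorElement]
      exact h.commutator hw le_rfl h'
    | one => exact ⟨0, zero_mem _, by rw [map_one]; exact hasLead_one _⟩
    | mul x y _ _ hx hy =>
      obtain ⟨t, ht, h⟩ := hx
      obtain ⟨t', ht', h'⟩ := hy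
      refine ⟨t + t', add_mem ht ht', ?_⟩
      rw [map_mul]
      exact h.mul (by omega) h'
    | inv x _ hx =>
      obtain ⟨t, ht, h⟩ := hx
      refine ⟨-t, neg_mem ht, ?_⟩
      rw [map_inv]
      exact h.inv (by omega)

/-- The elimination starts from the free generators, all of weight one. Their leads are a basis of
`V`, which generates the tensor algebra freely. -/
theorem mem_dcs_succ_of_hasLead {s : ℕ} (hs : 1 ≤ s) (g : FreeGroup (Fin q))
    (hg : HasLead s 0 (magnus q g : (TensorAlgebra ℤ (Fin q → ℤ))⟦X⟧)) : g ∈ dcs _ (s + 1) := by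
  let D : FreeFamily (magnus q) s (Fin q) :=
    { elt := FreeGroup.of
      lead := fun i => TensorAlgebra.ι ℤ (Pi.basisFun ℤ (Fin q) i)
      wt := fun _ => 1
      one_le := fun _ => le_rfl
      wt_le := fun _ => hs
      mem := fun _ => Subgroup.mem_top _
      hasLead := fun i => by
        rw [magnus, FreeGroup.lift_apply_of]
        exact hasLead_oneAddX _
      free := (TensorAlgebra.equivFreeAlgebra (Pi.basisFun ℤ (Fin q))).symm.injective }
  refine FreeFamily.mem_dcs_of_hasLead (fun g => ?_) s 1 le_rfl (by omega) _ (Fin q) D (fun _ => le_rfl)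
    le_rfl g ?_ hg
  · obtain ⟨t, -, h⟩ := hasLead_magnus_one q g
    exact ⟨t, h⟩
  · rw [show D.elt = FreeGroup.of from rfl, FreeGroup.closure_range_of, top_sup_eq]
    exact Subgroup.mem_top g

/-- The homomorphism `Γ^s F → L_s[V]` taking an element to the leading term of its image under the
Magnus homomorphism. -/
def lieLead {s : ℕ} (hs : 1 ≤ s) : dcs (FreeGroup (Fin q)) s →*
    Multiplicative (freeLiePart ℤ (Fin q → ℤ) s) where
  toFun g := .ofAdd ⟨coeff s (magnus q g : (TensorAlgebra ℤ (Fin q → ℤ))⟦X⟧), by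
    obtain ⟨t, ht, h⟩ := hasLead_magnus q hs g g.2
    rwa [h.coeff_eq hs]⟩
  map_one' := by
    apply Multiplicative.toAdd.injective
    apply Subtype.ext
    simp [coeff_one, Nat.pos_iff_ne_zero.1 hs]
  map_mul' g g' := by
    apply Multiplicative.toAdd.injective
    apply Subtype.ext
    obtain ⟨t, -, h⟩ := hasLead_magnus q hs g g.2
    obtain ⟨t', -, h'⟩ := hasLead_magnus q hs g' g'.2
    have := (h.mul hs h').coeff_eq hs
    rw [← h.coeff_eq hs, ← h'.coeff_eq hs, ← Units.val_mul, ← map_mul] at this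
    exact this

/-- One inclusion holds because deeper elements have higher leading degree; the other is the
elimination argument in `mem_dcs_succ_of_hasLead`. -/
theorem ker_lieLead {s : ℕ} (hs : 1 ≤ s) :
    (lieLead q hs).ker = (dcs (FreeGroup (Fin q)) (s + 1)).subgroupOf (dcs _ s) := by
  ext g
  rw [MonoidHom.mem_ker, Subgroup.mem_subgroupOf]
  have h0 : lieLead q hs g = 1 ↔
      coeff s (magnus q g : (TensorAlgebra ℤ (Fin q → ℤ))⟦X⟧) = 0 := by
    rw [← Multiplicative.toAdd.injective.eq_iff]
    exact Subtype.ext_iff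
  rw [h0]
  constructor
  · intro h
    obtain ⟨t, ht, h'⟩ := hasLead_magnus q hs g g.2
    apply mem_dcs_succ_of_hasLead q hs
    rwa [← h, h'.coeff_eq hs]
  · intro h
    obtain ⟨t, ht, h'⟩ := hasLead_magnus q (by omega) g h
    exact (h'.of_lt (Nat.lt_succ_self s)).coeff_eq hs

/-- The leading terms of elements of `Γ^{s+1} F`. -/
def leadTerms (s : ℕ) : Submodule ℤ (TensorAlgebra ℤ (Fin q → ℤ)) where
  carrier := {t | ∃ g ∈ dcs (FreeGroup (Fin q)) (s + 1),
    HasLead (s + 1) t (magnus q g : (TensorAlgebra ℤ (Fin q → ℤ))⟦X⟧)}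
  zero_mem' := ⟨1, one_mem _, by rw [map_one]; exact hasLead_one _⟩
  add_mem' := by
    rintro x y ⟨g, hg, h⟩ ⟨g', hg', h'⟩
    exact ⟨g * g', mul_mem hg hg', by rw [map_mul]; exact h.mul (by omega) h'⟩
  smul_mem' := by
    rintro c x ⟨g, hg, h⟩
    refine ⟨g ^ c, zpow_mem hg c, ?_⟩
    rw [map_zpow, Algebra.smul_def, eq_intCast, ← zsmul_eq_mul]
    exact h.zpow (by omega) c

theorem leadTerms_le (s : ℕ) : leadTerms q s ≤ freeLiePart ℤ (Fin q → ℤ) (s + 1) := by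
  rintro t ⟨g, hg, h⟩
  obtain ⟨t', ht', h'⟩ := hasLead_magnus q (by omega) g hg
  rwa [← h.coeff_eq (by omega), h'.coeff_eq (by omega)]

theorem commutator_mem_leadTerms {a b : ℕ} {x y : TensorAlgebra ℤ (Fin q → ℤ)}
    (hx : x ∈ leadTerms q a) (hy : y ∈ leadTerms q b) :
    x * y - y * x ∈ leadTerms q (a + b + 1) := by
  obtain ⟨g, hg, h⟩ := hx
  obtain ⟨g', hg', h'⟩ := hy
  have e : a + b + 1 + 1 = a + 1 + (b + 1) := by omega
  refine ⟨⁅g, g'⁆, ?_, ?_⟩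
  · rw [e]
    exact commutator_mem_dcs (by omega) (by omega) hg hg'
  · rw [e, map_commutatorElement]
    exact h.commutator (by omega) (by omega) h'

/-- The sum of the modules of leading terms is a Lie subalgebra. -/
def leadTermsLie : LieSubalgebra ℤ (TensorAlgebra ℤ (Fin q → ℤ)) where
  toSubmodule := ⨆ s, leadTerms q s
  lie_mem' := by
    intro x y hx hy
    change x * y - y * x ∈ ⨆ s, leadTerms q s
    change x ∈ ⨆ s, leadTerms q s at hx
    change y ∈ ⨆ s, leadTerms q s at hy
    induction hx using Submodule.iSup_induction' with
    | zero => rw [zero_mul, mul_zero, sub_zero]; exact zero_mem _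
    | add x x' _ _ h h' =>
      have := add_mem h h'
      rwa [show x * y - y * x + (x' * y - y * x') = (x + x') * y - y * (x + x') by noncomm_ring]
        at this
    | mem a x hx =>
      induction hy using Submodule.iSup_induction' with
      | zero => rw [zero_mul, mul_zero, sub_zero]; exact zero_mem _
      | add y y' _ _ h h' =>
        have := add_mem h h'
        rwa [show x * y - y * x + (x * y' - y' * x) = x * (y + y') - (y + y') * x by noncomm_ring]
          at this
      | mem b y hy => exact Submodule.mem_iSup_of_mem _ (commutator_mem_leadTerms q hx hy)

theorem lieSpan_le_leadTermsLie :
    LieSubalgebra.lieSpan ℤ (TensorAlgebra ℤ (Fin q → ℤ)) (Set.range (TensorAlgebra.ι ℤ)) ≤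
      leadTermsLie q := by
  rw [LieSubalgebra.lieSpan_le]
  rintro _ ⟨v, rfl⟩
  refine Submodule.mem_iSup_of_mem 0 (p := leadTerms q) ?_
  have : ⊤ ≤ (leadTerms q 0).comap (TensorAlgebra.ι ℤ) := by
    rw [← (Pi.basisFun ℤ (Fin q)).span_eq, Submodule.span_le]
    rintro _ ⟨i, rfl⟩
    refine ⟨FreeGroup.of i, Subgroup.mem_top _, ?_⟩
    rw [magnus, FreeGroup.lift_apply_of]
    exact hasLead_oneAddX _
  exact this (Submodule.mem_top)

/-- The leading terms of all degrees span a Lie subalgebra that contains `V`, hence `L[V]`. Each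
`leadTerms q s` is homogeneous of degree `s + 1`, so the homogeneous components of an element of
that span are again leading terms. -/
theorem freeLiePart_succ_le (s : ℕ) : freeLiePart ℤ (Fin q → ℤ) (s + 1) ≤ leadTerms q s := by
  rintro x ⟨hx, hx'⟩
  have h : ∀ y ∈ ⨆ s, leadTerms q s, ∀ s, (DirectSum.decompose
      (fun n : ℕ => LinearMap.range (TensorAlgebra.ι ℤ (M := Fin q → ℤ)) ^ n) y (s + 1) :
        TensorAlgebra ℤ (Fin q → ℤ)) ∈ leadTerms q s := by
    intro y hy s
    induction hy using Submodule.iSup_induction' with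
    | zero => rw [DirectSum.decompose_zero]; exact zero_mem _
    | add y y' _ _ h h' => rw [DirectSum.decompose_add]; exact add_mem h h'
    | mem a y hy =>
      have hy' := (leadTerms_le q a hy).2
      by_cases has : a = s
      · subst has
        rw [DirectSum.decompose_of_mem_same _ hy']
        exact hy
      · rw [DirectSum.decompose_of_mem_ne _ hy' (by omega)]
        exact zero_mem _
  have := h x (lieSpan_le_leadTermsLie q hx) s
  rwa [DirectSum.decompose_of_mem_same _ hx'] at this

theorem lieLead_surjective {s : ℕ} (hs : 1 ≤ s) : Function.Surjective (lieLead q hs) := by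
  obtain ⟨s, rfl⟩ := Nat.exists_eq_add_of_le' hs
  intro x
  obtain ⟨g, hg, h⟩ := freeLiePart_succ_le q s x.toAdd.2
  refine ⟨⟨g, hg⟩, ?_⟩
  apply Multiplicative.toAdd.injective
  apply Subtype.ext
  exact h.coeff_eq hs

instance (s : ℕ) : Module.Finite ℤ (freeLiePart ℤ (Fin q → ℤ) s) := by
  have h1 : (LinearMap.range (TensorAlgebra.ι ℤ (M := Fin q → ℤ))).FG := by
    rw [LinearMap.range_eq_map]
    exact (Module.Finite.fg_top).map _
  have h2 := h1.pow s
  have := isNoetherian_of_fg_of_noetherian _ h2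
  exact Module.Finite.of_injective (Submodule.inclusion (freeLiePart_le s))
    (Submodule.inclusion_injective _)

instance (s : ℕ) : Module.Free ℤ (freeLiePart ℤ (Fin q → ℤ) s) := inferInstance

/-- The degree one part of the free Lie algebra is `V`. -/
def freeLiePartOne {R V : Type} [CommRing R] [AddCommGroup V] [Module R V] :
    V ≃ₗ[R] freeLiePart R V 1 :=
  LinearEquiv.ofBijective ((TensorAlgebra.ι R).codRestrict _ ι_mem_freeLiePart) ⟨by
    intro v w h
    exact TensorAlgebra.ι_leftInverse.injective congr(($h).1), by
    rintro ⟨x, -, hx⟩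
    rw [pow_one] at hx
    obtain ⟨v, rfl⟩ := hx
    exact ⟨v, rfl⟩⟩

end FreeLie
end McCool
end

noncomputable section
namespace McCool
open CategoryTheory
open scoped TensorProduct DirectSum

/-! ### Alternating evaluation of cohomology classes on commuting tuples -/

section AlternatingEvaluation

variable {G : Type} [Group G]

/-- The alternating sum of the values of a cochain on the permutations of a tuple. -/
def altEval {p : ℕ} (g : Fin p → G) : Coch G p →+ ℤ :=
  AddMonoidHom.mk' (fun f => ∑ σ : Equiv.Perm (Fin p), (Equiv.Perm.sign σ : ℤ) * f (g ∘ σ)) fun f f' => by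
    simp [mul_add, Finset.sum_add_distrib]

omit [Group G] in
theorem altEval_apply {p : ℕ} (g : Fin p → G) (f : Coch G p) :
    altEval g f = ∑ σ : Equiv.Perm (Fin p), (Equiv.Perm.sign σ : ℤ) * f (g ∘ σ) := rfl

/-- Exchanging the two entries to be multiplied leaves the contracted tuple unchanged, since they
commute, and reverses the sign. -/
theorem sum_sign_contractNth_castSucc {p : ℕ} (g : Fin (p + 1) → G) (hg : ∀ i j, Commute (g i) (g j))
    (f : Coch G p) (j : Fin p) :
    ∑ σ : Equiv.Perm (Fin (p + 1)), (Equiv.Perm.sign σ : ℤ) *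
      f (Fin.contractNth j.castSucc (· * ·) (g ∘ σ)) = 0 := by
  have hne : j.castSucc ≠ j.succ := Fin.castSucc_lt_succ.ne
  have h : ∑ σ : Equiv.Perm (Fin (p + 1)), (Equiv.Perm.sign σ : ℤ) *
      f (Fin.contractNth j.castSucc (· * ·) (g ∘ σ)) =
      -∑ σ : Equiv.Perm (Fin (p + 1)), (Equiv.Perm.sign σ : ℤ) *
      f (Fin.contractNth j.castSucc (· * ·) (g ∘ σ)) := by
    conv_lhs => rw [← Equiv.sum_comp (Equiv.mulRight (Equiv.swap j.castSucc j.succ))]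
    rw [← Finset.sum_neg_distrib]
    refine Finset.sum_congr rfl fun σ _ => ?_
    have hc : Fin.contractNth j.castSucc (· * ·) (g ∘ ⇑(σ * Equiv.swap j.castSucc j.succ)) =
        Fin.contractNth j.castSucc (· * ·) (g ∘ σ) := by
      funext k
      rcases lt_trichotomy (k : ℕ) j with hk | hk | hk
      · rw [Fin.contractNth_apply_of_lt _ _ _ _ (by simpa using hk),
          Fin.contractNth_apply_of_lt _ _ _ _ (by simpa using hk)]
        simp only [Function.comp_apply, Equiv.Perm.mul_apply]
        rw [Equiv.swap_apply_of_ne_of_ne]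
        · exact fun h => by simp [Fin.ext_iff] at h; omega
        · exact fun h => by simp [Fin.ext_iff] at h; omega
      · obtain rfl : k = j := Fin.ext hk
        rw [Fin.contractNth_apply_of_eq _ _ _ _ (by simp),
          Fin.contractNth_apply_of_eq _ _ _ _ (by simp)]
        simp only [Function.comp_apply, Equiv.Perm.mul_apply, Equiv.swap_apply_left,
          Equiv.swap_apply_right]
        exact hg _ _
      · rw [Fin.contractNth_apply_of_gt _ _ _ _ (by simpa using hk),
          Fin.contractNth_apply_of_gt _ _ _ _ (by simpa using hk)]
        simp only [Function.comp_apply, Equiv.Perm.mul_apply]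
        rw [Equiv.swap_apply_of_ne_of_ne]
        · exact fun h => by simp [Fin.ext_iff] at h; omega
        · exact fun h => by simp [Fin.ext_iff] at h; omega
    rw [Equiv.coe_mulRight]
    beta_reduce
    rw [hc, Equiv.Perm.sign_mul, Equiv.Perm.sign_swap hne]
    simp
  linarith

/-- The inner faces cancel by `sum_sign_contractNth_castSucc`. The first and the last face differ by
a cyclic rotation of the tuple, whose sign `(-1)^p` makes them cancel. -/
theorem altEval_δ {p : ℕ} (g : Fin (p + 1) → G) (hg : ∀ i j, Commute (g i) (g j)) (f : Coch G p) :
    altEval g (δ f) = 0 := by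
  have h1 : ∀ x : Fin (p + 1) → G, Fin.contractNth (Fin.last p) (· * ·) x =
      fun i => x i.castSucc := fun x => by
    funext k
    rw [Fin.contractNth_apply_of_lt _ _ _ _ (by simp)]
  have h2 : ∑ σ : Equiv.Perm (Fin (p + 1)), (Equiv.Perm.sign σ : ℤ) * f (fun i => g (σ i.castSucc)) =
      (-1) ^ p * ∑ σ : Equiv.Perm (Fin (p + 1)), (Equiv.Perm.sign σ : ℤ) * f (fun i => g (σ i.succ)) := by
    conv_rhs => rw [← Equiv.sum_comp (Equiv.mulRight (finRotate (p + 1))⁻¹)]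
    rw [Finset.mul_sum]
    refine Finset.sum_congr rfl fun σ _ => ?_
    rw [Equiv.coe_mulRight, Equiv.Perm.sign_mul, Equiv.Perm.sign_inv, sign_finRotate]
    have h3 : ∀ i : Fin p, (finRotate (p + 1))⁻¹ i.succ = i.castSucc := fun i => by
      rw [Equiv.Perm.inv_eq_iff_eq, ← Fin.coeSucc_eq_succ, finRotate_apply]
    simp only [Equiv.Perm.mul_apply, h3]
    push_cast
    rw [mul_comm (_ : ℤ) ((-1) ^ p), ← mul_assoc, ← mul_assoc, ← pow_add, Even.neg_one_pow ⟨p, rfl⟩,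
      one_mul]
  rw [altEval_apply]
  simp only [δ_apply, mul_add, Finset.sum_add_distrib, Finset.mul_sum]
  rw [Finset.sum_comm, Fin.sum_univ_castSucc]
  have h4 : ∀ j : Fin p, ∑ σ : Equiv.Perm (Fin (p + 1)), (Equiv.Perm.sign σ : ℤ) *
      ((-1) ^ ((j.castSucc : ℕ) + 1) * f (Fin.contractNth j.castSucc (· * ·) (g ∘ σ))) = 0 := by
    intro j
    simp only [mul_left_comm _ ((-1 : ℤ) ^ _)]
    rw [← Finset.mul_sum, sum_sign_contractNth_castSucc g hg, mul_zero]
  rw [Finset.sum_eq_zero fun j _ => h4 j, zero_add]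
  simp only [mul_left_comm _ ((-1 : ℤ) ^ _), h1, Function.comp_apply]
  rw [← Finset.mul_sum, h2, Fin.val_last, ← mul_assoc, ← pow_add, Odd.neg_one_pow ⟨p, by omega⟩]
  ring

theorem altEval_congr {p : ℕ} (g : Fin p → G) (hg : ∀ i j, Commute (g i) (g j)) {z w : Cocyc G p}
    (h : cls z = cls w) : altEval g (val z) = altEval g (val w) := by
  have h' : cls (z - w) = 0 := by rw [cls_sub, h, sub_self]
  rw [← sub_eq_zero, ← map_sub, ← val_sub]
  cases p with
  | zero => rw [eq_zero_of_cls_eq_zero _ h', val_zero, map_zero]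
  | succ p =>
    obtain ⟨f, hf⟩ := exists_δ_of_cls_eq_zero _ h'
    rw [← hf, altEval_δ g hg]

/-- The functional on cohomology given by alternating evaluation at a commuting tuple. -/
def evalH {p : ℕ} (g : Fin p → G) (hg : ∀ i j, Commute (g i) (g j)) : HZ G p →+ ℤ :=
  AddMonoidHom.mk' (fun a => altEval g (val (Function.surjInv cls_surjective a))) fun a b => by
    rw [← map_add, ← val_add]
    apply altEval_congr g hg
    rw [cls_add]
    simp only [Function.surjInv_eq]

theorem evalH_cls {p : ℕ} (g : Fin p → G) (hg : ∀ i j, Commute (g i) (g j)) (z : Cocyc G p) :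
    evalH g hg (cls z) = altEval g (val z) :=
  altEval_congr g hg (Function.surjInv_eq _ _)

/-- The functional on the cohomology ring given by alternating evaluation at a commuting tuple. -/
def evalC {p : ℕ} (g : Fin p → G) (hg : ∀ i j, Commute (g i) (g j)) : CohomologyRing G →+ ℤ :=
  (evalH g hg).comp (DFinsupp.evalAddMonoidHom p)

theorem evalC_of {p : ℕ} (g : Fin p → G) (hg : ∀ i j, Commute (g i) (g j)) (a : HZ G p) :
    evalC g hg (DirectSum.of (HZ G) p a) = evalH g hg a :=
  congrArg (evalH g hg) (DirectSum.of_eq_same p a)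

theorem evalC_of_ne {p m : ℕ} (h : m ≠ p) (g : Fin p → G) (hg : ∀ i j, Commute (g i) (g j))
    (a : HZ G m) : evalC g hg (DirectSum.of (HZ G) m a) = 0 :=
  (congrArg (evalH g hg) (DirectSum.of_eq_of_ne m p a h.symm)).trans (map_zero _)

end AlternatingEvaluation

/-! ### Characters as cohomology classes -/

section Characters

variable {G : Type} [Group G]

/-- The group of homomorphisms `G → ℤ`. -/
abbrev Chars (G : Type) [Group G] : Type := Additive G →+ ℤ

/-- Pullback of characters. -/
def Chars.pullback {K : Type} [Group K] (ψ : Chars K) (φ : G →* K) : Chars G :=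
  AddMonoidHom.comp ψ (MonoidHom.toAdditive φ)

theorem Chars.map_mul (ψ : Chars G) (x y : G) :
    ψ (Additive.ofMul (x * y)) = ψ (Additive.ofMul x) + ψ (Additive.ofMul y) := map_add ψ _ _

theorem δ_one_apply (f : G → ℤ) (x : Fin 2 → G) :
    δ (fun y : Fin 1 → G => f (y 0)) x = f (x 1) - f (x 0 * x 1) + f (x 0) := by
  rw [δ_apply]
  simp [Fin.sum_univ_two, Fin.contractNth]
  ring

/-- A character as a `1`-cocycle. -/
def charZ (ψ : Chars G) : Cocyc G 1 := mkCocyc (fun x => ψ (.ofMul (x 0))) (by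
  funext x
  rw [δ_one_apply fun y => ψ (.ofMul y), Chars.map_mul]
  simp)

theorem val_charZ (ψ : Chars G) : val (charZ ψ) = fun x => ψ (.ofMul (x 0)) := val_mkCocyc _ _

/-- The class of a character in the cohomology ring. -/
def chr : Chars G →+ CohomologyRing G :=
  AddMonoidHom.mk' (fun ψ => DirectSum.of (HZ G) 1 (cls (charZ ψ))) fun ψ ψ' => by
    rw [← map_add, ← cls_add]
    refine congrArg _ (congrArg cls (val_injective ?_))
    rw [val_add, val_charZ, val_charZ, val_charZ]
    rfl

theorem chr_apply (ψ : Chars G) : chr ψ = DirectSum.of (HZ G) 1 (cls (charZ ψ)) := rfl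

theorem of_mul_of_cls {p q : ℕ} (z : Cocyc G p) (w : Cocyc G q) :
    DirectSum.of (HZ G) p (cls z) * DirectSum.of (HZ G) q (cls w) =
      DirectSum.of (HZ G) (p + q) (cls (cupZ z w)) := by
  rw [DirectSum.of_mul_of]
  exact congrArg _ (cup_cls z w)

/-- The product cocycle is the coboundary of `-f`. -/
theorem chr_mul_chr_eq_zero_of (ψ ψ' : Chars G) (f : G → ℤ) (hf : ∀ x y, f (x * y) =
    f x + f y + ψ (.ofMul x) * ψ' (.ofMul y)) : chr ψ * chr ψ' = 0 := by
  rw [chr_apply, chr_apply, of_mul_of_cls, cls_eq_zero_of_δ (m := 1) rfl _ (fun x => -f (x 0)),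
    map_zero]
  intro x
  rw [δ_one_apply (fun y => -f y), val_cupZ, val_charZ, val_charZ]
  simp only [cupC, hf]
  have h0 : (x ∘ Fin.cast rfl) (0 : Fin 2) = x (Fin.castAdd 1 0) := rfl
  have h1 : (x ∘ Fin.cast rfl) (1 : Fin 2) = x (Fin.natAdd 1 0) := rfl
  rw [h0, h1]
  ring

/-- The sum of the two products is the coboundary of minus the pointwise product of the characters.
-/
theorem chr_anticomm (ψ ψ' : Chars G) : chr ψ * chr ψ' = -(chr ψ' * chr ψ) := by
  rw [eq_neg_iff_add_eq_zero, chr_apply, chr_apply, of_mul_of_cls, of_mul_of_cls, ← map_add,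
    ← cls_add, cls_eq_zero_of_δ (m := 1) rfl _
      (fun x => -(ψ (.ofMul (x 0)) * ψ' (.ofMul (x 0)))), map_zero]
  intro x
  rw [δ_one_apply (fun y => -(ψ (.ofMul y) * ψ' (.ofMul y))), val_add, val_cupZ, val_cupZ, val_charZ,
    val_charZ]
  simp only [Pi.add_apply, cupC, Chars.map_mul]
  have h0 : (x ∘ Fin.cast rfl) (0 : Fin 2) = x (Fin.castAdd 1 0) := rfl
  have h1 : (x ∘ Fin.cast rfl) (1 : Fin 2) = x (Fin.natAdd 1 0) := rfl
  rw [h0, h1]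
  ring

theorem cohomologyMap_of {K : Type} [Group K] (φ : G →* K) (n : ℕ) (a : HZ K n) :
    cohomologyMap φ (DirectSum.of (HZ K) n a) = DirectSum.of (HZ G) n (mapH φ n a) :=
  DirectSum.toSemiring_of _ _ _ _ _

theorem cohomologyMap_chr {K : Type} [Group K] (φ : G →* K) (ψ : Chars K) :
    cohomologyMap φ (chr ψ) = chr (ψ.pullback φ) := by
  rw [chr_apply, chr_apply, cohomologyMap_of, mapH_cls]
  refine congrArg _ (congrArg cls (val_injective ?_))
  rw [val_mapZ, val_charZ, val_charZ]
  rfl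

/-- This makes the vanishing of cup products of characters on a free group explicit. The required
identity for `x` a generator prescribes the differences of `f` along the edges of the Cayley graph,
and the identity for all `x` follows by induction on words. -/
theorem exists_quadratic_freeGroup {X : Type} (ψ ψ' : Chars (FreeGroup X)) :
    ∃ f : FreeGroup X → ℤ, ∀ x y, f (x * y) = f x + f y + ψ (.ofMul x) * ψ' (.ofMul y) := by
  obtain ⟨h, hh⟩ := exists_potential fun (w : FreeGroup X) i =>
    ψ (.ofMul (FreeGroup.of i)) * ψ' (.ofMul w)
  have hψ1' : ψ' (.ofMul 1) = 0 := map_zero ψ'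
  have hinv : ∀ (χ : Chars (FreeGroup X)) x, χ (.ofMul x⁻¹) = -χ (.ofMul x) := fun χ x => map_neg χ _
  refine ⟨fun w => h w - h 1, fun x => ?_⟩
  induction x using FreeGroup.induction_on with
  | C1 => intro y; simp
  | of i =>
    intro y
    have h1 := hh y i
    have h2 := hh 1 i
    rw [mul_one, hψ1'] at h2
    linarith
  | inv_of i ih =>
    intro y
    have h1 := ih ((FreeGroup.of i)⁻¹ * y)
    have h2 := ih (FreeGroup.of i)⁻¹
    rw [mul_inv_cancel_left, Chars.map_mul, hinv] at h1
    rw [mul_inv_cancel, hinv] at h2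
    rw [hinv]
    linarith
  | mul a b ha hb =>
    intro y
    have h1 := ha (b * y)
    have h2 := ha b
    have h3 := hb y
    rw [Chars.map_mul] at h1
    rw [mul_assoc, Chars.map_mul]
    linarith

theorem exists_quadratic [IsFreeGroup G] (ψ ψ' : Chars G) :
    ∃ f : G → ℤ, ∀ x y, f (x * y) = f x + f y + ψ (.ofMul x) * ψ' (.ofMul y) := by
  let e := IsFreeGroup.toFreeGroup G
  obtain ⟨f, hf⟩ := exists_quadratic_freeGroup (ψ.pullback e.symm.toMonoidHom)
    (ψ'.pullback e.symm.toMonoidHom)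
  refine ⟨fun x => f (e x), fun x y => ?_⟩
  beta_reduce
  rw [map_mul, hf]
  simp [Chars.pullback]

theorem chr_pullback_mul_eq_zero {K : Type} [Group K] [IsFreeGroup K] (φ : G →* K) (ψ ψ' : Chars K) :
    chr (ψ.pullback φ) * chr (ψ'.pullback φ) = 0 := by
  obtain ⟨f, hf⟩ := exists_quadratic ψ ψ'
  exact chr_mul_chr_eq_zero_of _ _ (fun x => f (φ x)) fun x y => by
    rw [map_mul, hf]
    rfl

end Characters

/-! ### Products of characters -/

section Products

variable {G : Type} [Group G]

theorem exists_prod_chr (l : List (Chars G)) : ∃ z : Cocyc G l.length,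
    (l.map chr).prod = DirectSum.of (HZ G) l.length (cls z) ∧
      val z = fun x => ∏ i, l.get i (.ofMul (x i)) := by
  induction l with
  | nil =>
    refine ⟨oneZ, rfl, ?_⟩
    rw [val_oneZ]
    funext x
    simp
  | cons ψ l ih =>
    obtain ⟨z, hz, hv⟩ := ih
    have h : 1 + l.length = (ψ :: l).length := by rw [List.length_cons, add_comm]
    have hδ : δ (fun x : Fin (ψ :: l).length → G => val (cupZ (charZ ψ) z) (x ∘ Fin.cast h)) = 0 := by
      generalize (ψ :: l).length = m at h
      subst h
      exact δ_val (cupZ (charZ ψ) z)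
    refine ⟨mkCocyc _ hδ, ?_, ?_⟩
    · rw [List.map_cons, List.prod_cons, hz, chr_apply, of_mul_of_cls]
      have := gradedMk_eq h.symm (cupZ (charZ ψ) z) (mkCocyc _ hδ) fun x => by
        rw [val_mkCocyc]
        rfl
      exact DirectSum.of_eq_of_gradedMonoid_eq this
    · rw [val_mkCocyc]
      funext x
      rw [val_cupZ, cupC, val_charZ, hv]
      refine Eq.trans ?_ (Fin.prod_univ_succ (n := l.length) fun i => (ψ :: l).get i (.ofMul (x i))).symm
      refine congrArg₂ (· * ·) rfl (Finset.prod_congr rfl fun i _ => ?_)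
      refine congrArg (l.get i) (congrArg (fun j => Additive.ofMul (x j)) (Fin.ext ?_))
      simp

/-- The product is represented by the cochain `∏ l_i(x_i)`, so its alternating sum is the Leibniz
expansion of a determinant. -/
theorem evalC_prod_chr (l : List (Chars G)) {p : ℕ} (h : l.length = p) (g : Fin p → G)
    (hg : ∀ i j, Commute (g i) (g j)) : evalC g hg (l.map chr).prod =
      Matrix.det (Matrix.of fun i j => l.get (i.cast h.symm) (.ofMul (g j))) := by
  subst h
  obtain ⟨z, hz, hv⟩ := exists_prod_chr l
  rw [hz, evalC_of, evalH_cls, altEval_apply, hv, ← Matrix.det_transpose, Matrix.det_apply]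
  refine Finset.sum_congr rfl fun σ _ => ?_
  rw [Units.smul_def, smul_eq_mul]
  rfl

theorem evalC_prod_chr_of_ne (l : List (Chars G)) {p : ℕ} (h : l.length ≠ p) (g : Fin p → G)
    (hg : ∀ i j, Commute (g i) (g j)) : evalC g hg (l.map chr).prod = 0 := by
  obtain ⟨z, hz, hv⟩ := exists_prod_chr l
  rw [hz, evalC_of_ne h]

end Products
end McCool
end

noncomputable section
namespace McCool
open CategoryTheory
open scoped TensorProduct DirectSum

/-! ### Square-free monomials -/

section Monomials

variable {ι : Type} {N : ℕ}

/-- The list of pairs `(m, i)` with `c m = i`. -/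
def suppList (c : Fin N → Option ι) : List (Fin N × ι) :=
  (List.finRange N).filterMap fun m => (c m).map (Prod.mk m)

/-- The degree of the square-free monomial with exponents `c`. -/
def monoDeg (c : Fin N → Option ι) : ℕ := (suppList c).length

/-- The ordered monomial in the variables `x m i`, in which the variable with first index `m`
is `x m (c m)`, or does not occur if `c m` is `none`. -/
def mono {R : Type*} [Monoid R] (x : Fin N → ι → R) (c : Fin N → Option ι) : R :=
  (List.ofFn fun m => (c m).elim 1 (x m)).prod

theorem mem_suppList {c : Fin N → Option ι} {p : Fin N × ι} : p ∈ suppList c ↔ c p.1 = some p.2 := by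
  simp only [suppList, List.mem_filterMap, List.mem_finRange, true_and, Option.map_eq_some_iff]
  constructor
  · rintro ⟨m, i, h, rfl⟩
    exact h
  · intro h
    exact ⟨p.1, p.2, h, rfl⟩

theorem suppList_nodup (c : Fin N → Option ι) : (suppList c).Nodup := by
  refine (List.nodup_finRange N).filterMap ?_
  rintro a b ⟨m, i⟩ ha hb
  simp only [Option.mem_def, Option.map_eq_some_iff, Prod.mk.injEq] at ha hb
  obtain ⟨_, _, rfl, _⟩ := ha
  obtain ⟨_, _, rfl, _⟩ := hb
  rfl

theorem suppList_succ (c : Fin (N + 1) → Option ι) : suppList c =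
    (c 0).toList.map (Prod.mk 0) ++ (suppList fun m => c m.succ).map fun p => (p.1.succ, p.2) := by
  rw [suppList, List.finRange_succ, List.filterMap_cons, suppList, List.filterMap_map,
    List.map_filterMap]
  cases h : c 0 <;> simp [Function.comp_def]

theorem monoDeg_succ (c : Fin (N + 1) → Option ι) :
    monoDeg c = (c 0).elim 0 (fun _ => 1) + monoDeg fun m => c m.succ := by
  rw [monoDeg, suppList_succ, List.length_append, List.length_map, List.length_map]
  cases c 0 <;> rfl

theorem mono_succ {R : Type*} [Monoid R] (x : Fin (N + 1) → ι → R) (c : Fin (N + 1) → Option ι) :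
    mono x c = (c 0).elim 1 (x 0) * mono (fun m => x m.succ) fun m => c m.succ := by
  rw [mono, List.ofFn_succ, List.prod_cons]
  rfl

theorem mono_eq_prod {R : Type*} [Monoid R] (x : Fin N → ι → R) (c : Fin N → Option ι) :
    mono x c = ((suppList c).map fun p => x p.1 p.2).prod := by
  induction N with
  | zero => rfl
  | succ N ih =>
    rw [mono_succ, suppList_succ, List.map_append, List.prod_append, List.map_map, ih]
    congr 1
    · cases c 0 <;> simp
    · rw [List.map_map]
      rfl

theorem map_mono {R S : Type*} [Monoid R] [Monoid S] (f : R →* S) (x : Fin N → ι → R)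
    (c : Fin N → Option ι) : f (mono x c) = mono (fun m i => f (x m i)) c := by
  rw [mono_eq_prod, mono_eq_prod, map_list_prod, List.map_map]
  rfl

theorem mul_mono_of_anticomm {R : Type*} [Ring R] (x : Fin N → ι → R) (y : R)
    (h : ∀ m i, y * x m i = -(x m i * y)) (c : Fin N → Option ι) :
    y * mono x c = (-1) ^ monoDeg c * (mono x c * y) := by
  rw [mono_eq_prod, monoDeg]
  induction suppList c with
  | nil => simp
  | cons p l ih =>
    rw [List.map_cons, List.prod_cons, ← mul_assoc, h, neg_mul, mul_assoc, ih, List.length_cons,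
      pow_succ]
    have hc : Commute (x p.1 p.2) ((-1) ^ l.length) := by
      rcases neg_one_pow_eq_or R l.length with h | h <;> rw [h]
      · exact Commute.one_right _
      · exact (Commute.one_right _).neg_right
    rw [← mul_assoc (x p.1 p.2), hc.eq]
    noncomm_ring

theorem eq_of_suppList_subset {c c' : Fin N → Option ι} (h : suppList c ⊆ suppList c')
    (hd : monoDeg c' ≤ monoDeg c) : c = c' := by
  have hp : (suppList c).Perm (suppList c') :=
    ((suppList_nodup c).subperm h).perm_of_length_le hd
  funext m
  refine Option.ext fun i => ?_
  have := hp.mem_iff (a := (m, i))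
  rw [mem_suppList, mem_suppList] at this
  exact this

/-- A monomial either omits the first factor or uses one of its `q` variables, which matches the
recursion of `bettiPower`. Only this inequality is needed. -/
theorem bettiPower_le_card (q N n : ℕ) :
    bettiPower q N n ≤ Nat.card {c : Fin N → Option (Fin q) // monoDeg c = n} := by
  induction N generalizing n with
  | zero =>
    cases n with
    | zero =>
      have : Nonempty {c : Fin 0 → Option (Fin q) // monoDeg c = 0} := ⟨⟨Fin.elim0, rfl⟩⟩
      exact Nat.card_pos
    | succ n => exact Nat.zero_le _
  | succ N ih =>
    cases n with
    | zero =>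
      have : Nonempty {c : Fin (N + 1) → Option (Fin q) // monoDeg c = 0} :=
        ⟨⟨fun _ => none, by simp [monoDeg, suppList]⟩⟩
      exact Nat.card_pos
    | succ n =>
      let f : {c : Fin N → Option (Fin q) // monoDeg c = n + 1} ⊕
          Fin q × {c : Fin N → Option (Fin q) // monoDeg c = n} →
          {c : Fin (N + 1) → Option (Fin q) // monoDeg c = n + 1} :=
        Sum.elim (fun c => ⟨Fin.cons none c.1, by
            rw [monoDeg_succ]; simpa using c.2⟩)
          (fun p => ⟨Fin.cons (some p.1) p.2.1, by
            rw [monoDeg_succ]; simpa [add_comm] using p.2.2⟩)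
      have hf : Function.Injective f := by
        rintro (⟨c, hc⟩ | ⟨i, c, hc⟩) (⟨d, hd⟩ | ⟨j, d, hd⟩) h
        all_goals
          have h0 := congrFun congr(($h).1) 0
          have h1 : ∀ m : Fin N, _ := fun m => congrFun congr(($h).1) m.succ
          simp [f] at h0 h1
        · congr 1
          exact Subtype.ext (funext h1)
        · subst h0
          congr 2
          exact Subtype.ext (funext h1)
      have h1 := Nat.card_le_card_of_injective f hf
      rw [Nat.card_sum, Nat.card_prod, Nat.card_fin] at h1
      exact (add_le_add (ih _) (Nat.mul_le_mul le_rfl (ih _))).trans h1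

end Monomials

/-! ### Dual functionals and spanning by monomials -/

section DualFunctionals

variable {ι : Type} {N : ℕ} {G : Type} [Group G]

theorem mono_chr_mem (φ : Fin N → ι → Chars G) (c : Fin N → Option ι) :
    ∃ a : HZ G (monoDeg c), mono (fun m i => chr (φ m i)) c = DirectSum.of (HZ G) _ a := by
  obtain ⟨z, hz, -⟩ := exists_prod_chr ((suppList c).map fun p => φ p.1 p.2)
  have hl : ((suppList c).map fun p => φ p.1 p.2).length = monoDeg c := List.length_map _
  rw [List.map_map] at hz
  rw [mono_eq_prod, ← hl]
  exact ⟨cls z, hz⟩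

/-- Characters `φ m i` with a dual family of elements `γ m i`, such that elements with different
first indices commute. -/
structure IsDualFamily [DecidableEq ι] (φ : Fin N → ι → Chars G) (γ : Fin N → ι → G) : Prop where
  dual : ∀ p p' : Fin N × ι, φ p.1 p.2 (.ofMul (γ p'.1 p'.2)) = if p = p' then 1 else 0
  commute : ∀ m m' i i', m ≠ m' → Commute (γ m i) (γ m' i')

variable [DecidableEq ι] {φ : Fin N → ι → Chars G} {γ : Fin N → ι → G}

theorem IsDualFamily.commute_suppList (h : IsDualFamily φ γ) (c : Fin N → Option ι)
    (j j' : Fin (monoDeg c)) :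
    Commute (γ ((suppList c).get j).1 ((suppList c).get j).2)
      (γ ((suppList c).get j').1 ((suppList c).get j').2) := by
  by_cases hm : ((suppList c).get j).1 = ((suppList c).get j').1
  · have h1 := mem_suppList.1 ((suppList c).get_mem j)
    have h2 := mem_suppList.1 ((suppList c).get_mem j')
    rw [hm, h2] at h1
    rw [hm, Option.some_injective _ h1]
  · exact h.commute _ _ _ _ hm

/-- The functional dual to a monomial in characters. -/
def IsDualFamily.functional (h : IsDualFamily φ γ) (c : Fin N → Option ι) : CohomologyRing G →+ ℤ :=
  evalC (fun j : Fin (monoDeg c) => γ ((suppList c).get j).1 ((suppList c).get j).2)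
    (h.commute_suppList c)

/-- For equal monomials the determinant is that of the identity matrix. For different monomials of
the same degree, some variable of `c'` does not occur in `c` and gives a zero row. -/
theorem IsDualFamily.functional_mono (h : IsDualFamily φ γ) (c c' : Fin N → Option ι) :
    h.functional c (mono (fun m i => chr (φ m i)) c') = if c' = c then 1 else 0 := by
  have e : mono (fun m i => chr (φ m i)) c' =
      (((suppList c').map fun p => φ p.1 p.2).map chr).prod := by
    rw [mono_eq_prod, List.map_map]
    rfl
  rw [e, functional]
  by_cases hd : monoDeg c' = monoDeg c
  · rw [evalC_prod_chr _ ((List.length_map _).trans hd)]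
    split_ifs with hc
    · subst hc
      refine (congrArg Matrix.det ?_).trans Matrix.det_one
      ext i j
      rw [Matrix.of_apply, Matrix.one_apply, List.get_eq_getElem, List.getElem_map]
      exact (h.dual _ _).trans
        (if_congr ((suppList_nodup c').getElem_inj_iff.trans (Fin.ext_iff (a := i) (b := j)).symm)
          rfl rfl)
    · have : ¬ suppList c' ⊆ suppList c := fun h => hc (eq_of_suppList_subset h hd.ge)
      simp only [List.subset_def, not_forall] at this
      obtain ⟨p, hp, hp'⟩ := this
      obtain ⟨i, hi⟩ := List.mem_iff_get.1 hp
      refine Matrix.det_eq_zero_of_row_eq_zero (Fin.cast hd i) fun j => ?_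
      rw [Matrix.of_apply, List.get_eq_getElem, List.getElem_map]
      refine (h.dual _ _).trans (if_neg fun hij => hp' ?_)
      rw [← hi]
      have h2 : (suppList c').get i = (suppList c).get j := hij
      rw [h2]
      exact List.get_mem _ _
  · rw [evalC_prod_chr_of_ne _ (by rw [List.length_map]; exact hd), if_neg]
    rintro rfl
    exact hd rfl

/-- The functionals map `M` onto `ℤ^κ`, so the composite `ℤ^r → M → ℤ^κ` is onto. As `r ≤ |κ|`, the
Orzech property makes it injective; hence the functionals separate points of `M`. -/
theorem mem_span_of_dual {M : Type*} [AddCommGroup M] {r : ℕ} (hM : GenBy r M) {κ : Type} [Fintype κ]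
    [DecidableEq κ] (hr : r ≤ Fintype.card κ) (v : κ → M) (E : κ → M →+ ℤ)
    (hE : ∀ i j, E i (v j) = if j = i then 1 else 0) (x : M) : x = ∑ i, E i x • v i := by
  obtain ⟨f, hf⟩ := hM
  let u : M →+ (κ → ℤ) := AddMonoidHom.mk' (fun x i => E i x) fun x y => by funext i; simp
  have hu : ∀ a : κ → ℤ, u (∑ i, a i • v i) = a := fun a => by
    funext j
    change E j _ = _
    simp [hE]
  let F : (Fin r → ℤ) →ₗ[ℤ] (κ → ℤ) := (u.comp f).toIntLinearMap
  have hF : Function.Surjective F := fun a => by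
    obtain ⟨y, hy⟩ := hf (∑ i, a i • v i)
    exact ⟨y, (congrArg u hy).trans (hu a)⟩
  obtain ⟨e⟩ : Nonempty (Fin r ↪ κ) := Function.Embedding.nonempty_of_card_le (by simpa using hr)
  let i : (Fin r → ℤ) →ₗ[ℤ] (κ → ℤ) := Function.ExtendByZero.linearMap ℤ e
  have hi : Function.Injective i := fun a b hab => by
    funext j
    have := congrFun hab (e j)
    simpa [i, e.injective.extend_apply] using this
  have hinj := OrzechProperty.injective_of_surjective_of_injective i F hi hF
  obtain ⟨y, rfl⟩ := hf x
  obtain ⟨y', hy'⟩ := hf (∑ i, E i (f y) • v i)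
  rw [← hy']
  refine congrArg f (hinj ?_)
  change u (f y) = u (f y')
  rw [hy', hu]
  rfl

/-- Here the upper bound on generators meets the lower bound from the dual functionals. -/
theorem IsDualFamily.mem_closure_mono {q : ℕ} {φ : Fin N → Fin q → Chars G} {γ : Fin N → Fin q → G}
    (h : IsDualFamily φ γ) {n : ℕ} (hG : GenBy (bettiPower q N n) (HZ G n)) (a : HZ G n) :
    DirectSum.of (HZ G) n a ∈ AddSubgroup.closure
      {x | ∃ c, monoDeg c = n ∧ x = mono (fun m i => chr (φ m i)) c} := by
  let κ := {c : Fin N → Option (Fin q) // monoDeg c = n}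
  have hv : ∀ c : κ, ∃ a : HZ G n, mono (fun m i => chr (φ m i)) c.1 = DirectSum.of (HZ G) n a := by
    rintro ⟨c, rfl⟩
    exact mono_chr_mem φ c
  choose v hv using hv
  classical
  have := Fintype.ofFinite κ
  have hx := mem_span_of_dual hG (κ := κ) ((bettiPower_le_card q N n).trans (by
    rw [Nat.card_eq_fintype_card])) v (fun c => (h.functional c.1).comp (DirectSum.of (HZ G) n))
    (fun c c' => by
      rw [AddMonoidHom.comp_apply, ← hv, h.functional_mono]
      exact if_congr Subtype.ext_iff.symm rfl rfl) a
  rw [hx, map_sum]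
  refine sum_mem fun c _ => ?_
  rw [map_zsmul, ← hv]
  refine zsmul_mem (AddSubgroup.subset_closure ?_) _
  exact ⟨c.1, c.2, rfl⟩

end DualFunctionals

end McCool
end

noncomputable section
namespace McCool
open CategoryTheory
open scoped TensorProduct DirectSum

/-! ### Tensor powers of `R ⊕ W` and maps out of them -/

section TensorPower

variable {R : Type} [CommRing R] {W : Type} [AddCommGroup W] [Module R W] [Module Rᵐᵒᵖ W]
  [IsCentralScalar R W] {ι : Type}

/-- The element of `R ⊕ W` attached to an index: `1` or an element of the family `e`. -/
def optElem (e : ι → W) (o : Option ι) : TrivSqZeroExt R W := o.elim 1 fun i => .inr (e i)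

/-- The elementary tensors in elements of the family `e`. -/
def tensorMono (e : ι → W) : ∀ {N : ℕ}, (Fin N → Option ι) → (tensorPower (degOne R W) N).carrier
  | 0, _ => (1 : TrivSqZeroExt R PUnit)
  | N + 1, c => GradedTensorProduct.tmul (𝒜 := (degOne R W).grading)
      (ℬ := (tensorPower (degOne R W) N).grading) R (optElem e (c 0) : TrivSqZeroExt R W)
      (tensorMono e fun m => c m.succ)

theorem optElem_mem (e : ι → W) (o : Option ι) :
    (optElem e o : TrivSqZeroExt R W) ∈ degOneGrading R W (o.elim 0 fun _ => 1) := by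
  cases o with
  | none => exact inl_mem R W 1
  | some i => exact inr_mem R W _

theorem tensorMono_mem (e : ι → W) {N : ℕ} (c : Fin N → Option ι) :
    (tensorMono e c : (tensorPower (degOne R W) N).carrier) ∈
      (tensorPower (degOne R W) N).grading (monoDeg c) := by
  induction N with
  | zero => exact inl_mem R PUnit 1
  | succ N ih =>
    exact tmul_mem (A := degOne R W) (B := tensorPower (degOne R W) N) (monoDeg_succ c).symm
      (optElem_mem e (c 0)) (ih _)

theorem degOneGrading_le_span {e : ι → W} (he : Submodule.span R (Set.range e) = ⊤) (i : ℕ) :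
    degOneGrading R W i ≤ Submodule.span R
      {x | ∃ o : Option ι, (o.elim 0 fun _ => 1) = i ∧ x = optElem e o} := by
  intro x hx
  match i, hx with
  | 0, hx =>
    have h : x.snd = 0 := hx
    have : x = x.fst • (1 : TrivSqZeroExt R W) := by ext <;> simp [h]
    rw [this]
    exact Submodule.smul_mem _ _ (Submodule.subset_span ⟨none, rfl, rfl⟩)
  | 1, hx =>
    have h : x.fst = 0 := hx
    have h2 : x = TrivSqZeroExt.inrHom R W x.snd := by ext <;> simp [h]
    have h3 : x.snd ∈ Submodule.span R (Set.range e) := he ▸ Submodule.mem_top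
    have h4 := Submodule.mem_map_of_mem (f := TrivSqZeroExt.inrHom R W) h3
    rw [← h2, Submodule.map_span] at h4
    refine Submodule.span_mono ?_ h4
    rintro _ ⟨_, ⟨i, rfl⟩, rfl⟩
    exact ⟨some i, rfl, rfl⟩
  | n + 2, hx =>
    have h : x = 0 := hx
    rw [h]
    exact zero_mem _

theorem tensorGrading_le_span (A B : GrAlg R) {S : ℕ → Set A.carrier} {T : ℕ → Set B.carrier}
    (hS : ∀ i, A.grading i ≤ Submodule.span R (S i)) (hT : ∀ j, B.grading j ≤ Submodule.span R (T j))
    (n : ℕ) : tensorGrading A B n ≤ Submodule.span R {x | ∃ i j, i + j = n ∧ ∃ a ∈ S i, ∃ b ∈ T j,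
      x = GradedTensorProduct.tmul R a b} := by
  refine Submodule.span_le.2 ?_
  rintro _ ⟨i, k, hik, a, ha, b, hb, rfl⟩
  set Q : Submodule R (A.grading ᵍ⊗[R] B.grading) := Submodule.span R _ with hQ
  let F : A.carrier →ₗ[R] B.carrier →ₗ[R] A.grading ᵍ⊗[R] B.grading :=
    (TensorProduct.mk R A.carrier B.carrier).compr₂ (GradedTensorProduct.of R A.grading
      B.grading).toLinearMap
  have hmem : ∀ y ∈ T k, a ∈ Submodule.span R (S i) → F a y ∈ Q := by
    intro y hy ha
    refine (Submodule.span_le (p := Q.comap (F.flip y))).2 ?_ ha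
    exact fun x hx => Submodule.subset_span ⟨i, k, hik, x, hx, y, hy, rfl⟩
  refine (Submodule.span_le (p := Q.comap (F a))).2 ?_ (hT k hb)
  exact fun y hy => hmem y hy (hS i ha)

theorem exists_tensor_lift (A B : GrAlg R) {C : Type*} [Ring C] [Algebra R C] (f : A.carrier →ₐ[R] C)
    (g : B.carrier →ₐ[R] C) (h : ∀ i j, ∀ a ∈ A.grading i, ∀ b ∈ B.grading j,
      f a * g b = (-1 : ℤˣ) ^ (j * i) • (g b * f a)) :
    ∃ Φ : (tensor A B).carrier →ₐ[R] C, ∀ a b, Φ (GradedTensorProduct.tmul (𝒜 := A.grading)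
      (ℬ := B.grading) R a b) = f a * g b :=
  ⟨GradedTensorProduct.lift A.grading B.grading f g fun i j a b => h i j a a.2 b b.2, fun _ _ => rfl⟩

theorem grading_le_span {e : ι → W} (he : Submodule.span R (Set.range e) = ⊤) (N j : ℕ) :
    (tensorPower (degOne R W) N).grading j ≤
      Submodule.span R {x | ∃ c, monoDeg c = j ∧ x = tensorMono e c} := by
  induction N generalizing j with
  | zero =>
    intro x hx
    change x ∈ degOneGrading R PUnit j at hx
    match j, hx with
    | 0, hx =>
      have : x = (TrivSqZeroExt.fst x : R) • (1 : TrivSqZeroExt R PUnit) := by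
        refine TrivSqZeroExt.ext ?_ rfl
        simp
      rw [this]
      exact Submodule.smul_mem _ _ (Submodule.subset_span ⟨Fin.elim0, rfl, rfl⟩)
    | 1, hx =>
      have h : x = (0 : TrivSqZeroExt R PUnit) := TrivSqZeroExt.ext hx rfl
      rw [h]
      exact zero_mem _
    | n + 2, hx =>
      have h : x = (0 : TrivSqZeroExt R PUnit) := hx
      rw [h]
      exact zero_mem _
  | succ N ih =>
    refine (tensorGrading_le_span (degOne R W) (tensorPower (degOne R W) N)
      (degOneGrading_le_span he) ih j).trans (Submodule.span_mono ?_)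
    rintro _ ⟨i, k, hik, _, ⟨o, ho, rfl⟩, _, ⟨c, hc, rfl⟩, rfl⟩
    refine ⟨Fin.cons o c, ?_, rfl⟩
    rw [monoDeg_succ]
    exact (congrArg₂ (· + ·) ho hc).trans hik

theorem mem_span_tensorMono {e : ι → W} (he : Submodule.span R (Set.range e) = ⊤) (N : ℕ)
    (t : (tensorPower (degOne R W) N).carrier) :
    t ∈ Submodule.span R (Set.range (tensorMono (R := R) (N := N) e)) := by
  induction t using DirectSum.Decomposition.inductionOn (tensorPower (degOne R W) N).grading with
  | zero => exact zero_mem _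
  | add a b h h' => exact add_mem h h'
  | homogeneous a =>
    refine Submodule.span_mono ?_ (grading_le_span he N _ a.2)
    rintro _ ⟨c, -, rfl⟩
    exact ⟨c, rfl⟩

variable {C : Type*} [Ring C] [Algebra R C]

/-- The square-zero relation extends each `f m` to `R ⊕ W`, and anticommutation supplies the Koszul
sign needed to combine the factors in the graded tensor product. -/
theorem exists_tensorLift {e : ι → W} (he : Submodule.span R (Set.range e) = ⊤) {N : ℕ}
    (f : Fin N → W →ₗ[R] C) (hsq : ∀ m w w', f m w * f m w' = 0)
    (hanti : ∀ m m' w w', f m w * f m' w' = -(f m' w' * f m w)) :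
    ∃ Φ : (tensorPower (degOne R W) N).carrier →ₐ[R] C,
      ∀ c, Φ (tensorMono e c) = mono (fun m i => f m (e i)) c := by
  induction N with
  | zero =>
    refine ⟨(Algebra.ofId R C).comp (TrivSqZeroExt.fstHom R R PUnit), fun c => ?_⟩
    exact map_one ((Algebra.ofId R C).comp (TrivSqZeroExt.fstHom R R PUnit))
  | succ N ih =>
    obtain ⟨Ψ, hΨ⟩ := ih (fun m => f m.succ) (fun m => hsq m.succ) fun m m' => hanti m.succ m'.succ
    let g : TrivSqZeroExt R W →ₐ[R] C := TrivSqZeroExt.lift (Algebra.ofId R C) (f 0) (hsq 0)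
      (fun r w => by rw [map_smul, Algebra.ofId_apply, Algebra.smul_def])
      (fun r w => by
        rw [op_smul_eq_smul, map_smul, Algebra.ofId_apply, Algebra.smul_def, Algebra.commutes])
    have hg : ∀ x, g x = algebraMap R C x.fst + f 0 x.snd := fun x => rfl
    have h : ∀ i j, ∀ a ∈ degOneGrading R W i, ∀ b ∈ (tensorPower (degOne R W) N).grading j,
        g a * Ψ b = (-1 : ℤˣ) ^ (j * i) • (Ψ b * g a) := by
      intro i j a ha b hb
      rw [hg]
      match i, ha with
      | 0, ha =>
        have : a.snd = 0 := ha
        rw [this, map_zero, add_zero, mul_zero, pow_zero, one_smul, Algebra.commutes]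
      | 1, ha =>
        have : a.fst = 0 := ha
        rw [this, map_zero, zero_add, mul_one]
        -- The sign rule is linear in `b`, so it suffices to check it on monomials of degree `j`.
        have hb' := grading_le_span he N j hb
        clear hb
        induction hb' using Submodule.span_induction with
        | zero => rw [map_zero, mul_zero, zero_mul, smul_zero]
        | add x y _ _ h h' => rw [map_add, mul_add, add_mul, smul_add, h, h']
        | smul r x _ h => rw [map_smul, mul_smul_comm, smul_mul_assoc, h, smul_comm]
        | mem x hx =>
          obtain ⟨c, rfl, rfl⟩ := hx
          rw [hΨ, mul_mono_of_anticomm _ _ fun m i => hanti _ _ _ _]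
          rcases Nat.even_or_odd (monoDeg c) with hc | hc
          · rw [hc.neg_one_pow, hc.neg_one_pow, one_mul, one_smul]
          · rw [hc.neg_one_pow, hc.neg_one_pow, neg_one_mul, Units.neg_smul, one_smul]
      | n + 2, ha =>
        have : a = 0 := ha
        simp [this]
    obtain ⟨Φ, hΦ⟩ := exists_tensor_lift (degOne R W) (tensorPower (degOne R W) N) g Ψ h
    refine ⟨Φ, fun c => ?_⟩
    rw [mono_succ]
    refine (hΦ _ _).trans (congrArg₂ (· * ·) ?_ (hΨ _))
    cases hc : c 0 with
    | none => exact map_one g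
    | some i => exact TrivSqZeroExt.lift_apply_inr _ _ _ _ _ _

end TensorPower

end McCool
end

noncomputable section
namespace McCool
open CategoryTheory
open scoped TensorProduct DirectSum

/-! ### Realizing the tensor power in a cohomology ring -/

section Realization

/-- `IsCentralScalar` for the scalar actions that come from module structures. -/
abbrev CentralModule (R W : Type) [CommRing R] [AddCommGroup W] [Module R W] [Module Rᵐᵒᵖ W] : Prop :=
  IsCentralScalar R W

variable {W : Type} [AddCommGroup W] [Module ℤ W] [Module ℤᵐᵒᵖ W] [CentralModule ℤ W]

/-- An additive map between modules over `ℤ` as a linear map. -/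
def linearOfAdd {A B : Type*} [AddCommGroup A] [AddCommGroup B] [Module ℤ A] [Module ℤ B] (f : A →+ B) :
    A →ₗ[ℤ] B where
  toFun := f
  map_add' := map_add f
  map_smul' a x := by simpa using map_intCast_smul f ℤ ℤ a x

theorem mem_closure_of_mem_span {M : Type*} [AddCommGroup M] {_ : Module ℤ M} {s : Set M} {x : M}
    (h : x ∈ Submodule.span ℤ s) : x ∈ AddSubgroup.closure s := by
  induction h using Submodule.span_induction with
  | zero => exact zero_mem _
  | add x y _ _ h h' => exact add_mem h h'
  | smul r x _ h =>
    exact (congrArg (· ∈ AddSubgroup.closure s) (int_smul_eq_zsmul _ r x)).mpr (zsmul_mem h r)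
  | mem x hx => exact AddSubgroup.subset_closure hx

theorem exists_sum_of_mem_closure_range {κ : Type*} [Fintype κ] {M : Type*} [AddCommGroup M] (v : κ → M)
    {x : M} (h : x ∈ AddSubgroup.closure (Set.range v)) : ∃ a : κ → ℤ, ∑ c, a c • v c = x := by
  rw [← Submodule.span_int_eq_addSubgroupClosure] at h
  exact (Submodule.mem_span_range_iff_exists_fun ℤ).1 h

/-- A ring homomorphism from a tensor power of `ℤ ⊕ W` to a cohomology ring, which realizes `W` by
characters pulled back from a free group. -/
theorem exists_realization {Γ Γ₀ ι : Type} [Group Γ] [Group Γ₀] [IsFreeGroup Γ₀] [Finite ι]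
    [DecidableEq ι] {N : ℕ} (p : Fin N → Γ →* Γ₀) (θ : W →+ Chars Γ₀) {e : ι → W}
    (he : Submodule.span ℤ (Set.range e) = ⊤) {γ : Fin N → ι → Γ}
    (hγ : IsDualFamily (fun m i => (θ (e i)).pullback (p m)) γ) :
    ∃ Φ : (tensorPower (degOne ℤ W) N).carrier →+* CohomologyRing Γ, Function.Injective Φ ∧
      ∀ c, Φ (tensorMono e c) = mono (fun m i => chr ((θ (e i)).pullback (p m))) c := by
  let f : Fin N → W →ₗ[ℤ] CohomologyRing Γ := fun m =>
    linearOfAdd (AddMonoidHom.mk' (fun w => chr ((θ w).pullback (p m))) fun w w' => by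
      rw [← map_add, map_add]
      rfl)
  obtain ⟨Φ, hΦ⟩ : ∃ Φ : (tensorPower (degOne ℤ W) N).carrier →+* CohomologyRing Γ,
      ∀ c, Φ (tensorMono e c) = mono (fun m i => chr ((θ (e i)).pullback (p m))) c := by
    obtain ⟨Φ, hΦ⟩ := exists_tensorLift he f (fun m w w' => chr_pullback_mul_eq_zero _ _ _)
      fun m m' w w' => chr_anticomm _ _
    exact ⟨Φ, hΦ⟩
  refine ⟨Φ, ?_, hΦ⟩
  rw [injective_iff_map_eq_zero]
  intro t ht
  have := Fintype.ofFinite ι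
  obtain ⟨a, rfl⟩ := exists_sum_of_mem_closure_range _
    (mem_closure_of_mem_span (mem_span_tensorMono he N t))
  refine Finset.sum_eq_zero fun c _ => ?_
  -- The dual functionals read off the coefficients, so an element of the kernel has all
  -- coefficients zero.
  have h1 : ∀ c', hγ.functional c (Φ (a c' • tensorMono e c')) = if c' = c then a c' else 0 := by
    intro c'
    rw [map_zsmul, map_zsmul, hΦ]
    refine (congrArg (a c' • ·) (hγ.functional_mono c c')).trans ?_
    split_ifs <;> simp
  have h4 := congrArg (hγ.functional c) ht
  rw [map_sum, map_sum, map_zero, Finset.sum_congr rfl fun c' _ => h1 c',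
    Finset.sum_ite_eq' Finset.univ c, if_pos (Finset.mem_univ c)] at h4
  rw [h4, zero_smul]

theorem map_grading_of_map_tensorMono {Γ ι : Type} [Group Γ] {N : ℕ} {e : ι → W}
    (he : Submodule.span ℤ (Set.range e) = ⊤) {φ : Fin N → ι → Chars Γ}
    {Φ : (tensorPower (degOne ℤ W) N).carrier →+* CohomologyRing Γ}
    (hΦ : ∀ c, Φ (tensorMono e c) = mono (fun m i => chr (φ m i)) c) {j : ℕ}
    {t : (tensorPower (degOne ℤ W) N).carrier} (ht : t ∈ (tensorPower (degOne ℤ W) N).grading j) :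
    ∃ a : HZ Γ j, Φ t = DirectSum.of (HZ Γ) j a := by
  have h := mem_closure_of_mem_span (grading_le_span he N j ht)
  have h2 : Φ t ∈ (DirectSum.of (HZ Γ) j).range := by
    refine (AddSubgroup.closure_le ((DirectSum.of (HZ Γ) j).range.comap (Φ : _ →+ CohomologyRing Γ))).2
      ?_ h
    rintro _ ⟨c, rfl, rfl⟩
    obtain ⟨a, ha⟩ := mono_chr_mem φ c
    exact ⟨a, ((hΦ c).trans ha).symm⟩
  obtain ⟨a, ha⟩ := h2
  exact ⟨a, ha.symm⟩

/-- A power of a free group has the cohomology ring of a product of wedges of circles. -/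
theorem exists_cohomologyRing_equiv {Γ : Type} [Group Γ] {N q : ℕ}
    (E : Γ ≃* (Fin N → FreeGroup (Fin q))) (θ : W →+ Chars (FreeGroup (Fin q))) {e : Fin q → W}
    (he : Submodule.span ℤ (Set.range e) = ⊤)
    (hθ : ∀ i j, θ (e i) (.ofMul (FreeGroup.of j)) = if i = j then 1 else 0) :
    ∃ f : CohomologyRing Γ ≃+* (tensorPower (degOne ℤ W) N).carrier,
      ∀ (i : ℕ) (x : HZ Γ i), f (DirectSum.of (HZ Γ) i x) ∈
        (tensorPower (degOne ℤ W) N).grading i := by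
  let p : Fin N → Γ →* FreeGroup (Fin q) := fun m => (Pi.evalMonoidHom _ m).comp E.toMonoidHom
  let γ : Fin N → Fin q → Γ := fun m i => E.symm (Pi.mulSingle m (FreeGroup.of i))
  have hγ : IsDualFamily (fun m i => (θ (e i)).pullback (p m)) γ := by
    refine ⟨?_, ?_⟩
    · rintro ⟨m, i⟩ ⟨m', i'⟩
      have h1 : (θ (e i)).pullback (p m) (.ofMul (γ m' i')) =
          θ (e i) (.ofMul ((Pi.mulSingle m' (FreeGroup.of i') : Fin N → FreeGroup (Fin q)) m)) := by
        change θ (e i) (.ofMul (E (E.symm _) m)) = _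
        rw [E.apply_symm_apply]
      refine h1.trans ?_
      by_cases hm : m = m'
      · subst hm
        rw [Pi.mulSingle_eq_same, hθ]
        simp
      · rw [Pi.mulSingle_eq_of_ne hm, ofMul_one, map_zero, if_neg]
        exact fun h => hm congr(($h).1)
    · intro m m' i i' hm
      exact (Pi.mulSingle_commute hm _ _).map E.symm
  obtain ⟨Φ, hinj, hΦ⟩ := exists_realization p θ he hγ
  have hof : ∀ i (x : HZ Γ i), ∃ t ∈ (tensorPower (degOne ℤ W) N).grading i,
      Φ t = DirectSum.of (HZ Γ) i x := by
    intro i x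
    -- The generator bound for `F^N` makes the monomials span each degree, which gives surjectivity.
    have h := hγ.mem_closure_mono ((genBy_freeGroup_power q N i).of_mulEquiv E) x
    refine (AddSubgroup.closure_le ((AddSubgroup.map (Φ : _ →+ CohomologyRing Γ)
      ((tensorPower (degOne ℤ W) N).grading i).toAddSubgroup))).2 ?_ h
    rintro _ ⟨c, rfl, rfl⟩
    exact ⟨_, tensorMono_mem e c, hΦ c⟩
  have hsurj : Function.Surjective Φ := fun x => by
    induction x using DirectSum.induction_on with
    | zero => exact ⟨0, map_zero Φ⟩
    | of i x =>
      obtain ⟨t, -, ht⟩ := hof i x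
      exact ⟨t, ht⟩
    | add x y hx hy =>
      obtain ⟨a, rfl⟩ := hx
      obtain ⟨b, rfl⟩ := hy
      exact ⟨a + b, map_add _ _ _⟩
  refine ⟨(RingEquiv.ofBijective Φ ⟨hinj, hsurj⟩).symm, fun i x => ?_⟩
  obtain ⟨t, ht, hx⟩ := hof i x
  rw [← hx]
  have := (RingEquiv.ofBijective Φ ⟨hinj, hsurj⟩).symm_apply_apply t
  exact this.symm ▸ ht

end Realization

/-! ### Free abelian groups recognized by dual characters -/

section CharacterLattice

/-- The target is `ℤ^M`, written as a power of the free group of rank one so that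
`genBy_freeGroup_power` also applies to free abelian groups. -/
theorem exists_mulEquiv_freeGroup_power {K : Type} [Group K] {M : ℕ} (χ : Fin M → Chars K)
    (g : Fin M → K) (hχ : ∀ i j, χ i (.ofMul (g j)) = if i = j then 1 else 0)
    (hinj : ∀ x, (∀ i, χ i (.ofMul x) = 0) → x = 1) :
    Nonempty (K ≃* (Fin M → FreeGroup (Fin 1))) := by
  let Θ : K →* (Fin M → FreeGroup (Fin 1)) :=
    MonoidHom.mk' (fun x i => FreeGroup.of 0 ^ χ i (.ofMul x)) fun x y => by
      funext i
      rw [Pi.mul_apply, Chars.map_mul, zpow_add]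
  refine ⟨MulEquiv.ofBijective Θ ⟨?_, fun x => ?_⟩⟩
  · rw [injective_iff_map_eq_one]
    intro x hx
    refine hinj x fun i => ?_
    have h1 : FreeGroup.of (0 : Fin 1) ^ χ i (.ofMul x) = 1 := congrFun hx i
    have h2 := congrArg (FreeGroup.lift fun _ : Fin 1 => Multiplicative.ofAdd (1 : ℤ)) h1
    rw [map_zpow, FreeGroup.lift_apply_of, _root_.map_one (FreeGroup.lift _), ← ofAdd_zsmul] at h2
    have h3 := congrArg Multiplicative.toAdd h2
    simpa using h3
  · change x ∈ Θ.range
    refine Subgroup.pi_mem_of_mulSingle_mem _ fun i => ?_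
    have h1 : x i ∈ Subgroup.zpowers (FreeGroup.of (0 : Fin 1)) := by
      have : Subgroup.zpowers (FreeGroup.of (0 : Fin 1)) = ⊤ := by
        rw [← FreeGroup.closure_range_of, Subgroup.zpowers_eq_closure, Set.range_unique]
        rfl
      rw [this]
      exact Subgroup.mem_top _
    obtain ⟨n, hn⟩ := Subgroup.mem_zpowers_iff.1 h1
    refine ⟨g i ^ n, ?_⟩
    rw [map_zpow, ← hn, Pi.mulSingle_zpow]
    congr 1
    funext j
    change FreeGroup.of 0 ^ χ j (.ofMul (g i)) = _
    rw [hχ]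
    by_cases h : j = i
    · subst h
      simp
    · rw [if_neg h, zpow_zero, Pi.mulSingle_eq_of_ne h]

end CharacterLattice

/-! ### The image of the cohomology of a free abelian quotient -/

section QuotientImage

variable {W : Type} [AddCommGroup W] [Module ℤ W] [Module ℤᵐᵒᵖ W] [CentralModule ℤ W]

/-- The image in cohomology of a free abelian quotient on which dual characters are defined. -/
theorem exists_range_cohomologyMap_equiv {Γ Γ₀ : Type} [Group Γ] [Group Γ₀] [IsFreeGroup Γ₀] {r : ℕ}
    {N : ℕ} (p : Fin N → Γ →* Γ₀) (θ : W →+ Chars Γ₀) {e : Fin r → W}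
    (he : Submodule.span ℤ (Set.range e) = ⊤) {γ : Fin N → Fin r → Γ}
    (hγ : IsDualFamily (fun m i => (θ (e i)).pullback (p m)) γ) (S : Subgroup Γ) [S.Normal]
    (hS : ∀ x, x ∈ S ↔ ∀ m i, (θ (e i)).pullback (p m) (.ofMul x) = 0) :
    ∃ f : (tensorPower (degOne ℤ W) N).carrier ≃+* (cohomologyMap (QuotientGroup.mk' S)).range,
      ∀ (i : ℕ), ∀ t ∈ (tensorPower (degOne ℤ W) N).grading i,
        ∃ x : HZ Γ i, (f t : CohomologyRing Γ) = DirectSum.of (HZ Γ) i x := by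
  obtain ⟨Φ, hinj, hΦ⟩ := exists_realization p θ he hγ
  set φ : Fin N → Fin r → Chars Γ := fun m i => (θ (e i)).pullback (p m)
  have hlift : ∀ m i, ∃ χ : Chars (Γ ⧸ S), χ.pullback (QuotientGroup.mk' S) = φ m i := by
    intro m i
    let F : Γ →* Multiplicative ℤ := AddMonoidHom.toMultiplicativeRight (φ m i)
    refine ⟨MonoidHom.toAdditiveLeft (QuotientGroup.lift S F fun x hx => (hS x).1 hx m i), ?_⟩
    rfl
  choose χ hχ using hlift
  let ε := finProdFinEquiv (m := N) (n := r)
  have hχγ : ∀ m i x, χ m i (.ofMul (QuotientGroup.mk' S x)) = φ m i (.ofMul x) := fun m i x => by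
    rw [← hχ]
    rfl
  have hdual : ∀ (p p' : Fin N × Fin r), χ p.1 p.2 (.ofMul (QuotientGroup.mk' S (γ p'.1 p'.2))) =
      if p = p' then 1 else 0 := fun p p' => (hχγ _ _ _).trans (hγ.dual p p')
  have hker : ∀ x : Γ ⧸ S, (∀ p : Fin N × Fin r, χ p.1 p.2 (.ofMul x) = 0) → x = 1 := by
    intro x hx
    obtain ⟨x, rfl⟩ := QuotientGroup.mk'_surjective S x
    rw [QuotientGroup.mk'_apply, QuotientGroup.eq_one_iff, hS]
    exact fun m i => (hχγ m i x).symm.trans (hx (m, i))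
  obtain ⟨E⟩ := exists_mulEquiv_freeGroup_power (K := Γ ⧸ S)
    (fun j => χ (ε.symm j).1 (ε.symm j).2)
    (fun j => QuotientGroup.mk' S (γ (ε.symm j).1 (ε.symm j).2))
    (fun i j => (hdual _ _).trans (if_congr ε.symm.injective.eq_iff rfl rfl))
    (fun x hx => hker x fun p => by
      have h := hx (ε p)
      simp only [Equiv.symm_apply_apply] at h
      exact h)
  have hcomm : ∀ x y : Γ ⧸ S, Commute x y := fun x y => by
    refine mul_inv_eq_one.1 (hker _ fun p => ?_)
    rw [Chars.map_mul, Chars.map_mul, ofMul_inv, map_neg, Chars.map_mul]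
    ring
  -- In the quotient, which is `ℤ^{Nr}`, every pair `(m, i)` becomes a separate factor of rank one.
  have hfam : IsDualFamily (fun (j : Fin (N * r)) (_ : Fin 1) => χ (ε.symm j).1 (ε.symm j).2)
      (fun j _ => QuotientGroup.mk' S (γ (ε.symm j).1 (ε.symm j).2)) := by
    refine ⟨?_, fun _ _ _ _ _ => hcomm _ _⟩
    rintro ⟨j, i⟩ ⟨j', i'⟩
    refine (hdual _ _).trans (if_congr (ε.symm.injective.eq_iff.trans ?_) rfl rfl)
    simp [Subsingleton.elim i i']
  -- A single character is the monomial supported at one place.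
  have hφ : ∀ m i, chr (φ m i) ∈ Φ.range := by
    intro m i
    have h := hΦ fun m' => if m' = m then some i else none
    rw [mono_eq_prod] at h
    have hs : suppList (fun m' => if m' = m then some i else none) = [(m, i)] := by
      rw [← List.perm_singleton, List.perm_ext_iff_of_nodup (suppList_nodup _) (List.nodup_singleton _)]
      rintro ⟨m', i'⟩
      rw [mem_suppList, List.mem_singleton]
      split_ifs with hm <;> simp_all [eq_comm]
    rw [hs] at h
    exact ⟨_, h.trans List.prod_singleton⟩
  -- Both subrings are generated by the classes `chr (φ m i)`.
  have hrange : Φ.range = (cohomologyMap (QuotientGroup.mk' S)).range := by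
    refine le_antisymm ?_ ?_
    · rintro _ ⟨t, rfl⟩
      have ht := mem_closure_of_mem_span (mem_span_tensorMono he N t)
      refine (AddSubgroup.closure_le ((cohomologyMap
        (QuotientGroup.mk' S)).range.toAddSubgroup.comap (Φ : _ →+ CohomologyRing Γ))).2 ?_ ht
      rintro _ ⟨c, rfl⟩
      change Φ _ ∈ (cohomologyMap (QuotientGroup.mk' S)).range
      rw [hΦ]
      refine ⟨mono (fun m i => chr (χ m i)) c, ?_⟩
      have := map_mono (cohomologyMap (QuotientGroup.mk' S) : CohomologyRing (Γ ⧸ S) →* CohomologyRing Γ)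
        (fun m i => chr (χ m i)) c
      refine this.trans ?_
      congr 1
      funext m i
      exact (cohomologyMap_chr _ _).trans (congrArg chr (hχ m i))
    · rintro _ ⟨x, rfl⟩
      induction x using DirectSum.induction_on with
      | zero => rw [map_zero]; exact zero_mem _
      | add x y hx hy => rw [map_add]; exact add_mem hx hy
      | of i x =>
        have h := hfam.mem_closure_mono ((genBy_freeGroup_power 1 (N * r) i).of_mulEquiv E) x
        refine (AddSubgroup.closure_le ((Φ.range.toAddSubgroup).comap
          (cohomologyMap (QuotientGroup.mk' S) : CohomologyRing (Γ ⧸ S) →+ CohomologyRing Γ))).2 ?_ h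
        rintro _ ⟨c, rfl, rfl⟩
        have := map_mono (cohomologyMap (QuotientGroup.mk' S) : CohomologyRing (Γ ⧸ S) →* CohomologyRing Γ)
          (fun (j : Fin (N * r)) (_ : Fin 1) => chr (χ (ε.symm j).1 (ε.symm j).2)) c
        change (cohomologyMap (QuotientGroup.mk' S)) _ ∈ Φ.range
        refine this.symm ▸ ?_
        rw [mono_eq_prod]
        refine list_prod_mem fun y hy => ?_
        obtain ⟨p, -, rfl⟩ := List.mem_map.1 hy
        have h2 := (cohomologyMap_chr (QuotientGroup.mk' S) (χ (ε.symm p.1).1 (ε.symm p.1).2)).trans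
          (congrArg chr (hχ _ _))
        exact h2.symm ▸ hφ _ _
  let f1 : (tensorPower (degOne ℤ W) N).carrier ≃+* Φ.range :=
    RingEquiv.ofBijective Φ.rangeRestrict
      ⟨fun a b h => hinj congr(($h).1), Φ.rangeRestrict_surjective⟩
  refine ⟨f1.trans (RingEquiv.subringCongr hrange), fun i t ht => ?_⟩
  exact map_grading_of_map_tensorMono he hΦ ht

end QuotientImage

end McCool
end

noncomputable section
namespace McCool
open CategoryTheory
open scoped TensorProduct DirectSum

/-! ### Freeness of the partial conjugations of one generator -/

section PartialConjugations

variable {n q : ℕ} (i : Fin n) (hq : q ≤ i)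

theorem alpha_apply_self (i j : Fin n) : alpha i j (FreeGroup.of i) =
    FreeGroup.of j * FreeGroup.of i * (FreeGroup.of j)⁻¹ := by
  change conjHom i (FreeGroup.of j) (FreeGroup.of i) = _
  rw [conjHom, FreeGroup.lift_apply_of, if_pos rfl]

theorem alpha_apply_of_ne {i r : Fin n} (j : Fin n) (h : r ≠ i) :
    alpha i j (FreeGroup.of r) = FreeGroup.of r := by
  change conjHom i (FreeGroup.of j) (FreeGroup.of r) = _
  rw [conjHom, FreeGroup.lift_apply_of, if_neg h]

/-- An element of `Fin q` as an index smaller than `i`. -/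
def lowIndex (j : Fin q) : Fin n := ⟨j, j.2.trans (hq.trans_lt i.2)⟩

theorem lowIndex_lt (j : Fin q) : lowIndex i hq j < i := Fin.lt_def.2 (j.2.trans_le hq)

/-- The homomorphism from a free group to the automorphism group that takes the generators to the
`α_{ij}` with fixed `i`. -/
def alphaHom : FreeGroup (Fin q) →* MulAut (FreeGroup (Fin n)) :=
  FreeGroup.lift fun j => alpha i (lowIndex i hq j)

/-- The homomorphism of free groups that takes a generator to the inverse of a generator. -/
def invHom : FreeGroup (Fin q) →* FreeGroup (Fin n) :=
  FreeGroup.lift fun j => (FreeGroup.of (lowIndex i hq j))⁻¹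

theorem alphaHom_apply_of_ne (w : FreeGroup (Fin q)) {r : Fin n} (h : r ≠ i) :
    alphaHom i hq w (FreeGroup.of r) = FreeGroup.of r := by
  induction w using FreeGroup.induction_on with
  | C1 => rw [map_one]; rfl
  | of j => rw [alphaHom, FreeGroup.lift_apply_of, alpha_apply_of_ne _ h]
  | inv_of j ih => rw [map_inv, MulAut.inv_apply, MulEquiv.symm_apply_eq, ih]
  | mul a b ha hb => rw [map_mul, MulAut.mul_apply, hb, ha]

theorem alphaHom_invHom (w v : FreeGroup (Fin q)) : alphaHom i hq w (invHom i hq v) = invHom i hq v := by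
  have : ((alphaHom i hq w).toMonoidHom.comp (invHom i hq)) = invHom i hq := by
    ext j
    change alphaHom i hq w (invHom i hq (FreeGroup.of j)) = _
    rw [invHom, FreeGroup.lift_apply_of, map_inv, alphaHom_apply_of_ne i hq w (lowIndex_lt i hq j).ne]
  exact DFunLike.congr_fun this v

/-- Composition of partial conjugations reverses the order of the conjugating words; inverting the
letters in `invHom` compensates for this. -/
theorem alphaHom_apply_self (w : FreeGroup (Fin q)) : alphaHom i hq w (FreeGroup.of i) =
    (invHom i hq w)⁻¹ * FreeGroup.of i * invHom i hq w := by
  induction w using FreeGroup.induction_on with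
  | C1 => rw [map_one, map_one]; simp
  | of j => rw [alphaHom, FreeGroup.lift_apply_of, alpha_apply_self, invHom, FreeGroup.lift_apply_of,
      inv_inv]
  | inv_of j ih =>
    rw [map_inv, MulAut.inv_apply, MulEquiv.symm_apply_eq, map_inv, inv_inv, map_mul, map_mul, map_inv,
      alphaHom_invHom, ih]
    group
  | mul a b ha hb =>
    rw [map_mul, MulAut.mul_apply, hb, map_mul, map_mul, map_inv, alphaHom_invHom, ha, map_mul]
    group

/-- The action of a group on itself by left multiplication, with a fixed point added. -/
def optionAction (L : Type) [Group L] : L →* Equiv.Perm (Option L) :=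
  MonoidHom.mk' (fun w => (Equiv.mulLeft w).optionCongr) fun a b => by
    ext x
    cases x <;> simp [mul_assoc]

/-- A homomorphism to permutations, by which an element of the free group on the small indices that
commutes with the generator `i` is seen to be trivial. -/
def pingPong : FreeGroup (Fin n) →* Equiv.Perm (Option (FreeGroup (Fin q))) :=
  FreeGroup.lift fun r => if h : (r : ℕ) < q then (optionAction _ (FreeGroup.of ⟨r, h⟩))⁻¹
    else Equiv.swap none (some 1)

theorem pingPong_invHom (w : FreeGroup (Fin q)) : pingPong (invHom i hq w) = optionAction _ w := by
  have : pingPong.comp (invHom i hq) = optionAction (FreeGroup (Fin q)) := by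
    ext1 j
    rw [MonoidHom.comp_apply, invHom, FreeGroup.lift_apply_of, map_inv, pingPong,
      FreeGroup.lift_apply_of, dif_pos (show ((lowIndex i hq j : Fin n) : ℕ) < q from j.2), inv_inv]
    rfl
  exact DFunLike.congr_fun this w

/-- If `w` acts trivially, then `invHom w` commutes with `x_i`. Under `pingPong`, `x_i` exchanges
the extra point with `1`, whereas `invHom w` fixes the extra point and acts as left multiplication
by `w` elsewhere; comparing the images of the extra point gives `w = 1`. -/
theorem alphaHom_injective : Function.Injective (alphaHom i hq) := by
  rw [injective_iff_map_eq_one]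
  intro w hw
  have h1 := alphaHom_apply_self i hq w
  rw [hw, MulAut.one_apply, mul_assoc, eq_inv_mul_iff_mul_eq] at h1
  have h2 := congrArg (pingPong (q := q)) h1
  rw [map_mul, map_mul, pingPong_invHom] at h2
  have h3 := DFunLike.congr_fun h2 none
  have h4 : pingPong (q := q) (FreeGroup.of i) = Equiv.swap none (some 1) := by
    rw [pingPong, FreeGroup.lift_apply_of, dif_neg (not_lt.2 hq)]
  rw [h4, Equiv.Perm.mul_apply, Equiv.Perm.mul_apply, Equiv.swap_apply_left] at h3
  simpa [optionAction] using h3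

end PartialConjugations

/-! ### `H(n,k)` as a power of a free group -/

section GroupH

theorem nonempty_subgroupG_equiv (n k m : ℕ) (hk : 1 ≤ k) (hm : m ∈ Set.Icc k n) :
    Nonempty (FreeGroup (Fin (k - 1)) ≃* subgroupG n m (k - 1)) := by
  obtain ⟨hkm, hmn⟩ := hm
  let i : Fin n := ⟨m - 1, by omega⟩
  have hq : k - 1 ≤ i := Nat.sub_le_sub_right hkm 1
  have hmem : ∀ j : Fin (k - 1), alpha i (lowIndex i hq j) ∈ upperMcCool n := fun j =>
    Subgroup.subset_closure ⟨i, _, lowIndex_lt i hq j, rfl⟩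
  let Θ : FreeGroup (Fin (k - 1)) →* upperMcCool n := FreeGroup.lift fun j => ⟨_, hmem j⟩
  have hΘ : (upperMcCool n).subtype.comp Θ = alphaHom i hq := by
    ext1 j
    rw [MonoidHom.comp_apply, FreeGroup.lift_apply_of, alphaHom, FreeGroup.lift_apply_of]
    rfl
  have hinj : Function.Injective Θ := by
    have h := alphaHom_injective i hq
    rw [← hΘ, MonoidHom.coe_comp] at h
    exact Function.Injective.of_comp h
  have hrange : Θ.range = subgroupG n m (k - 1) := by
    rw [FreeGroup.range_lift_eq_closure, subgroupG]
    congr 1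
    ext a
    constructor
    · rintro ⟨j, rfl⟩
      exact ⟨i, lowIndex i hq j, by simp only [i]; omega, j.2, rfl⟩
    · rintro ⟨i', r, hi, hr, ha⟩
      obtain rfl : i' = i := Fin.ext (by simp only [i]; omega)
      exact ⟨⟨r, hr⟩, Subtype.ext ha.symm⟩
  exact ⟨(MonoidHom.ofInjective hinj).trans (MulEquiv.subgroupCongr hrange)⟩

theorem nonempty_groupH_equiv (n k : ℕ) (hk : 1 ≤ k) (hkn : k ≤ n) :
    Nonempty (groupH n k ≃* (Fin (n - k + 1) → FreeGroup (Fin (k - 1)))) := by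
  have e : ∀ m : Set.Icc k n, FreeGroup (Fin (k - 1)) ≃* subgroupG n m (k - 1) := fun m =>
    Classical.choice (nonempty_subgroupG_equiv n k m hk m.2)
  have hc : Fintype.card (Set.Icc k n) = n - k + 1 := by
    rw [← Set.toFinset_card, Set.toFinset_Icc, Nat.card_Icc]
    omega
  have E := Fintype.equivFinOfCardEq hc
  exact ⟨(MulEquiv.piCongrRight fun m => (e m).symm).trans
    (MulEquiv.arrowCongr E (MulEquiv.refl _))⟩

end GroupH

/-! ### Descending central series of a power and the graded quotients -/

section CentralSeries

theorem map_mem_dcs {G K : Type} [Group G] [Group K] (f : G →* K) {s : ℕ} {x : G} (hx : x ∈ dcs G s) :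
    f x ∈ dcs K s := by
  have h := Subgroup.mem_map_of_mem f hx
  rw [Subgroup.map_lowerCentralSeries] at h
  exact Subgroup.lowerCentralSeries_mono _ le_top h

/-- The homomorphism induced on a stage of the descending central series. -/
def dcsMap {G K : Type} [Group G] [Group K] (f : G →* K) (s : ℕ) : dcs G s →* dcs K s :=
  (f.comp (dcs G s).subtype).codRestrict _ fun x => map_mem_dcs f x.2

variable {W : Type} [AddCommGroup W] [Module ℤ W] [Module ℤᵐᵒᵖ W] [CentralModule ℤ W]

theorem exists_cohomologyRing_equiv_of_basis {Γ : Type} [Group Γ] {N q : ℕ}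
    (E : Γ ≃* (Fin N → FreeGroup (Fin q))) (b : Module.Basis (Fin q) ℤ W) :
    ∃ f : CohomologyRing Γ ≃+* (tensorPower (degOne ℤ W) N).carrier,
      ∀ (i : ℕ) (x : HZ Γ i), f (DirectSum.of (HZ Γ) i x) ∈
        (tensorPower (degOne ℤ W) N).grading i := by
  let θ : W →+ Chars (FreeGroup (Fin q)) := AddMonoidHom.mk' (fun w =>
    MonoidHom.toAdditiveLeft (FreeGroup.lift fun j => Multiplicative.ofAdd (b.repr w j))) fun w w' => by
      apply MonoidHom.toAdditiveLeft.symm.injective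
      ext j
      simp
  refine exists_cohomologyRing_equiv E θ b.span_eq fun i j => ?_
  change Multiplicative.toAdd (FreeGroup.lift _ (FreeGroup.of j)) = _
  rw [FreeGroup.lift_apply_of, toAdd_ofAdd, b.repr_self, Finsupp.single_apply]

theorem mem_dcs_iff_of_power {H F : Type} [Group H] [Group F] {N : ℕ} (E : H ≃* (Fin N → F)) {s : ℕ}
    (x : H) : x ∈ dcs H s ↔ ∀ m, E x m ∈ dcs F s := by
  constructor
  · exact fun hx m => map_mem_dcs ((Pi.evalMonoidHom _ m).comp E.toMonoidHom) hx
  · intro h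
    have h1 : E x ∈ (dcs H s).comap E.symm.toMonoidHom := by
      refine Subgroup.pi_mem_of_mulSingle_mem _ fun m => ?_
      exact map_mem_dcs (E.symm.toMonoidHom.comp (MonoidHom.mulSingle (fun _ => F) m)) (h m)
    simpa using h1

/-- A functional on `L_s[V]` becomes a character of `Γ^s F` through `lieLead`. Preimages of a basis
of `L_s[V]`, placed in the separate factors, form the dual family, and the common kernel of the
characters is `Γ^{s+1} H`. -/
theorem exists_range_toGrDCS_equiv {H : Type} [Group H] {N q s : ℕ} (hs : 1 ≤ s)
    (E : H ≃* (Fin N → FreeGroup (Fin q))) :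
    ∃ f : (tensorPower (zPlusLieDual s q) N).carrier ≃+* (cohomologyMap (toGrDCS H s)).range,
      ∀ (i : ℕ), ∀ t ∈ (tensorPower (zPlusLieDual s q) N).grading i,
        ∃ x : HZ (dcs H s) i, (f t : CohomologyRing (dcs H s)) = DirectSum.of (HZ (dcs H s)) i x := by
  let b := Module.finBasis ℤ (freeLiePart ℤ (Fin q → ℤ) s)
  let p : Fin N → dcs H s →* dcs (FreeGroup (Fin q)) s := fun m =>
    dcsMap ((Pi.evalMonoidHom _ m).comp E.toMonoidHom) s
  let θ : Module.Dual ℤ (freeLiePart ℤ (Fin q → ℤ) s) →+ Chars (dcs (FreeGroup (Fin q)) s) :=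
    AddMonoidHom.mk' (fun w => w.toAddMonoidHom.comp (MonoidHom.toAdditiveLeft (lieLead q hs)))
      fun w w' => rfl
  have hθ : ∀ m i x, (θ (b.dualBasis i)).pullback (p m) (.ofMul x) =
      b.repr (lieLead q hs (p m x)).toAdd i := fun m i x => b.dualBasis_apply i _
  choose g hg using fun i => lieLead_surjective q hs (.ofAdd (b i))
  let γ : Fin N → Fin _ → dcs H s := fun m i =>
    dcsMap (E.symm.toMonoidHom.comp (MonoidHom.mulSingle (fun _ => FreeGroup (Fin q)) m)) s (g i)
  have hγ : ∀ m i, E (γ m i : H) = Pi.mulSingle m (g i : FreeGroup (Fin q)) :=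
    fun m i => E.apply_symm_apply _
  -- The freeness required of the target of `p` is Nielsen–Schreier for `Γ^s F`.
  refine exists_range_cohomologyMap_equiv p θ b.dualBasis.span_eq (γ := γ) ⟨?_, ?_⟩ _ fun x => ?_
  · rintro ⟨m, i⟩ ⟨m', i'⟩
    refine (hθ _ _ _).trans ?_
    by_cases hm : m = m'
    · subst hm
      have h1 : p m (γ m i') = g i' := Subtype.ext (by
        change E (γ m i' : H) m = _
        rw [hγ, Pi.mulSingle_eq_same])
      rw [h1, hg, toAdd_ofAdd, b.repr_self, Finsupp.single_apply]
      simp [eq_comm]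
    · have h1 : p m (γ m' i') = 1 := Subtype.ext (by
        change E (γ m' i' : H) m = _
        rw [hγ, Pi.mulSingle_eq_of_ne hm]
        rfl)
      rw [h1, map_one, toAdd_one, map_zero]
      exact (if_neg fun h : (m, i) = (m', i') => hm congr(($h).1)).symm
  · intro m m' i i' hm
    refine Subtype.ext (E.injective ?_)
    change E ((γ m i : H) * γ m' i') = E ((γ m' i' : H) * γ m i)
    rw [map_mul, map_mul, hγ, hγ]
    exact Pi.mulSingle_commute hm _ _
  · rw [Subgroup.mem_subgroupOf, mem_dcs_iff_of_power E]
    refine forall_congr' fun m => ?_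
    have h1 : E x m ∈ dcs (FreeGroup (Fin q)) (s + 1) ↔ p m x ∈ (lieLead q hs).ker := by
      rw [ker_lieLead, Subgroup.mem_subgroupOf]
      rfl
    rw [h1, MonoidHom.mem_ker]
    simp only [hθ]
    rw [← toAdd_eq_zero, ← b.repr.map_eq_zero_iff, Finsupp.ext_iff]
    rfl

end CentralSeries

end McCool
end

theorem mainTheorem8 (n k : ℕ) (hk : 2 ≤ k) (hkn : k ≤ n) :
    -- the integral cohomology algebra of `H(n,k)`
    (∃ e : McCool.CohomologyRing (McCool.groupH n k) ≃+*
        (McCool.tensorPower (McCool.zPlusLieDual 1 (k - 1)) (n - k + 1)).carrier,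
      ∀ (i : ℕ) (x : McCool.HZ (McCool.groupH n k) i),
        e (DirectSum.of (McCool.HZ (McCool.groupH n k)) i x) ∈
          (McCool.tensorPower (McCool.zPlusLieDual 1 (k - 1)) (n - k + 1)).grading i) ∧
    (∃ e : McCool.CohomologyRing (McCool.groupH n k) ≃+*
        (McCool.tensorPower (McCool.zPlusDual (k - 1)) (n - k + 1)).carrier,
      ∀ (i : ℕ) (x : McCool.HZ (McCool.groupH n k) i),
        e (DirectSum.of (McCool.HZ (McCool.groupH n k)) i x) ∈
          (McCool.tensorPower (McCool.zPlusDual (k - 1)) (n - k + 1)).grading i) ∧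
    -- the image of `H^*(gr_s H(n,k))` in the integral cohomology algebra of `Γ^s H(n,k)`
    (∀ s : ℕ, 1 ≤ s →
      ∃ e : (McCool.tensorPower (McCool.zPlusLieDual s (k - 1)) (n - k + 1)).carrier ≃+*
          (McCool.cohomologyMap (McCool.toGrDCS (McCool.groupH n k) s)).range,
        ∀ (i : ℕ), ∀ t ∈ (McCool.tensorPower (McCool.zPlusLieDual s (k - 1)) (n - k + 1)).grading i,
          ∃ x : McCool.HZ (McCool.dcs (McCool.groupH n k) s) i,
            (e t : McCool.CohomologyRing (McCool.dcs (McCool.groupH n k) s)) =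
              DirectSum.of (McCool.HZ (McCool.dcs (McCool.groupH n k) s)) i x) := by
  obtain ⟨E⟩ := McCool.nonempty_groupH_equiv n k (by omega) hkn
  refine ⟨?_, ?_, fun s hs => ?_⟩
  -- The standard basis is carried through `V ≅ L_1[V]` before passing to the dual.
  · exact McCool.exists_cohomologyRing_equiv_of_basis E
      ((Pi.basisFun ℤ (Fin (k - 1))).map McCool.freeLiePartOne).dualBasis
  · exact McCool.exists_cohomologyRing_equiv_of_basis E (Pi.basisFun ℤ (Fin (k - 1))).dualBasis
  · exact McCool.exists_range_toGrDCS_equiv hs E
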